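/- **Setting.** Consider the two-Higgs-doublet model (2HDM) on four-dimensional Minkowski space with metric $\mathrm{diag}(1,-1,-1,-1)$. Its 24 real fields $y^i$ are the scalars $\phi_1,\dots,\phi_8$ and the gauge fields $B_\mu$, $W^a_\mu$ ($0\le\mu\le3$, $1\le a\le3$). The doublets are $\Phi_1=\tfrac1{\sqrt2}(\phi_1+i\phi_2,\ \phi_3+i\phi_4)^T$ and $\Phi_2=\tfrac1{\sqrt2}(\phi_5+i\phi_6,\ \phi_7+i\phi_8)^T$, and the Lagrangian is $$\mathcal L=-\tfrac14W^a_{\mu\nu}W^{a\mu\nu}-\tfrac14B_{\mu\nu}B^{\mu\nu}+\sum_{n=1}^2(D_\mu\Phi_n)^\dagger(D^\mu\Phi_n)-V(\Phi_1,\Phi_2),$$ where $D_\mu=\partial_\mu+ig\frac{\sigma^a}2W^a_\mu+ig'YB_\mu$, $\;B_{\mu\nu}=\partial_\mu B_\nu-\partial_\nu B_\mu$, $\;W^a_{\mu\nu}=\partial_\mu W^a_\nu-\partial_\nu W^a_\mu+s\,g\,\epsilon^{abc}W^b_\mu W^c_\nu$. Here $g,g',Y$ are nonzero real numbers, and $s\in\{1,-1\}$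 is a sign convention (the result holds for either sign). The potential is the general renormalizable one, $$V=m_{11}^2\Phi_1^\dagger\Phi_1+m_{22}^2\Phi_2^\dagger\Phi_2-[m_{12}^2\Phi_1^\dagger\Phi_2+\text{h.c.}]+\tfrac{\lambda_1}2(\Phi_1^\dagger\Phi_1)^2+\tfrac{\lambda_2}2(\Phi_2^\dagger\Phi_2)^2+\lambda_3(\Phi_1^\dagger\Phi_1)(\Phi_2^\dagger\Phi_2)+\lambda_4(\Phi_1^\dagger\Phi_2)(\Phi_2^\dagger\Phi_1)+\big[\tfrac{\lambda_5}2(\Phi_1^\dagger\Phi_2)^2+\lambda_6(\Phi_1^\dagger\Phi_1)(\Phi_1^\dagger\Phi_2)+\lambda_7(\Phi_2^\dagger\Phi_2)(\Phi_1^\dagger\Phi_2)+\text{h.c.}\big],$$ with $m_{12}^2,\lambda_5,\lambda_6,\lambda_7$ complex, the other parameters real, and all of them arbitrary. A change of Higgs basis replaces $(\Phi_1,\Phi_2)^T$ by $(\hat\Phi_1,\hat\Phi_2)^T=U(\Phi_1,\Phi_2)^T$ with $U\in U(2)$, and the parameters of $V$ by those of the potential $\hat V$ with $\hat V(\hat\Phi_1,\hat\Phi_2)=V(\Phi_1,\Phi_2)$.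 **Symmetries.** For a smooth vector field $X=\xi^\mu(x,y)\partial_{x^\mu}+\eta^i(x,y)\partial_{y^i}$ on $\mathbb R^{4+24}$ let $\operatorname{pr}X$ be its prolongation to jet space. With $E_i(\mathcal L)=\frac{\partial\mathcal L}{\partial y^i}-d_\mu\frac{\partial\mathcal L}{\partial y^i_{,\mu}}$ ($d_\mu$ the total derivative), $X$ is * a Lie point symmetry of the field equations if, for every $i$, $\operatorname{pr}X(E_i(\mathcal L))=0$ at all jets at which $E(\mathcal L)=0$; * variational if $\operatorname{pr}X(\mathcal L)+\mathcal L\,d_\mu\xi^\mu=d_\mu\beta^\mu$ for some smooth functions $\beta^\mu$ of $x$, $y$ and finitely many derivatives of $y$, and strictly variational if this holds with $\beta^\mu=0$ for all $\mu$; * a divergence symmetry if it is variational but not strictly variational, and a non-variational symmetry if it is a Lie point symmetry of the field equations but not variational. $X$ is scalar if $\xi^\mu=0$ for all $\mu$ and $\eta^i=0$ for every gauge field $y^i$ (the remaining $\eta^i$ may be arbitrary smooth functions of $(x,y)$). Put $$\begin{aligned}H_1&=\phi_6\partial_{\phi_1}-\phi_5\partial_{\phi_2}+\phi_8\partial_{\phi_3}-\phi_7\partial_{\phi_4}+\phi_2\partial_{\phi_5}-\phi_1\partial_{\phi_6}+\phi_4\partial_{\phi_7}-\phi_3\partial_{\phi_8},\\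 H_2&=\phi_5\partial_{\phi_1}+\phi_6\partial_{\phi_2}+\phi_7\partial_{\phi_3}+\phi_8\partial_{\phi_4}-\phi_1\partial_{\phi_5}-\phi_2\partial_{\phi_6}-\phi_3\partial_{\phi_7}-\phi_4\partial_{\phi_8},\\ H_3&=\phi_2\partial_{\phi_1}-\phi_1\partial_{\phi_2}+\phi_4\partial_{\phi_3}-\phi_3\partial_{\phi_4}-\phi_6\partial_{\phi_5}+\phi_5\partial_{\phi_6}-\phi_8\partial_{\phi_7}+\phi_7\partial_{\phi_8},\\ X_Y&=-\phi_2\partial_{\phi_1}+\phi_1\partial_{\phi_2}-\phi_4\partial_{\phi_3}+\phi_3\partial_{\phi_4}-\phi_6\partial_{\phi_5}+\phi_5\partial_{\phi_6}-\phi_8\partial_{\phi_7}+\phi_7\partial_{\phi_8}.\end{aligned}$$ **Theorem.** 1. For all values of the parameters of $V$, the scalar Lie point symmetries of the field equations $E(\mathcal L)=0$ form a real Lie algebra under the bracket of vector fields, which is isomorphic to exactly one of $$\mathfrak{su}(2)\oplus\mathfrak u(1)_Y,\qquad \mathfrak u(1)\oplus\mathfrak u(1)_Y,\qquad \mathfrak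 u(1)_Y.$$ In a suitable Higgs basis it equals, respectively, $\operatorname{span}(H_1,H_2,H_3,X_Y)$, $\operatorname{span}(H_3,X_Y)$ or $\operatorname{span}(X_Y)$; which of these three spans can be reached by a change of Higgs basis is uniquely determined, and corresponds to the isomorphism type. 2. Each of these three spans is the algebra of scalar Lie point symmetries for some choice of the parameters of $V$. 3. For all values of the parameters of $V$ and every scalar $X$, the following are equivalent: $X$ is a Lie point symmetry of the field equations; $X$ is variational; $X$ is strictly variational. In particular, the 2HDM has no scalar Lie point divergence symmetries and no scalar non-variational Lie point symmetries. -/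

import Mathlib

open scoped ContDiff Matrix

noncomputable section

namespace THDM

/-! ### Jets, total derivatives, generators and their prolongations -/

/-- Labels of the 24 dependent variables: the 8 real scalars `φ₁, …, φ₈`, the components `B_μ`,
and the components `W^a_μ`. -/
abbrev FieldIx : Type := Fin 8 ⊕ (Fin 4 ⊕ (Fin 3 × Fin 4))

/-- Label of the scalar `φ_{k+1}`. -/
abbrev iφ (k : Fin 8) : FieldIx := Sum.inl k

/-- Label of the gauge field component `B_μ`. -/
abbrev iB (μ : Fin 4) : FieldIx := Sum.inr (Sum.inl μ)

/-- Label of the gauge field component `W^a_μ`. -/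
abbrev iW (a : Fin 3) (μ : Fin 4) : FieldIx := Sum.inr (Sum.inr (a, μ))

/-- Spacetime `ℝ⁴`. -/
abbrev Spacetime : Type := Fin 4 → ℝ

/-- The space `ℝ^{4+24}` of independent and dependent variables `(x, y)`. -/
abbrev Vars : Type := Spacetime × (FieldIx → ℝ)

/-- Multi-indices `J = (j₀, j₁, j₂, j₃)`. -/
abbrev MIx : Type := Fin 4 → ℕ

/-- The multi-index with a single 1 in place `μ`. -/
abbrev unitIx (μ : Fin 4) : MIx := Pi.single μ 1

/-- The infinite jet space, with coordinates `x^μ` and `y^i_J`. -/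
abbrev Jet : Type := Spacetime × (FieldIx → MIx → ℝ)

/-- The projection of jets to the variables `(x, y)`. -/
def base (j : Jet) : Vars := (j.1, fun i => j.2 i 0)

/-- Local functions: smooth functions of `x` and finitely many of the derivatives `y^i_J`. -/
def IsLocalFunction (f : Jet → ℝ) : Prop :=
  ∃ (S : Finset (FieldIx × MIx)) (F : Spacetime × (S → ℝ) → ℝ),
    ContDiff ℝ ∞ F ∧ ∀ j : Jet, f j = F (j.1, fun s => j.2 s.1.1 s.1.2)

/-- The partial derivative `∂f/∂y^i_J`. -/
def partialY (i : FieldIx) (J : MIx) (f : Jet → ℝ) (j : Jet) : ℝ :=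
  lineDeriv ℝ f j (0, Pi.single i (Pi.single J 1))

/-- The total derivative `d_μ f = ∂f/∂x^μ + ∑ y^i_{J+μ} ∂f/∂y^i_J`. -/
def totalDeriv (μ : Fin 4) (f : Jet → ℝ) (j : Jet) : ℝ :=
  lineDeriv ℝ f j (Pi.single μ 1, fun i J => j.2 i (J + unitIx μ))

/-- The iterated total derivative `D_J`. -/
def iterTotalDeriv (J : MIx) (f : Jet → ℝ) : Jet → ℝ :=
  (totalDeriv 0)^[J 0] ((totalDeriv 1)^[J 1] ((totalDeriv 2)^[J 2] ((totalDeriv 3)^[J 3] f)))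

/-- The space of smooth vector fields on `ℝ^{4+24}`. -/
def smoothFields : Submodule ℝ (Vars → Vars) where
  carrier := {X | ContDiff ℝ ∞ X}
  add_mem' := by
    intro X Y hX hY
    rw [Set.mem_ofPred_eq] at hX hY ⊢
    exact hX.add hY
  zero_mem' := by
    rw [Set.mem_ofPred_eq]
    exact contDiff_const
  smul_mem' := by
    intro c X hX
    rw [Set.mem_ofPred_eq] at hX ⊢
    exact contDiff_const.smul hX

lemma mem_smoothFields {X : Vars → Vars} : X ∈ smoothFields ↔ ContDiff ℝ ∞ X := Iff.rfl

/-- Generators `X = ξ^μ(x,y) ∂_{x^μ} + η^i(x,y) ∂_{y^i}` of point transformations. -/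
abbrev PointGenerator : Type := smoothFields

/-- The coefficient `ξ^μ`, as a function on `ℝ^{4+24}`. -/
def PointGenerator.ξ (X : PointGenerator) (μ : Fin 4) (z : Vars) : ℝ := (X.1 z).1 μ

/-- The coefficient `η^i`, as a function on `ℝ^{4+24}`. -/
def PointGenerator.η (X : PointGenerator) (i : FieldIx) (z : Vars) : ℝ := (X.1 z).2 i

lemma PointGenerator.contDiff (X : PointGenerator) : ContDiff ℝ ∞ X.1 := mem_smoothFields.1 X.2

/-- The Lie bracket `[X, Y]^a = X^b ∂_b Y^a - Y^b ∂_b X^a` of smooth vector fields. -/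
instance : Bracket PointGenerator PointGenerator where
  bracket X Y := ⟨VectorField.lieBracket ℝ X.1 Y.1,
    mem_smoothFields.2 (ContDiff.lieBracket_vectorField X.contDiff Y.contDiff le_rfl)⟩

lemma PointGenerator.differentiableAt (X : PointGenerator) (z : Vars) :
    DifferentiableAt ℝ X.1 z :=
  (X.contDiff.differentiable (by simp)).differentiableAt

lemma PointGenerator.coe_bracket (X Y : PointGenerator) :
    (⁅X, Y⁆ : PointGenerator).1 = VectorField.lieBracket ℝ X.1 Y.1 := rfl

instance : LieRing PointGenerator where
  add_lie X Y Z := by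
    apply Subtype.ext
    funext z
    exact VectorField.lieBracket_add_left (X.differentiableAt z) (Y.differentiableAt z)
  lie_add X Y Z := by
    apply Subtype.ext
    funext z
    exact VectorField.lieBracket_add_right (Y.differentiableAt z) (Z.differentiableAt z)
  lie_self X := by
    apply Subtype.ext
    exact VectorField.lieBracket_self
  leibniz_lie X Y Z := by
    apply Subtype.ext
    funext z
    exact VectorField.leibniz_identity_lieBracket (n := ∞)
      (by rw [minSmoothness_of_isRCLikeNormedField]; exact WithTop.coe_le_coe.2 le_top)
      X.contDiff.contDiffAt Y.contDiff.contDiffAt Z.contDiff.contDiffAt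

instance : LieAlgebra ℝ PointGenerator where
  lie_smul c X Y := by
    apply Subtype.ext
    funext z
    exact VectorField.lieBracket_const_smul_right (Y.differentiableAt z)

/-- The characteristic `Q^i = η^i - ξ^μ y^i_μ`. -/
def characteristic (X : PointGenerator) (i : FieldIx) (j : Jet) : ℝ :=
  X.η i (base j) - ∑ μ, X.ξ μ (base j) * j.2 i (unitIx μ)

/-- The prolonged coefficient `η^i_J = D_J Q^i + ξ^μ y^i_{J+μ}`. -/
def prolongCoeff (X : PointGenerator) (i : FieldIx) (J : MIx) (j : Jet) : ℝ :=
  iterTotalDeriv J (characteristic X i) j + ∑ μ, X.ξ μ (base j) * j.2 i (J + unitIx μ)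

/-- The infinite prolongation `pr X = ξ^μ ∂_{x^μ} + ∑ η^i_J ∂_{y^i_J}`, acting on functions of
finitely many jet coordinates. -/
def pr (X : PointGenerator) (f : Jet → ℝ) (j : Jet) : ℝ :=
  lineDeriv ℝ f j (fun μ => X.ξ μ (base j), fun i J => prolongCoeff X i J j)

/-! ### Symmetries of a first order Lagrangian -/

/-- The Euler-Lagrange expression `∂L/∂y^i - d_μ (∂L/∂y^i_μ)` of a first order Lagrangian. -/
def eulerLagrange (L : Jet → ℝ) (i : FieldIx) (j : Jet) : ℝ :=
  partialY i 0 L j - ∑ μ, totalDeriv μ (partialY i (unitIx μ) L) j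

/-- The linearized symmetry condition `pr X (E_i(L)) = 0` whenever `E(L) = 0`: `X` is a Lie point
symmetry of the field equations of `L`. -/
def IsELSymmetry (L : Jet → ℝ) (X : PointGenerator) : Prop :=
  ∀ j : Jet, (∀ i, eulerLagrange L i j = 0) → ∀ i, pr X (eulerLagrange L i) j = 0

/-- The first variation `pr X (L) + L d_μ ξ^μ`. -/
def firstVariation (L : Jet → ℝ) (X : PointGenerator) (j : Jet) : ℝ :=
  pr X L j + L j * ∑ μ, totalDeriv μ (fun j' => X.ξ μ (base j')) j

/-- Strict variational symmetries. -/
def IsStrictlyVariational (L : Jet → ℝ) (X : PointGenerator) : Prop :=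
  ∀ j, firstVariation L X j = 0

/-- Variational symmetries: the first variation is a total divergence `d_μ β^μ`. -/
def IsVariational (L : Jet → ℝ) (X : PointGenerator) : Prop :=
  ∃ β : Fin 4 → Jet → ℝ, (∀ μ, IsLocalFunction (β μ)) ∧
    ∀ j, firstVariation L X j = ∑ μ, totalDeriv μ (β μ) j

/-- Divergence symmetries: variational, but not strictly variational. -/
def IsDivergenceSymmetry (L : Jet → ℝ) (X : PointGenerator) : Prop :=
  IsVariational L X ∧ ¬ IsStrictlyVariational L X

/-- Non-variational symmetries of the field equations. -/
def IsNonVariationalSymmetry (L : Jet → ℝ) (X : PointGenerator) : Prop :=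
  IsELSymmetry L X ∧ ¬ IsVariational L X

/-- Scalar generators: neither spacetime nor the gauge fields are transformed. -/
def IsScalar (X : PointGenerator) : Prop :=
  (∀ μ z, X.ξ μ z = 0) ∧ (∀ μ z, X.η (iB μ) z = 0) ∧ (∀ a μ z, X.η (iW a μ) z = 0)

/-! ### The two-Higgs-doublet model -/

/-- The parameters of the general renormalizable potential. -/
structure Potential where
  m11sq : ℝ
  m22sq : ℝ
  m12sq : ℂ
  lam1 : ℝ
  lam2 : ℝ
  lam3 : ℝ
  lam4 : ℝ
  lam5 : ℂ
  lam6 : ℂ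
  lam7 : ℂ

/-- The potential `V(Φ₁, Φ₂)`; the doublets are the rows of the matrix `Φ`. Each pair
`z + h.c.` is written as `2 Re z`. -/
def Potential.V (p : Potential) (Φ : Matrix (Fin 2) (Fin 2) ℂ) : ℝ :=
  let b11 : ℂ := star (Φ 0) ⬝ᵥ Φ 0
  let b22 : ℂ := star (Φ 1) ⬝ᵥ Φ 1
  let b12 : ℂ := star (Φ 0) ⬝ᵥ Φ 1
  let b21 : ℂ := star (Φ 1) ⬝ᵥ Φ 0
  p.m11sq * b11.re + p.m22sq * b22.re - 2 * (p.m12sq * b12).re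
    + p.lam1 / 2 * b11.re ^ 2 + p.lam2 / 2 * b22.re ^ 2
    + p.lam3 * b11.re * b22.re + p.lam4 * (b12 * b21).re
    + 2 * (p.lam5 / 2 * b12 ^ 2 + p.lam6 * b11 * b12 + p.lam7 * b22 * b12).re

/-- The matrix with rows `Φ₁ = (φ₁ + iφ₂, φ₃ + iφ₄)/√2` and `Φ₂ = (φ₅ + iφ₆, φ₇ + iφ₈)/√2`. -/
def doublets (φ : Fin 8 → ℝ) : Matrix (Fin 2) (Fin 2) ℂ :=
  ((1 / Real.sqrt 2 : ℝ) : ℂ) •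
    !![φ 0 + φ 1 * Complex.I, φ 2 + φ 3 * Complex.I;
       φ 4 + φ 5 * Complex.I, φ 6 + φ 7 * Complex.I]

/-- The Pauli matrices. -/
def pauli : Fin 3 → Matrix (Fin 2) (Fin 2) ℂ :=
  ![!![0, 1; 1, 0], !![0, -Complex.I; Complex.I, 0], !![1, 0; 0, -1]]

/-- The Minkowski metric `diag(1, -1, -1, -1)`. -/
def metric : Fin 4 → ℝ := ![1, -1, -1, -1]

/-- The gauge couplings `g`, `g'`, the hypercharge `Y` of the doublets, and the sign `s` in the
field strength of `W`. -/
structure Gauge where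
  g : ℝ
  g' : ℝ
  Y : ℝ
  s : ℝ

/-- `D_μ Φ_n = ∂_μ Φ_n + i g (σ^a/2) W^a_μ Φ_n + i g' Y B_μ Φ_n`. -/
def covDeriv (c : Gauge) (μ : Fin 4) (n : Fin 2) (j : Jet) : Fin 2 → ℂ :=
  let Φ := doublets (fun k => j.2 (iφ k) 0)
  let dΦ := doublets (fun k => j.2 (iφ k) (unitIx μ))
  dΦ n + (Complex.I * c.g) • (∑ a, ((j.2 (iW a μ) 0 : ℝ) : ℂ) • ((1 / 2 : ℂ) • pauli a) *ᵥ Φ n)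
    + (Complex.I * c.g' * c.Y * (j.2 (iB μ) 0 : ℝ)) • Φ n

/-- `W^a_{μν} = ∂_μ W^a_ν - ∂_ν W^a_μ + s g ε^{abc} W^b_μ W^c_ν`. -/
def fieldStrengthW (c : Gauge) (a : Fin 3) (μ ν : Fin 4) (j : Jet) : ℝ :=
  j.2 (iW a ν) (unitIx μ) - j.2 (iW a μ) (unitIx ν)
    + c.s * c.g * crossProduct (fun b => j.2 (iW b μ) 0) (fun b => j.2 (iW b ν) 0) a

/-- `B_{μν} = ∂_μ B_ν - ∂_ν B_μ`. -/
def fieldStrengthB (μ ν : Fin 4) (j : Jet) : ℝ := j.2 (iB ν) (unitIx μ) - j.2 (iB μ) (unitIx ν)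

/-- The 2HDM Lagrangian. -/
def lagrangian (c : Gauge) (p : Potential) (j : Jet) : ℝ :=
  -(1 / 4) * (∑ a, ∑ μ, ∑ ν, metric μ * metric ν * fieldStrengthW c a μ ν j ^ 2)
    - 1 / 4 * (∑ μ, ∑ ν, metric μ * metric ν * fieldStrengthB μ ν j ^ 2)
    + (∑ n, ∑ μ, metric μ * (star (covDeriv c μ n j) ⬝ᵥ covDeriv c μ n j).re)
    - p.V (doublets (fun k => j.2 (iφ k) 0))

/-- The scalar Lie point symmetries of the field equations of the 2HDM. -/
def scalarSymmetries (c : Gauge) (p : Potential) : Set PointGenerator :=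
  {X | IsScalar X ∧ IsELSymmetry (lagrangian c p) X}

/-- The Higgs basis change `Φ̂_i = U_{ij} Φ_j`, `U ∈ U(2)`, turns the potential with parameters `p`
into the one with parameters `p'`, i.e. `V_{p'}(Φ̂) = V_p(Φ)`. -/
def IsBasisChange (U : Matrix (Fin 2) (Fin 2) ℂ) (p p' : Potential) : Prop :=
  U ∈ Matrix.unitaryGroup (Fin 2) ℂ ∧ ∀ Φ : Matrix (Fin 2) (Fin 2) ℂ, p'.V (U * Φ) = p.V Φ

/-! ### The symmetry algebras -/

/-- The vector field `∑ (A φ)_k ∂_{φ_k}` with `A` linear. -/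
def linearScalarGenerator (A : (Fin 8 → ℝ) →ₗ[ℝ] (Fin 8 → ℝ)) : PointGenerator :=
  ⟨fun z => (0, Sum.elim (A fun k => z.2 (iφ k)) 0), mem_smoothFields.2 <| by
    have hA : ContDiff ℝ ∞ fun z : Vars => A fun k => z.2 (iφ k) :=
      (LinearMap.toContinuousLinearMap A).contDiff.comp
        (contDiff_pi.2 fun k =>
          (contDiff_apply (𝕜 := ℝ) (E := ℝ) (iφ k)).comp contDiff_snd)
    refine contDiff_const.prodMk (contDiff_pi.2 fun i => ?_)
    rcases i with k | i
    · exact (contDiff_apply ℝ ℝ k).comp hA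
    · exact contDiff_const⟩

/-- Auxiliary constructor: the linear map `φ ↦ (c_k φ_{σ k})_k`. -/
def signedPerm (c : Fin 8 → ℝ) (σ : Fin 8 → Fin 8) : (Fin 8 → ℝ) →ₗ[ℝ] (Fin 8 → ℝ) where
  toFun φ k := c k * φ (σ k)
  map_add' φ ψ := by
    funext k
    simp [mul_add]
  map_smul' r φ := by
    funext k
    simp [mul_left_comm]

/-- `φ₆∂₁ - φ₅∂₂ + φ₈∂₃ - φ₇∂₄ + φ₂∂₅ - φ₁∂₆ + φ₄∂₇ - φ₃∂₈`. -/
def H1 : PointGenerator := linearScalarGenerator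
  (signedPerm ![1, -1, 1, -1, 1, -1, 1, -1] ![5, 4, 7, 6, 1, 0, 3, 2])

/-- `φ₅∂₁ + φ₆∂₂ + φ₇∂₃ + φ₈∂₄ - φ₁∂₅ - φ₂∂₆ - φ₃∂₇ - φ₄∂₈`. -/
def H2 : PointGenerator := linearScalarGenerator
  (signedPerm ![1, 1, 1, 1, -1, -1, -1, -1] ![4, 5, 6, 7, 0, 1, 2, 3])

/-- The Peccei-Quinn generator
`φ₂∂₁ - φ₁∂₂ + φ₄∂₃ - φ₃∂₄ - φ₆∂₅ + φ₅∂₆ - φ₈∂₇ + φ₇∂₈`. -/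
def H3 : PointGenerator := linearScalarGenerator
  (signedPerm ![1, -1, 1, -1, -1, 1, -1, 1] ![1, 0, 3, 2, 5, 4, 7, 6])

/-- The hypercharge generator
`-φ₂∂₁ + φ₁∂₂ - φ₄∂₃ + φ₃∂₄ - φ₆∂₅ + φ₅∂₆ - φ₈∂₇ + φ₇∂₈`. -/
def XY : PointGenerator := linearScalarGenerator
  (signedPerm ![-1, 1, -1, 1, -1, 1, -1, 1] ![1, 0, 3, 2, 5, 4, 7, 6])

/-- The three types of algebras: `su(2) ⊕ u(1)_Y`, `u(1) ⊕ u(1)_Y` and `u(1)_Y`. -/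
inductive AlgebraType where
  | su2u1
  | u1u1
  | u1

/-- The three algebras of vector fields, in a suitable Higgs basis. -/
def standardAlgebra : AlgebraType → Submodule ℝ PointGenerator
  | .su2u1 => Submodule.span ℝ {H1, H2, H3, XY}
  | .u1u1 => Submodule.span ℝ {H3, XY}
  | .u1 => Submodule.span ℝ {XY}

attribute [local instance] LieRing.ofAssociativeRing

/-- The real Lie algebra `u(n)` of skew-Hermitian matrices. -/
def uAlg (n : ℕ) : LieSubalgebra ℝ (Matrix (Fin n) (Fin n) ℂ) where
  carrier := {A | Aᴴ = -A}
  add_mem' := by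
    intro A B hA hB
    simp only [Set.mem_ofPred_eq] at hA hB ⊢
    rw [Matrix.conjTranspose_add, hA, hB, neg_add]
  zero_mem' := by simp
  smul_mem' := by
    intro c A hA
    simp only [Set.mem_ofPred_eq] at hA ⊢
    rw [Matrix.conjTranspose_smul, hA]
    simp
  lie_mem' := by
    intro A B hA hB
    change Aᴴ = -A at hA
    change Bᴴ = -B at hB
    change (A * B - B * A)ᴴ = -(A * B - B * A)
    rw [Matrix.conjTranspose_sub, Matrix.conjTranspose_mul, Matrix.conjTranspose_mul, hA, hB]
    noncomm_ring

/-- The real Lie algebra `su(n)` of traceless skew-Hermitian matrices. -/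
def suAlg (n : ℕ) : LieSubalgebra ℝ (Matrix (Fin n) (Fin n) ℂ) where
  carrier := {A | Aᴴ = -A ∧ A.trace = 0}
  add_mem' := by
    rintro A B ⟨hA, hA'⟩ ⟨hB, hB'⟩
    exact ⟨(uAlg n).add_mem hA hB, by rw [Matrix.trace_add, hA', hB', add_zero]⟩
  zero_mem' := by simp
  smul_mem' := by
    rintro c A ⟨hA, hA'⟩
    exact ⟨(uAlg n).smul_mem c hA, by rw [Matrix.trace_smul, hA', smul_zero]⟩
  lie_mem' := by
    rintro A B ⟨hA, hA'⟩ ⟨hB, hB'⟩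
    refine ⟨(uAlg n).lie_mem hA hB, ?_⟩
    change (A * B - B * A).trace = 0
    rw [Matrix.trace_sub, Matrix.trace_mul_comm, sub_self]

/-- The Lie algebra `𝔞` of vector fields is isomorphic to `su(2) ⊕ u(1)`, `u(1) ⊕ u(1)`,
respectively `u(1)`. -/
def IsOfType (𝔞 : LieSubalgebra ℝ PointGenerator) : AlgebraType → Prop
  | .su2u1 => Nonempty (𝔞 ≃ₗ⁅ℝ⁆ suAlg 2 × uAlg 1)
  | .u1u1 => Nonempty (𝔞 ≃ₗ⁅ℝ⁆ uAlg 1 × uAlg 1)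
  | .u1 => Nonempty (𝔞 ≃ₗ⁅ℝ⁆ uAlg 1)

end THDM

end

open THDM

/-!
The scalar fields are real coordinates of a complex matrix `Φ` whose rows are the two doublets. In
these coordinates gauge transformations multiply `Φ` from the right, changes of the Higgs basis
multiply it from the left, and the kinetic term is the Minkowski norm of the covariant derivative in
a Euclidean space on which the gauge generators are skew (`lagrangian_eq`).

Determining equations. The field equations of the 2HDM can be solved for second derivatives over any
first order jet, and the second derivatives `∂_ν∂_ν` of gauge field components with index `ν` remain
free (`solveR_spec`). Evaluating the linearized equations at such jets shows that a scalar symmetry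
does not depend on the gauge fields (`IsScalar.fderiv_gauge`) and, from the quadratic terms in the
first derivatives, that it is affine in `φ` with constant Jacobian `M`. The terms with derivatives
of the gauge fields make `M` commute with the gauge generators. The invertible hypercharge generator
excludes inhomogeneous terms, and through its current makes `M` skew. Finally `M` intertwines the
gradient of the potential (`IsScalar.exists_linear`). A skew `M` that intertwines the gradient leaves
the potential itself invariant (`fderiv_potU_eq_zero`), and so also the Lagrangian: symmetries are
strictly variational (`IsScalar.isStrictlyVariational`). Conversely, the Euler operator annihilates
total divergences (`eulerOp_totalDeriv`), so that variational generators are symmetries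
(`IsVariational.isELSymmetry`).

Classification. Since the gauge generators generate the algebra of all complex `2 × 2` matrices,
their commutant consists of the left multiplications, and the skew ones form `u(2)`. Hence the
scalar symmetries are the elements of `u(2)` that annihilate the potential (`mem_scalarSymmetries_iff`). They always contain
hypercharge, the center, because the potential is a quadratic polynomial in the gauge invariant
bilinears `Φ_a†Φ_b` (`V_eq`). What remains is a subalgebra of `su(2) = ℝ³`, a subspace closed under
the cross product, of dimension 0, 1 or 3 (`submodule_cross_trichotomy`). A subspace of dimension 1
is rotated to the standard one by diagonalizing a Hermitian matrix (`exists_unitary_conj_su2`), and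
the rotated potential is again of the general form because `U(2)` acts linearly on the bilinears
(`exists_basisChange`). The three cases are told apart by their dimensions 4, 2 and 1
(`IsOfType.finrank_eq`), which do not depend on the Higgs basis (`IsBasisChange.nonempty_equiv`).
Explicit potentials realize all three (`exists_isStandard_of_type`).
-/

open scoped ContDiff Matrix

noncomputable section

namespace THDM

/-! ### Calculus of local functions on the jet space -/

/-- The projection of jets to `x` and the finitely many coordinates `y^i_J` in `S`. -/
def jetProj (S : Finset (FieldIx × MIx)) : Jet →ₗ[ℝ] Spacetime × (S → ℝ) where
  toFun j := (j.1, fun s => j.2 s.1.1 s.1.2)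
  map_add' _ _ := rfl
  map_smul' _ _ := rfl

lemma hasLineDerivAt_comp_linear {V E F : Type*} [AddCommGroup V] [Module ℝ V]
    [NormedAddCommGroup E] [NormedSpace ℝ E] [NormedAddCommGroup F] [NormedSpace ℝ F]
    (π : V →ₗ[ℝ] E) {f : E → F} {j : V} (hf : DifferentiableAt ℝ f (π j)) (v : V) :
    HasLineDerivAt ℝ (fun j => f (π j)) (fderiv ℝ f (π j) (π v)) j v := by
  have h1 : HasDerivAt (fun t : ℝ => π (j + t • v)) (π v) 0 := by
    simp only [map_add, map_smul]
    simpa using ((hasDerivAt_id (0 : ℝ)).smul_const (π v)).const_add (π j)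
  have h2 : HasFDerivAt f (fderiv ℝ f (π j)) (π (j + (0 : ℝ) • v)) := by
    simpa using hf.hasFDerivAt
  exact h2.comp_hasDerivAt (0 : ℝ) h1

lemma isLocalFunction_iff {f : Jet → ℝ} : IsLocalFunction f ↔
    ∃ (S : Finset (FieldIx × MIx)) (F : Spacetime × (S → ℝ) → ℝ),
      ContDiff ℝ ∞ F ∧ f = fun j => F (jetProj S j) := by
  simp only [IsLocalFunction, funext_iff]
  rfl

lemma IsLocalFunction.comp {ι : Type*} [Fintype ι] {g : ι → Jet → ℝ}
    (hg : ∀ i, IsLocalFunction (g i)) {H : Spacetime × (ι → ℝ) → ℝ} (hH : ContDiff ℝ ∞ H) :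
    IsLocalFunction fun j => H (j.1, fun i => g i j) := by
  classical
  choose S F hF hgF using hg
  refine ⟨Finset.univ.biUnion S, fun z => H (z.1, fun i => F i (z.1, fun s => z.2
    ⟨s.1, Finset.mem_biUnion.2 ⟨i, Finset.mem_univ i, s.2⟩⟩)), ?_, fun j => ?_⟩
  · refine hH.comp (contDiff_fst.prodMk (contDiff_pi.2 fun i => (hF i).comp
      (contDiff_fst.prodMk (contDiff_pi.2 fun s => ?_))))
    exact (contDiff_apply ℝ ℝ _).comp contDiff_snd
  · simp only [hgF]

lemma isLocalFunction_coord (i : FieldIx) (J : MIx) : IsLocalFunction fun j => j.2 i J :=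
  ⟨{(i, J)}, fun z => z.2 ⟨(i, J), by simp⟩,
    (contDiff_apply ℝ ℝ _).comp contDiff_snd, fun _ => rfl⟩

lemma isLocalFunction_const (c : ℝ) : IsLocalFunction fun _ => c :=
  ⟨∅, fun _ => c, contDiff_const, fun _ => rfl⟩

lemma IsLocalFunction.add {f g : Jet → ℝ} (hf : IsLocalFunction f) (hg : IsLocalFunction g) :
    IsLocalFunction fun j => f j + g j := by
  have := IsLocalFunction.comp (ι := Bool) (g := fun b => cond b f g)
    (by rintro (_ | _) <;> assumption) (H := fun z => z.2 true + z.2 false)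
    (((contDiff_apply ℝ ℝ _).comp contDiff_snd).add ((contDiff_apply ℝ ℝ _).comp contDiff_snd))
  exact this

lemma IsLocalFunction.mul {f g : Jet → ℝ} (hf : IsLocalFunction f) (hg : IsLocalFunction g) :
    IsLocalFunction fun j => f j * g j := by
  have := IsLocalFunction.comp (ι := Bool) (g := fun b => cond b f g)
    (by rintro (_ | _) <;> assumption) (H := fun z => z.2 true * z.2 false)
    (((contDiff_apply ℝ ℝ _).comp contDiff_snd).mul ((contDiff_apply ℝ ℝ _).comp contDiff_snd))
  exact this

lemma IsLocalFunction.sum {ι : Type*} {s : Finset ι} {f : ι → Jet → ℝ}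
    (hf : ∀ i ∈ s, IsLocalFunction (f i)) : IsLocalFunction fun j => ∑ i ∈ s, f i j := by
  classical
  induction s using Finset.induction_on with
  | empty => simpa using isLocalFunction_const 0
  | insert a s ha ih =>
    simp only [Finset.sum_insert ha]
    exact (hf a (by simp)).add (ih fun i hi => hf i (by simp [hi]))

lemma IsLocalFunction.neg {f : Jet → ℝ} (hf : IsLocalFunction f) :
    IsLocalFunction fun j => -f j := by
  simpa using (isLocalFunction_const (-1)).mul hf

lemma IsLocalFunction.sub {f g : Jet → ℝ} (hf : IsLocalFunction f) (hg : IsLocalFunction g) :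
    IsLocalFunction fun j => f j - g j := by
  simpa [sub_eq_add_neg] using hf.add hg.neg

/-- Smooth functions of the variables `(x, y)` are local. -/
lemma isLocalFunction_base {h : Vars → ℝ} (hh : ContDiff ℝ ∞ h) :
    IsLocalFunction fun j => h (base j) :=
  IsLocalFunction.comp (g := fun i j => j.2 i 0) (fun i => isLocalFunction_coord i 0) hh

lemma IsLocalFunction.lineDifferentiableAt {f : Jet → ℝ} (hf : IsLocalFunction f) (j v : Jet) :
    LineDifferentiableAt ℝ f j v := by
  obtain ⟨S, F, hF, rfl⟩ := isLocalFunction_iff.1 hf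
  exact (hasLineDerivAt_comp_linear (jetProj S)
    (hF.differentiable (by simp)).differentiableAt v).lineDifferentiableAt

/-- Line derivatives of a local function are linear in the direction. -/
lemma IsLocalFunction.exists_linear {f : Jet → ℝ} (hf : IsLocalFunction f) (j : Jet) :
    ∃ l : Jet →ₗ[ℝ] ℝ, ∀ v, lineDeriv ℝ f j v = l v := by
  obtain ⟨S, F, hF, rfl⟩ := isLocalFunction_iff.1 hf
  refine ⟨(fderiv ℝ F (jetProj S j)).toLinearMap ∘ₗ jetProj S, fun v => ?_⟩
  exact (hasLineDerivAt_comp_linear (jetProj S)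
    (hF.differentiable (by simp)).differentiableAt v).lineDeriv

lemma lineDeriv_jet_add {f g : Jet → ℝ} (hf : IsLocalFunction f) (hg : IsLocalFunction g)
    (j v : Jet) : lineDeriv ℝ (fun j => f j + g j) j v = lineDeriv ℝ f j v + lineDeriv ℝ g j v :=
  ((hf.lineDifferentiableAt j v).hasLineDerivAt.add
    (hg.lineDifferentiableAt j v).hasLineDerivAt : HasDerivAt _ _ _).deriv

lemma lineDeriv_jet_mul {f g : Jet → ℝ} (hf : IsLocalFunction f) (hg : IsLocalFunction g)
    (j v : Jet) : lineDeriv ℝ (fun j => f j * g j) j v =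
      lineDeriv ℝ f j v * g j + f j * lineDeriv ℝ g j v := by
  have := HasDerivAt.mul (hf.lineDifferentiableAt j v).hasLineDerivAt
    (hg.lineDifferentiableAt j v).hasLineDerivAt
  simp only [zero_smul, add_zero] at this
  exact this.deriv

lemma lineDeriv_jet_const_mul {f : Jet → ℝ} (hf : IsLocalFunction f) (c : ℝ)
    (j v : Jet) : lineDeriv ℝ (fun j => c * f j) j v = c * lineDeriv ℝ f j v := by
  exact (HasDerivAt.const_mul c (hf.lineDifferentiableAt j v).hasLineDerivAt).deriv

lemma lineDeriv_jet_sum {ι : Type*} {s : Finset ι} {f : ι → Jet → ℝ}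
    (hf : ∀ i ∈ s, IsLocalFunction (f i)) (j v : Jet) :
    lineDeriv ℝ (fun j => ∑ i ∈ s, f i j) j v = ∑ i ∈ s, lineDeriv ℝ (f i) j v := by
  exact (HasDerivAt.fun_sum fun i hi =>
    ((hf i hi).lineDifferentiableAt j v).hasLineDerivAt).deriv

lemma lineDeriv_coord (i : FieldIx) (J : MIx) (j v : Jet) :
    lineDeriv ℝ (fun j : Jet => j.2 i J) j v = v.2 i J := by
  have : HasDerivAt (fun t : ℝ => j.2 i J + t * v.2 i J) (v.2 i J) 0 := by
    simpa using ((hasDerivAt_id (0 : ℝ)).mul_const (v.2 i J)).const_add (j.2 i J)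
  exact this.deriv

lemma lineDeriv_jet_const (c : ℝ) (j v : Jet) : lineDeriv ℝ (fun _ : Jet => c) j v = 0 :=
  (hasDerivAt_const (0 : ℝ) c).deriv

/-- The derivative of `f` along the vector field `v` on the jet space. -/
def along (v : Jet → Jet) (f : Jet → ℝ) (j : Jet) : ℝ := lineDeriv ℝ f j (v j)

/-- Vector fields on the jet space all of whose components are local functions. -/
structure IsLocalField (v : Jet → Jet) : Prop where
  fst : ∀ μ, IsLocalFunction fun j => (v j).1 μ
  snd : ∀ i J, IsLocalFunction fun j => (v j).2 i J

lemma IsLocalFunction.along {f : Jet → ℝ} (hf : IsLocalFunction f) {v : Jet → Jet}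
    (hv : IsLocalField v) : IsLocalFunction (along v f) := by
  obtain ⟨S, F, hF, rfl⟩ := isLocalFunction_iff.1 hf
  let g : S ⊕ (Fin 4 ⊕ S) → Jet → ℝ := Sum.elim (fun s j => j.2 s.1.1 s.1.2)
    (Sum.elim (fun μ j => (v j).1 μ) (fun s j => (v j).2 s.1.1 s.1.2))
  have hg : ∀ i, IsLocalFunction (g i) := by
    rintro (s | μ | s)
    · exact isLocalFunction_coord _ _
    · exact hv.fst μ
    · exact hv.snd _ _
  have hH : ContDiff ℝ ∞ fun z : Spacetime × (S ⊕ (Fin 4 ⊕ S) → ℝ) =>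
      fderiv ℝ F (z.1, fun s => z.2 (Sum.inl s))
        (fun μ => z.2 (Sum.inr (Sum.inl μ)), fun s => z.2 (Sum.inr (Sum.inr s))) := by
    refine ContDiff.clm_apply ((hF.fderiv_right (m := ∞) (by simp)).comp
      (contDiff_fst.prodMk (contDiff_pi.2 fun s => (contDiff_apply ℝ ℝ _).comp contDiff_snd)))
      ((contDiff_pi.2 fun s => ?_).prodMk (contDiff_pi.2 fun s => ?_)) <;>
    exact (contDiff_apply ℝ ℝ _).comp contDiff_snd
  convert IsLocalFunction.comp hg hH using 1
  funext j
  exact (hasLineDerivAt_comp_linear (jetProj S)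
    (hF.differentiable (by simp)).differentiableAt (v j)).lineDeriv

/-- The commutator of derivations: `∂_v ∂_w f - ∂_w ∂_v f = ∂_{[v,w]} f`. It rests on the symmetry
of the second derivative of the smooth function of finitely many coordinates that represents
`f`. -/
lemma along_along_sub {f : Jet → ℝ} (hf : IsLocalFunction f) {v w : Jet → Jet}
    (hv : IsLocalField v) (hw : IsLocalField w) (j : Jet) :
    along v (along w f) j - along w (along v f) j =
      lineDeriv ℝ f j
        (fun μ => along v (fun j => (w j).1 μ) j - along w (fun j => (v j).1 μ) j,
         fun i J => along v (fun j => (w j).2 i J) j - along w (fun j => (v j).2 i J) j) := by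
  obtain ⟨S, F, hF, rfl⟩ := isLocalFunction_iff.1 hf
  have hd : ∀ z, DifferentiableAt ℝ F z := fun z =>
    (hF.differentiable (by simp)).differentiableAt
  have hd2 : ∀ z, DifferentiableAt ℝ (fderiv ℝ F) z := fun z =>
    ((hF.fderiv_right (m := ∞) (by simp)).differentiable (by simp)).differentiableAt
  have key : ∀ v w : Jet → Jet, IsLocalField v → IsLocalField w →
      along v (along w fun j => F (jetProj S j)) j =
        fderiv ℝ (fderiv ℝ F) (jetProj S j) (jetProj S (v j)) (jetProj S (w j)) +
        fderiv ℝ F (jetProj S j) (jetProj S (fun μ => along v (fun j => (w j).1 μ) j,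
          fun i J => along v (fun j => (w j).2 i J) j)) := by
    intro v w hv hw
    have e1 : along w (fun j => F (jetProj S j)) =
        fun j => fderiv ℝ F (jetProj S j) (jetProj S (w j)) := by
      funext j
      exact (hasLineDerivAt_comp_linear (jetProj S) (hd _) (w j)).lineDeriv
    have h1 := hasLineDerivAt_comp_linear (jetProj S) (hd2 (jetProj S j)) (v j)
    have h2 : HasDerivAt (fun t : ℝ => jetProj S (w (j + t • v j)))
        (jetProj S (fun μ => along v (fun j => (w j).1 μ) j,
          fun i J => along v (fun j => (w j).2 i J) j)) 0 := by
      refine HasDerivAt.prodMk (hasDerivAt_pi.2 fun μ => ?_) (hasDerivAt_pi.2 fun s => ?_)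
      · exact ((hw.fst μ).lineDifferentiableAt j (v j)).hasLineDerivAt
      · exact ((hw.snd s.1.1 s.1.2).lineDifferentiableAt j (v j)).hasLineDerivAt
    have h3 := HasDerivAt.clm_apply h1 h2
    simp only [zero_smul, add_zero] at h3
    rw [e1]
    exact h3.deriv
  rw [key v w hv hw, key w v hw hv,
    (hasLineDerivAt_comp_linear (jetProj S) (hd (jetProj S j)) _).lineDeriv]
  have hs : IsSymmSndFDerivAt ℝ F (jetProj S j) :=
    hF.contDiffAt.isSymmSndFDerivAt (by
      rw [minSmoothness_of_isRCLikeNormedField]; exact WithTop.coe_le_coe.2 le_top)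
  rw [hs.eq, add_sub_add_left_eq_sub, ← map_sub, ← map_sub]
  rfl

/-- The total derivative `d_μ` as a vector field on the jet space. -/
def totalField (μ : Fin 4) (j : Jet) : Jet := (Pi.single μ 1, fun i J => j.2 i (J + unitIx μ))

/-- The coordinate vector field `∂/∂y^i_J`. -/
def coordField (i : FieldIx) (J : MIx) (_ : Jet) : Jet := (0, Pi.single i (Pi.single J 1))

lemma totalDeriv_eq_along (μ : Fin 4) (f : Jet → ℝ) : totalDeriv μ f = along (totalField μ) f := rfl

lemma partialY_eq_along (i : FieldIx) (J : MIx) (f : Jet → ℝ) :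
    partialY i J f = along (coordField i J) f := rfl

lemma isLocalField_totalField (μ : Fin 4) : IsLocalField (totalField μ) :=
  ⟨fun _ => isLocalFunction_const _, fun _ _ => isLocalFunction_coord _ _⟩

lemma isLocalField_coordField (i : FieldIx) (J : MIx) : IsLocalField (coordField i J) :=
  ⟨fun _ => isLocalFunction_const _, fun _ _ => isLocalFunction_const _⟩

lemma IsLocalFunction.totalDeriv {f : Jet → ℝ} (hf : IsLocalFunction f) (μ : Fin 4) :
    IsLocalFunction (totalDeriv μ f) := hf.along (isLocalField_totalField μ)

lemma IsLocalFunction.partialY {f : Jet → ℝ} (hf : IsLocalFunction f) (i : FieldIx) (J : MIx) :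
    IsLocalFunction (partialY i J f) := hf.along (isLocalField_coordField i J)

lemma totalDeriv_comm {f : Jet → ℝ} (hf : IsLocalFunction f) (μ ν : Fin 4) :
    totalDeriv μ (totalDeriv ν f) = totalDeriv ν (totalDeriv μ f) := by
  funext j
  obtain ⟨l, hl⟩ := hf.exists_linear j
  rw [← sub_eq_zero, totalDeriv_eq_along, totalDeriv_eq_along, totalDeriv_eq_along,
    totalDeriv_eq_along, along_along_sub hf (isLocalField_totalField μ)
    (isLocalField_totalField ν), hl]
  convert l.map_zero
  · simp [along, totalField, lineDeriv_jet_const]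
  · simp [along, totalField, lineDeriv_coord, add_right_comm]

/-- `∂/∂y^i_J` commutes with `d_μ` if `J` does not contain `μ`. -/
lemma partialY_zero_totalDeriv {f : Jet → ℝ} (hf : IsLocalFunction f) (i : FieldIx) (J : MIx)
    (μ : Fin 4) (hJ : J μ = 0) :
    partialY i J (totalDeriv μ f) = totalDeriv μ (partialY i J f) := by
  funext j
  obtain ⟨l, hl⟩ := hf.exists_linear j
  rw [← sub_eq_zero, totalDeriv_eq_along, totalDeriv_eq_along, partialY_eq_along,
    partialY_eq_along, along_along_sub hf (isLocalField_coordField i J)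
    (isLocalField_totalField μ), hl]
  convert l.map_zero
  · simp [along, totalField, coordField, lineDeriv_jet_const]
  · rename_i k K
    have : K + unitIx μ ≠ J := by
      rintro rfl
      simp at hJ
    by_cases hk : k = i
    · subst hk
      simp [along, totalField, coordField, lineDeriv_coord, lineDeriv_jet_const, this]
    · simp [along, totalField, coordField, lineDeriv_coord, lineDeriv_jet_const, hk]

/-- `[∂/∂y^i_{J+μ}, d_μ] = ∂/∂y^i_J`. -/
lemma partialY_add_totalDeriv {f : Jet → ℝ} (hf : IsLocalFunction f) (i : FieldIx) (J : MIx)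
    (μ : Fin 4) (j : Jet) : partialY i (J + unitIx μ) (totalDeriv μ f) j =
      totalDeriv μ (partialY i (J + unitIx μ) f) j + partialY i J f j := by
  rw [← sub_eq_iff_eq_add', totalDeriv_eq_along, totalDeriv_eq_along, partialY_eq_along,
    partialY_eq_along, along_along_sub hf (isLocalField_coordField i _)
    (isLocalField_totalField μ), partialY]
  congr 2
  · simp [along, totalField, coordField, lineDeriv_jet_const]
    rfl
  · funext k K
    by_cases hk : k = i
    · subst hk
      by_cases hK : K = J
      · subst hK
        simp [along, totalField, coordField, lineDeriv_coord, lineDeriv_jet_const]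
      · simp [along, totalField, coordField, lineDeriv_coord, lineDeriv_jet_const, hK]
    · simp [along, totalField, coordField, lineDeriv_coord, lineDeriv_jet_const, hk]

/-- The space of local functions. -/
def localFunctions : Submodule ℝ (Jet → ℝ) where
  carrier := {f | IsLocalFunction f}
  add_mem' hf hg := IsLocalFunction.add hf hg
  zero_mem' := isLocalFunction_const 0
  smul_mem' c _ hf := (isLocalFunction_const c).mul hf

/-- The total derivative as an endomorphism of the space of local functions. -/
def totalEnd (μ : Fin 4) : Module.End ℝ localFunctions where
  toFun f := ⟨totalDeriv μ f.1, IsLocalFunction.totalDeriv f.2 μ⟩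
  map_add' f g := Subtype.ext (funext fun j => lineDeriv_jet_add f.2 g.2 j _)
  map_smul' c f := Subtype.ext (funext fun j => lineDeriv_jet_const_mul f.2 c j _)

lemma commute_totalEnd (μ ν : Fin 4) : Commute (totalEnd μ) (totalEnd ν) :=
  LinearMap.ext fun f => Subtype.ext (totalDeriv_comm f.2 μ ν)

/-- The iterated total derivative as an endomorphism of the space of local functions. -/
def iterTotalEnd (J : MIx) : Module.End ℝ localFunctions :=
  totalEnd 0 ^ J 0 * (totalEnd 1 ^ J 1 * (totalEnd 2 ^ J 2 * totalEnd 3 ^ J 3))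

lemma totalEnd_pow_apply (μ : Fin 4) (n : ℕ) (f : localFunctions) :
    ((totalEnd μ ^ n) f).1 = (totalDeriv μ)^[n] f.1 := by
  induction n with
  | zero => rfl
  | succ n ih => rw [pow_succ', Function.iterate_succ_apply', ← ih]; rfl

lemma iterTotalEnd_apply (J : MIx) (f : localFunctions) :
    (iterTotalEnd J f).1 = iterTotalDeriv J f.1 := by
  simp only [iterTotalEnd, Module.End.mul_apply, totalEnd_pow_apply, iterTotalDeriv]

lemma iterTotalEnd_add_unitIx (J : MIx) (μ : Fin 4) :
    iterTotalEnd (J + unitIx μ) = totalEnd μ * iterTotalEnd J := by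
  have h : ∀ a b : Fin 4, ∀ n, totalEnd a ^ n * totalEnd b = totalEnd b * totalEnd a ^ n :=
    fun a b n => ((commute_totalEnd a b).pow_left n).eq
  have h' : ∀ a b : Fin 4, ∀ n, ∀ x, totalEnd a ^ n * (totalEnd b * x) =
      totalEnd b * (totalEnd a ^ n * x) := fun a b n x => by
    rw [← mul_assoc, h, mul_assoc]
  unfold iterTotalEnd
  fin_cases μ <;> simp [pow_succ', mul_assoc, h']

lemma commute_iterTotalEnd_totalEnd (J : MIx) (μ : Fin 4) :
    Commute (iterTotalEnd J) (totalEnd μ) := by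
  have h : ∀ a : Fin 4, ∀ n, Commute (totalEnd a ^ n) (totalEnd μ) :=
    fun a n => (commute_totalEnd a μ).pow_left n
  exact (h _ _).mul_left ((h _ _).mul_left ((h _ _).mul_left (h _ _)))

lemma IsLocalFunction.iterTotalDeriv {f : Jet → ℝ} (hf : IsLocalFunction f) (J : MIx) :
    IsLocalFunction (iterTotalDeriv J f) := by
  rw [← iterTotalEnd_apply J ⟨f, hf⟩]
  exact (iterTotalEnd J ⟨f, hf⟩).2

lemma iterTotalDeriv_add_unitIx {f : Jet → ℝ} (hf : IsLocalFunction f) (J : MIx) (μ : Fin 4) :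
    iterTotalDeriv (J + unitIx μ) f = totalDeriv μ (iterTotalDeriv J f) := by
  rw [← iterTotalEnd_apply _ ⟨f, hf⟩, iterTotalEnd_add_unitIx, ← iterTotalEnd_apply _ ⟨f, hf⟩]
  rfl

lemma iterTotalDeriv_zero (f : Jet → ℝ) : iterTotalDeriv 0 f = f := rfl

lemma iterTotalDeriv_unitIx {f : Jet → ℝ} (hf : IsLocalFunction f) (μ : Fin 4) :
    iterTotalDeriv (unitIx μ) f = totalDeriv μ f := by
  simpa [iterTotalDeriv_zero] using iterTotalDeriv_add_unitIx hf 0 μ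

/-! ### The Euler operator and symmetries of first order Lagrangians -/

/-- The Euler operator `∑_J (-1)^|J| D_J ∂/∂y^i_J` on local functions of arbitrary order. The sum has
finitely many nonzero terms because a local function depends on finitely many coordinates. -/
def eulerOp (i : FieldIx) (f : Jet → ℝ) (j : Jet) : ℝ :=
  ∑ᶠ J : MIx, (-1) ^ (∑ μ, J μ) * iterTotalDeriv J (partialY i J f) j

lemma iterTotalDeriv_zero_fun (J : MIx) : iterTotalDeriv J (0 : Jet → ℝ) = 0 := by
  have := iterTotalEnd_apply J 0
  rw [map_zero] at this
  exact this.symm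

lemma finite_partialY_ne_zero {f : Jet → ℝ} (hf : IsLocalFunction f) (i : FieldIx) :
    {J | partialY i J f ≠ 0}.Finite := by
  classical
  obtain ⟨S, F, hF, rfl⟩ := isLocalFunction_iff.1 hf
  refine (S.finite_toSet.image Prod.snd).subset fun J hJ => ?_
  by_contra hJS
  refine hJ (funext fun j => ?_)
  rw [partialY, (hasLineDerivAt_comp_linear (jetProj S)
    (hF.differentiable (by simp)).differentiableAt _).lineDeriv]
  have : jetProj S (0, Pi.single i (Pi.single J 1)) = 0 := by
    refine Prod.ext rfl (funext fun s => ?_)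
    have hs : s.1.2 ≠ J := fun h => hJS ⟨s.1, s.2, h⟩
    by_cases hi : s.1.1 = i
    · simp [jetProj, hi, hs]
    · simp [jetProj, hi]
  simp [this]

lemma sum_add_unitIx (J : MIx) (μ : Fin 4) : ∑ ν, (J + unitIx μ) ν = ∑ ν, J ν + 1 := by
  simp [Finset.sum_add_distrib]

/-- The Euler operator annihilates total divergences: with `[∂_{J+μ}, d_μ] = ∂_J` the two terms
of `∑_J (-1)^|J| D_J ∂_J d_μ f` telescope. -/
lemma eulerOp_totalDeriv {f : Jet → ℝ} (hf : IsLocalFunction f) (i : FieldIx) (μ : Fin 4)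
    (j : Jet) : eulerOp i (totalDeriv μ f) j = 0 := by
  classical
  let c : MIx → ℝ := fun J => (-1) ^ (∑ ν, J ν) * iterTotalDeriv (J + unitIx μ) (partialY i J f) j
  -- `c J` comes from `D_J d_μ ∂_J f`, and `b J` from the commutator `[∂_J, d_μ] = ∂_{J-μ}`.
  let b : MIx → ℝ := fun J => if 1 ≤ J μ then -c (J - unitIx μ) else 0
  have hinj : Function.Injective fun K : MIx => K + unitIx μ := add_left_injective _
  have hsub : ∀ J : MIx, 1 ≤ J μ → J - unitIx μ + unitIx μ = J := by
    intro J hJ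
    funext ν
    by_cases h : ν = μ
    · subst h; simp; omega
    · simp [h]
  have hc : c.support.Finite := by
    refine (finite_partialY_ne_zero hf i).subset fun J hJ h => hJ ?_
    simp only [c, h, iterTotalDeriv_zero_fun, Pi.zero_apply, mul_zero]
  have hb : b.support.Finite := by
    refine (hc.image fun K => K + unitIx μ).subset fun J hJ => ?_
    by_cases h : 1 ≤ J μ
    · refine ⟨J - unitIx μ, fun h0 => hJ ?_, hsub J h⟩
      simp [b, h0]
    · simp [b, h] at hJ
  have hterm : ∀ J : MIx, (-1) ^ (∑ ν, J ν) *
      iterTotalDeriv J (partialY i J (totalDeriv μ f)) j = c J + b J := by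
    intro J
    have e1 : iterTotalDeriv J (totalDeriv μ (partialY i J f)) =
        iterTotalDeriv (J + unitIx μ) (partialY i J f) := by
      have hl := hf.partialY i J
      have := (commute_iterTotalEnd_totalEnd J μ).eq
      rw [← iterTotalEnd_add_unitIx] at this
      rw [← iterTotalEnd_apply _ ⟨_, hl⟩, ← this, Module.End.mul_apply, iterTotalEnd_apply]
      rfl
    by_cases h : 1 ≤ J μ
    · obtain ⟨K, rfl⟩ : ∃ K, J = K + unitIx μ := ⟨_, (hsub J h).symm⟩
      have e2 : partialY i (K + unitIx μ) (totalDeriv μ f) =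
          totalDeriv μ (partialY i (K + unitIx μ) f) + partialY i K f :=
        funext fun j => partialY_add_totalDeriv hf i K μ j
      have e3 : iterTotalDeriv (K + unitIx μ)
            (totalDeriv μ (partialY i (K + unitIx μ) f) + partialY i K f) =
          iterTotalDeriv (K + unitIx μ) (totalDeriv μ (partialY i (K + unitIx μ) f)) +
            iterTotalDeriv (K + unitIx μ) (partialY i K f) := by
        have := congrArg Subtype.val (map_add (iterTotalEnd (K + unitIx μ))
          ⟨_, (hf.partialY i (K + unitIx μ)).totalDeriv μ⟩ ⟨_, hf.partialY i K⟩)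
        rwa [Submodule.coe_add, iterTotalEnd_apply, iterTotalEnd_apply, iterTotalEnd_apply] at this
      rw [e2, e3, e1]
      simp only [c, b]
      rw [if_pos h, add_tsub_cancel_right, sum_add_unitIx, Pi.add_apply]
      ring
    · have h0 : J μ = 0 := by omega
      rw [partialY_zero_totalDeriv hf i J μ h0, e1]
      simp [c, b, h]
  have hbc : ∑ᶠ J, b J = ∑ᶠ K, -c K := by
    rw [← finsum_mem_univ b, ← finsum_mem_inter_support_eq' b (Set.range fun K => K + unitIx μ),
      finsum_mem_range hinj]
    · simp [b]
    · intro J hJ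
      simp only [Set.mem_range, Set.mem_univ, iff_true]
      by_cases h : 1 ≤ J μ
      · exact ⟨_, hsub J h⟩
      · simp [b, h] at hJ
  unfold eulerOp
  rw [finsum_congr hterm, finsum_add_distrib hc hb, hbc, finsum_neg_distrib, add_neg_cancel]

lemma eulerOp_sum {ι : Type*} (s : Finset ι) {f : ι → Jet → ℝ}
    (hf : ∀ a, IsLocalFunction (f a)) (i : FieldIx) (j : Jet) :
    eulerOp i (fun j => ∑ a ∈ s, f a j) j = ∑ a ∈ s, eulerOp i (f a) j := by
  classical
  have hterm : ∀ J : MIx, (-1) ^ (∑ ν, J ν) *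
      iterTotalDeriv J (partialY i J fun j => ∑ a ∈ s, f a j) j =
      ∑ a ∈ s, (-1) ^ (∑ ν, J ν) * iterTotalDeriv J (partialY i J (f a)) j := by
    intro J
    have e1 : (partialY i J fun j => ∑ a ∈ s, f a j) =
        (∑ a ∈ s, (⟨_, (hf a).partialY i J⟩ : localFunctions)).1 := by
      funext j
      simp only [AddSubmonoidClass.coe_finsetSum, Finset.sum_apply]
      exact lineDeriv_jet_sum (fun a _ => hf a) j _
    rw [e1, ← iterTotalEnd_apply, map_sum, AddSubmonoidClass.coe_finsetSum, Finset.sum_apply,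
      Finset.mul_sum]
    simp only [iterTotalEnd_apply]
  unfold eulerOp
  rw [finsum_congr hterm, finsum_sum_comm]
  intro a _
  refine (finite_partialY_ne_zero (hf a) i).subset fun J hJ h => hJ ?_
  simp only [h, iterTotalDeriv_zero_fun, Pi.zero_apply, mul_zero]

/-- Functions of `x`, `y` and the first derivatives of `y`. -/
def IsFirstOrder (f : Jet → ℝ) : Prop :=
  ∀ j j' : Jet, j.1 = j'.1 → (∀ i, j.2 i 0 = j'.2 i 0) →
    (∀ i μ, j.2 i (unitIx μ) = j'.2 i (unitIx μ)) → f j = f j'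

lemma unitIx_ne_zero (μ : Fin 4) : unitIx μ ≠ 0 := by simp

lemma unitIx_inj {μ ν : Fin 4} : unitIx μ = unitIx ν ↔ μ = ν := by
  constructor
  · intro h
    by_contra hne
    have := congrFun h μ
    simp [hne] at this
  · rintro rfl; rfl

lemma lineDeriv_congr_direction {f : Jet → ℝ} (h1 : IsFirstOrder f) {v w : Jet} (hx : v.1 = w.1)
    (hy : ∀ i, v.2 i 0 = w.2 i 0) (hyd : ∀ i μ, v.2 i (unitIx μ) = w.2 i (unitIx μ)) (j : Jet) :
    lineDeriv ℝ f j v = lineDeriv ℝ f j w := by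
  unfold lineDeriv
  congr 1
  funext t
  apply h1 <;> simp [hx, hy, hyd]

lemma IsFirstOrder.partialY_eq_zero {f : Jet → ℝ} (h1 : IsFirstOrder f) (i : FieldIx) (J : MIx)
    (h0 : J ≠ 0) (hu : ∀ μ, J ≠ unitIx μ) : partialY i J f = 0 := by
  funext j
  have : lineDeriv ℝ f j (0, Pi.single i (Pi.single J 1)) = lineDeriv ℝ f j 0 := by
    refine lineDeriv_congr_direction h1 ?_ (fun k => ?_) (fun k μ => ?_) j
    · rfl
    · by_cases hk : k = i
      · subst hk; simp [h0]
      · simp [hk]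
    · by_cases hk : k = i
      · subst hk; simp [hu μ]
      · simp [hk]
  rw [partialY, this, lineDeriv_zero]
  rfl

/-- The chain rule for a first order function and a vertical direction `w`. -/
lemma IsFirstOrder.lineDeriv_eq {f : Jet → ℝ} (h1 : IsFirstOrder f) (hf : IsLocalFunction f)
    (j w : Jet) (hw : w.1 = 0) :
    lineDeriv ℝ f j w = ∑ k, (w.2 k 0 * partialY k 0 f j +
      ∑ ν, w.2 k (unitIx ν) * partialY k (unitIx ν) f j) := by
  obtain ⟨l, hl⟩ := hf.exists_linear j
  have e : lineDeriv ℝ f j w = lineDeriv ℝ f j (∑ k, (w.2 k 0 • coordField k 0 j +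
      ∑ ν, w.2 k (unitIx ν) • coordField k (unitIx ν) j)) := by
    refine lineDeriv_congr_direction h1 ?_ (fun i => ?_) (fun i μ => ?_) j
    · simp [hw, Prod.fst_sum, coordField]
    · simp only [Prod.snd_sum, Prod.snd_add, Prod.smul_snd, coordField, Finset.sum_apply,
        Pi.add_apply, Pi.smul_apply, smul_eq_mul]
      rw [Finset.sum_eq_single i]
      · simp
      · intro k _ hk
        simp [Pi.single_eq_of_ne hk.symm]
      · simp
    · simp only [Prod.snd_sum, Prod.snd_add, Prod.smul_snd, coordField, Finset.sum_apply,
        Pi.add_apply, Pi.smul_apply, smul_eq_mul]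
      rw [Finset.sum_eq_single i]
      · rw [Finset.sum_eq_single μ]
        · simp
        · intro ν _ hν
          simp [unitIx_inj, hν.symm]
        · simp
      · intro k _ hk
        simp [Pi.single_eq_of_ne hk.symm]
      · simp
  rw [e, hl]
  simp only [map_sum, map_add, map_smul, smul_eq_mul]
  simp only [← hl]
  rfl

/-- On first order functions the Euler operator is the Euler-Lagrange expression. -/
lemma eulerOp_eq_eulerLagrange {f : Jet → ℝ} (h1 : IsFirstOrder f) (hf : IsLocalFunction f)
    (i : FieldIx) (j : Jet) : eulerOp i f j = eulerLagrange f i j := by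
  classical
  unfold eulerOp eulerLagrange
  rw [finsum_eq_sum_of_support_subset (s := insert 0 (Finset.univ.image unitIx)),
    Finset.sum_insert, Finset.sum_image]
  · simp only [Pi.zero_apply, Finset.sum_const_zero, pow_zero, one_mul, iterTotalDeriv_zero,
      sub_eq_add_neg, ← Finset.sum_neg_distrib]
    congr 1
    refine Finset.sum_congr rfl fun μ _ => ?_
    rw [iterTotalDeriv_unitIx (hf.partialY i _)]
    simp
  · intro μ _ ν _ h
    exact unitIx_inj.1 h
  · simp [eq_comm]
  · intro J hJ
    by_contra hJS
    simp only [Finset.coe_insert, Finset.coe_image, Set.mem_insert_iff, Set.mem_image,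
      not_or, not_exists, Finset.coe_univ, Set.mem_univ, true_and] at hJS
    apply hJ
    simp only [h1.partialY_eq_zero i J hJS.1 fun μ h => hJS.2 μ h.symm, iterTotalDeriv_zero_fun,
      Pi.zero_apply, mul_zero]

/-- Generators that do not transform spacetime. -/
def IsVertical (X : PointGenerator) : Prop := ∀ μ z, X.ξ μ z = 0

lemma PointGenerator.contDiff_eta (X : PointGenerator) (i : FieldIx) : ContDiff ℝ ∞ (X.η i) :=
  (contDiff_apply ℝ ℝ i).comp (contDiff_snd.comp X.contDiff)

lemma IsVertical.characteristic_eq {X : PointGenerator} (hX : IsVertical X) (i : FieldIx) :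
    characteristic X i = fun j => X.η i (base j) := by
  funext j
  simp [characteristic, hX _ _]

lemma IsVertical.isLocalFunction_characteristic {X : PointGenerator} (hX : IsVertical X)
    (i : FieldIx) : IsLocalFunction (characteristic X i) := by
  rw [hX.characteristic_eq]
  exact isLocalFunction_base (X.contDiff_eta i)

lemma IsVertical.prolongCoeff_eq {X : PointGenerator} (hX : IsVertical X) (i : FieldIx) (J : MIx) :
    prolongCoeff X i J = iterTotalDeriv J (characteristic X i) := by
  funext j
  simp [prolongCoeff, hX _ _]

/-- The prolongation of a vertical generator as a vector field on the jet space. -/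
def prolongField (X : PointGenerator) (j : Jet) : Jet := (0, fun i J => prolongCoeff X i J j)

lemma IsVertical.pr_eq_along {X : PointGenerator} (hX : IsVertical X) (f : Jet → ℝ) :
    pr X f = along (prolongField X) f := by
  funext j
  simp only [pr, along, prolongField, hX _ _]
  rfl

lemma IsVertical.isLocalField {X : PointGenerator} (hX : IsVertical X) :
    IsLocalField (prolongField X) := by
  refine ⟨fun μ => isLocalFunction_const 0, fun i J => ?_⟩
  simp only [prolongField, hX.prolongCoeff_eq]
  exact (hX.isLocalFunction_characteristic i).iterTotalDeriv J

/-- Prolongations of vertical generators commute with total derivatives. -/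
lemma IsVertical.pr_totalDeriv {X : PointGenerator} (hX : IsVertical X) {f : Jet → ℝ}
    (hf : IsLocalFunction f) (μ : Fin 4) : pr X (totalDeriv μ f) = totalDeriv μ (pr X f) := by
  funext j
  obtain ⟨l, hl⟩ := hf.exists_linear j
  rw [← sub_eq_zero, hX.pr_eq_along, hX.pr_eq_along, totalDeriv_eq_along, totalDeriv_eq_along,
    along_along_sub hf hX.isLocalField (isLocalField_totalField μ), hl]
  convert l.map_zero
  · simp [along, prolongField, totalField, lineDeriv_jet_const]
  · rename_i i J
    simp only [prolongField, totalField, along, lineDeriv_coord, hX.prolongCoeff_eq,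
      iterTotalDeriv_add_unitIx (hX.isLocalFunction_characteristic i), Prod.snd_zero,
      Pi.zero_apply]
    exact sub_self _

lemma IsFirstOrder.partialY {f : Jet → ℝ} (h1 : IsFirstOrder f) (i : FieldIx) (J : MIx) :
    IsFirstOrder (partialY i J f) := by
  intro j j' hx hy hyd
  unfold THDM.partialY lineDeriv
  congr 1
  funext t
  apply h1 <;> simp [hx, hy, hyd]

lemma IsVertical.partialY_pr {X : PointGenerator} (hX : IsVertical X) {f : Jet → ℝ}
    (h1 : IsFirstOrder f) (hf : IsLocalFunction f) (i : FieldIx) (J : MIx) (j : Jet) :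
    partialY i J (pr X f) j = pr X (partialY i J f) j +
      ∑ k, (partialY i J (characteristic X k) j * partialY k 0 f j + ∑ ν,
        partialY i J (totalDeriv ν (characteristic X k)) j * partialY k (unitIx ν) f j) := by
  rw [← sub_eq_iff_eq_add', hX.pr_eq_along, hX.pr_eq_along, partialY_eq_along, partialY_eq_along,
    along_along_sub hf (isLocalField_coordField i J) hX.isLocalField, h1.lineDeriv_eq hf]
  · refine Finset.sum_congr rfl fun k _ => ?_
    simp only [prolongField, coordField, hX.prolongCoeff_eq, iterTotalDeriv_zero,
      iterTotalDeriv_unitIx (hX.isLocalFunction_characteristic k)]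
    simp [along, lineDeriv_jet_const, partialY, coordField]
  · funext μ
    simp [along, prolongField, coordField, lineDeriv_jet_const]

lemma IsVertical.partialY_characteristic {X : PointGenerator} (hX : IsVertical X)
    (i k : FieldIx) (μ : Fin 4) : partialY i (unitIx μ) (characteristic X k) = 0 := by
  funext j
  rw [hX.characteristic_eq]
  have : (fun t : ℝ => X.η k (base (j + t • (0, Pi.single i (Pi.single (unitIx μ) 1))))) =
      fun _ => X.η k (base j) := by
    funext t
    congr 1
    refine Prod.ext (by simp [base]) (funext fun m => ?_)
    by_cases hm : m = i
    · subst hm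
      simp [base, Pi.single_apply, (unitIx_ne_zero μ).symm]
    · simp [base, hm]
  simp only [partialY, lineDeriv, this]
  simp

/-- The first variation of the Euler-Lagrange expressions:
`E_i(pr X L) = pr X (E_i L) + ∑_k (∂η^k/∂y^i) E_k(L)` for a vertical generator `X`. -/
lemma IsVertical.eulerLagrange_pr {X : PointGenerator} (hX : IsVertical X) {L : Jet → ℝ}
    (h1 : IsFirstOrder L) (hL : IsLocalFunction L) (i : FieldIx) (j : Jet) :
    eulerLagrange (pr X L) i j = pr X (eulerLagrange L i) j +
      ∑ k, partialY i 0 (characteristic X k) j * eulerLagrange L k j := by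
  classical
  have hQ := hX.isLocalFunction_characteristic
  have hpd : ∀ μ, IsLocalFunction (totalDeriv μ (partialY i (unitIx μ) L)) :=
    fun μ => (hL.partialY _ _).totalDeriv μ
  have e0 : ∀ k ν, partialY i 0 (totalDeriv ν (characteristic X k)) =
      totalDeriv ν (partialY i 0 (characteristic X k)) :=
    fun k ν => partialY_zero_totalDeriv (hQ k) i 0 ν rfl
  have e1 : ∀ k μ ν, partialY i (unitIx μ) (totalDeriv ν (characteristic X k)) =
      fun j => if μ = ν then partialY i 0 (characteristic X k) j else 0 := by
    intro k μ ν
    funext j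
    split_ifs with h
    · subst h
      have := partialY_add_totalDeriv (hQ k) i 0 μ j
      rw [zero_add, hX.partialY_characteristic] at this
      rw [this]
      simp [totalDeriv, lineDeriv]
    · rw [partialY_zero_totalDeriv (hQ k) i _ ν (by simp [Ne.symm h]),
        hX.partialY_characteristic]
      simp [totalDeriv, lineDeriv]
  have e2 : ∀ μ, partialY i (unitIx μ) (pr X L) = fun j => pr X (partialY i (unitIx μ) L) j +
      ∑ k, partialY i 0 (characteristic X k) j * partialY k (unitIx μ) L j := by
    intro μ
    funext j
    rw [hX.partialY_pr h1 hL]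
    congr 1
    refine Finset.sum_congr rfl fun k _ => ?_
    rw [hX.partialY_characteristic]
    simp [e1]
  have e3 : ∀ μ, totalDeriv μ (partialY i (unitIx μ) (pr X L)) j =
      pr X (totalDeriv μ (partialY i (unitIx μ) L)) j +
      ∑ k, (totalDeriv μ (partialY i 0 (characteristic X k)) j * partialY k (unitIx μ) L j +
        partialY i 0 (characteristic X k) j * totalDeriv μ (partialY k (unitIx μ) L) j) := by
    intro μ
    have hp : IsLocalFunction (pr X (partialY i (unitIx μ) L)) := by
      rw [hX.pr_eq_along]
      exact (hL.partialY _ _).along hX.isLocalField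
    have hm : ∀ k, IsLocalFunction fun j =>
        partialY i 0 (characteristic X k) j * partialY k (unitIx μ) L j :=
      fun k => ((hQ k).partialY _ _).mul (hL.partialY _ _)
    rw [e2, totalDeriv, lineDeriv_jet_add hp (IsLocalFunction.sum fun k _ => hm k),
      hX.pr_totalDeriv (hL.partialY _ _), lineDeriv_jet_sum fun k _ => hm k]
    simp only [lineDeriv_jet_mul ((hQ _).partialY i 0) (hL.partialY _ (unitIx μ))]
    rfl
  have e4 : pr X (eulerLagrange L i) j = pr X (partialY i 0 L) j -
      ∑ μ, pr X (totalDeriv μ (partialY i (unitIx μ) L)) j := by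
    have : eulerLagrange L i = fun j => partialY i 0 L j +
        (-1) * ∑ μ, totalDeriv μ (partialY i (unitIx μ) L) j := by
      funext j
      rw [eulerLagrange]
      ring
    have hs := IsLocalFunction.sum (s := Finset.univ) fun μ _ => hpd μ
    rw [this, pr, lineDeriv_jet_add (hL.partialY _ _) ((isLocalFunction_const _).mul hs),
      lineDeriv_jet_const_mul hs, lineDeriv_jet_sum fun μ _ => hpd μ]
    simp only [pr]
    ring
  rw [e4, eulerLagrange, hX.partialY_pr h1 hL]
  simp only [e3, e0, eulerLagrange, Finset.sum_add_distrib, mul_sub, Finset.mul_sum,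
    Finset.sum_sub_distrib]
  rw [Finset.sum_comm (f := fun k ν => totalDeriv ν (partialY i 0 (characteristic X k)) j *
      partialY k (unitIx ν) L j),
    Finset.sum_comm (f := fun k ν => partialY i 0 (characteristic X k) j *
      totalDeriv ν (partialY k (unitIx ν) L) j)]
  ring

lemma IsVertical.firstVariation_eq {X : PointGenerator} (hX : IsVertical X) (L : Jet → ℝ)
    (j : Jet) : firstVariation L X j = pr X L j := by
  simp only [firstVariation, hX _ _, totalDeriv, lineDeriv_jet_const]
  simp

lemma IsVertical.isFirstOrder_pr {X : PointGenerator} (hX : IsVertical X) {f : Jet → ℝ}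
    (h1 : IsFirstOrder f) (hf : IsLocalFunction f) : IsFirstOrder (pr X f) := by
  have hb : ∀ j j' : Jet, j.1 = j'.1 → (∀ i, j.2 i 0 = j'.2 i 0) → base j = base j' :=
    fun j j' hx hy => Prod.ext hx (funext hy)
  intro j j' hx hy hyd
  simp only [hX.pr_eq_along, along]
  rw [h1.lineDeriv_eq hf _ _ rfl, h1.lineDeriv_eq hf _ _ rfl]
  simp only [prolongField, hX.prolongCoeff_eq, iterTotalDeriv_zero,
      iterTotalDeriv_unitIx (hX.isLocalFunction_characteristic _),
      h1.partialY _ _ j j' hx hy hyd]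
  have : ∀ ν k, totalDeriv ν (fun j => X.η k (base j)) j =
      totalDeriv ν (fun j => X.η k (base j)) j' := by
    intro ν k
    unfold totalDeriv lineDeriv
    congr 1
    funext t
    refine congrArg (X.η k) (hb _ _ ?_ ?_)
    · simp [hx]
    · simp [hy, hyd]
  simp only [hX.characteristic_eq, this, hb j j' hx hy]

/-- Variational vertical generators of a first order Lagrangian are symmetries of its
Euler-Lagrange equations. -/
lemma IsVariational.isELSymmetry {X : PointGenerator} (hX : IsVertical X) {L : Jet → ℝ}
    (h1 : IsFirstOrder L) (hL : IsLocalFunction L) (h : IsVariational L X) :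
    IsELSymmetry L X := by
  obtain ⟨β, hβ, hLβ⟩ := h
  intro j hj i
  have hpr : IsLocalFunction (pr X L) := by
    rw [hX.pr_eq_along]
    exact hL.along hX.isLocalField
  have e : pr X L = fun j => ∑ μ, totalDeriv μ (β μ) j := by
    funext j
    rw [← hLβ, hX.firstVariation_eq]
  have h0 : eulerLagrange (pr X L) i j = 0 := by
    rw [← eulerOp_eq_eulerLagrange (hX.isFirstOrder_pr h1 hL) hpr, e,
      eulerOp_sum _ fun μ => (hβ μ).totalDeriv μ]
    exact Finset.sum_eq_zero fun μ _ => eulerOp_totalDeriv (hβ μ) i μ j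
  rw [hX.eulerLagrange_pr h1 hL] at h0
  simpa [hj] using h0

lemma IsStrictlyVariational.isVariational {X : PointGenerator} {L : Jet → ℝ}
    (h : IsStrictlyVariational L X) : IsVariational L X := by
  refine ⟨fun _ _ => 0, fun _ => isLocalFunction_const 0, fun j => ?_⟩
  simp [h j, totalDeriv, lineDeriv_jet_const]

/-! ### The scalar fields as a complex matrix -/

lemma sqrt_two_mul_half (x : ℝ) : √2 * (√2 / 2 * x) = x := by
  have := Real.mul_self_sqrt (show (0 : ℝ) ≤ 2 by norm_num)
  linear_combination x / 2 * this

lemma half_sqrt_two_mul (x : ℝ) : √2 / 2 * (√2 * x) = x := by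
  have := Real.mul_self_sqrt (show (0 : ℝ) ≤ 2 by norm_num)
  linear_combination x / 2 * this

/-- The real coordinates `φ` and the complex matrix of doublets, as a linear equivalence. -/
def doubletsEquiv : (Fin 8 → ℝ) ≃ₗ[ℝ] Matrix (Fin 2) (Fin 2) ℂ where
  toFun := doublets
  map_add' φ ψ := by
    ext a b
    fin_cases a <;> fin_cases b <;> simp [doublets] <;> ring
  map_smul' r φ := by
    ext a b
    fin_cases a <;> fin_cases b <;> simp [doublets] <;> ring
  invFun Φ := Real.sqrt 2 • ![(Φ 0 0).re, (Φ 0 0).im, (Φ 0 1).re, (Φ 0 1).im,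
    (Φ 1 0).re, (Φ 1 0).im, (Φ 1 1).re, (Φ 1 1).im]
  left_inv φ := by
    ext k
    fin_cases k <;> simp [doublets, sqrt_two_mul_half]
  right_inv Φ := by
    ext a b
    fin_cases a <;> fin_cases b <;> apply Complex.ext <;> simp [doublets, half_sqrt_two_mul]

lemma doubletsEquiv_apply (φ : Fin 8 → ℝ) : doubletsEquiv φ = doublets φ := rfl

/-- The Euclidean inner product on `ℝ⁸` is twice the real trace inner product of the doublets. -/
lemma dotProduct_eq_trace (v w : Fin 8 → ℝ) :
    v ⬝ᵥ w = 2 * ((doublets v)ᴴ * doublets w).trace.re := by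
  have h : (Real.sqrt 2)⁻¹ * (Real.sqrt 2)⁻¹ = (1 / 2 : ℝ) := by
    rw [← mul_inv, Real.mul_self_sqrt (by norm_num)]; norm_num
  simp only [dotProduct, Fin.sum_univ_eight, doublets, one_div, Complex.ofReal_inv,
    Matrix.conjTranspose_smul, Matrix.smul_mul, Matrix.mul_smul, Matrix.trace_smul]
  simp only [Matrix.trace, Matrix.diag, Matrix.mul_apply, Fin.sum_univ_two,
    Matrix.conjTranspose_apply, smul_smul]
  have h2 : (Real.sqrt 2 : ℂ)⁻¹ * star ((Real.sqrt 2 : ℂ)⁻¹) = ((1 / 2 : ℝ) : ℂ) := by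
    rw [← h]; simp
  rw [h2]
  simp
  ring

/-- Right multiplication of the doublet matrix by `B`, in real coordinates: the action of gauge
transformations on scalars. -/
def rightMul (B : Matrix (Fin 2) (Fin 2) ℂ) : (Fin 8 → ℝ) →ₗ[ℝ] (Fin 8 → ℝ) :=
  doubletsEquiv.symm.toLinearMap ∘ₗ LinearMap.mulRight ℝ B ∘ₗ doubletsEquiv.toLinearMap

/-- Left multiplication of the doublet matrix by `a`, in real coordinates: the action of changes of
the Higgs basis. -/
def leftMul (a : Matrix (Fin 2) (Fin 2) ℂ) : (Fin 8 → ℝ) →ₗ[ℝ] (Fin 8 → ℝ) :=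
  doubletsEquiv.symm.toLinearMap ∘ₗ LinearMap.mulLeft ℝ a ∘ₗ doubletsEquiv.toLinearMap

lemma doublets_rightMul (B : Matrix (Fin 2) (Fin 2) ℂ) (φ : Fin 8 → ℝ) :
    doublets (rightMul B φ) = doublets φ * B := by
  rw [← doubletsEquiv_apply, ← doubletsEquiv_apply]
  simp [rightMul]

lemma doublets_leftMul (a : Matrix (Fin 2) (Fin 2) ℂ) (φ : Fin 8 → ℝ) :
    doublets (leftMul a φ) = a * doublets φ := by
  rw [← doubletsEquiv_apply, ← doubletsEquiv_apply]
  simp [leftMul]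

lemma doublets_injective : Function.Injective doublets := doubletsEquiv.injective

lemma rightMul_skew {B : Matrix (Fin 2) (Fin 2) ℂ} (hB : Bᴴ = -B) (v w : Fin 8 → ℝ) :
    rightMul B v ⬝ᵥ w = -(v ⬝ᵥ rightMul B w) := by
  simp only [dotProduct_eq_trace, doublets_rightMul, Matrix.conjTranspose_mul, hB, Matrix.neg_mul,
    Matrix.trace_neg, Complex.neg_re]
  rw [Matrix.trace_mul_cycle, Matrix.trace_mul_comm, ← Matrix.mul_assoc]
  ring

lemma leftMul_skew {a : Matrix (Fin 2) (Fin 2) ℂ} (ha : aᴴ = -a) (v w : Fin 8 → ℝ) :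
    leftMul a v ⬝ᵥ w = -(v ⬝ᵥ leftMul a w) := by
  simp only [dotProduct_eq_trace, doublets_leftMul, Matrix.conjTranspose_mul, ha, Matrix.neg_mul,
    Matrix.trace_neg, Complex.neg_re, Matrix.mul_neg, Matrix.mul_assoc]
  ring

lemma leftMul_rightMul (a B : Matrix (Fin 2) (Fin 2) ℂ) (v : Fin 8 → ℝ) :
    leftMul a (rightMul B v) = rightMul B (leftMul a v) :=
  doublets_injective (by simp only [doublets_leftMul, doublets_rightMul, Matrix.mul_assoc])

/-- The matrices of the gauge generators, with couplings: `none` is hypercharge, `some a` is weak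
isospin. -/
def gaugeMat (c : Gauge) : Option (Fin 3) → Matrix (Fin 2) (Fin 2) ℂ
  | none => (Complex.I * c.g' * c.Y) • 1
  | some a => (Complex.I * c.g * (1 / 2)) • (pauli a)ᵀ

/-- The gauge generators on the real scalar fields. -/
def gaugeGen (c : Gauge) (α : Option (Fin 3)) : (Fin 8 → ℝ) →ₗ[ℝ] (Fin 8 → ℝ) :=
  rightMul (gaugeMat c α)

lemma gaugeMat_conjTranspose (c : Gauge) (α : Option (Fin 3)) :
    (gaugeMat c α)ᴴ = -gaugeMat c α := by
  rcases α with _ | a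
  · simp [gaugeMat]
  · have : ((pauli a)ᵀ)ᴴ = (pauli a)ᵀ := by
      ext i k
      fin_cases a <;> fin_cases i <;> fin_cases k <;> simp [pauli]
    simp [gaugeMat, this]

lemma gaugeGen_skew (c : Gauge) (α : Option (Fin 3)) (v w : Fin 8 → ℝ) :
    gaugeGen c α v ⬝ᵥ w = -(v ⬝ᵥ gaugeGen c α w) :=
  rightMul_skew (gaugeMat_conjTranspose c α) v w

/-! ### The Lagrangian in real form -/

/-- The label of the gauge field `B_μ` (`none`) or `W^a_μ` (`some a`). -/
def gaugeIx : Option (Fin 3) → Fin 4 → FieldIx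
  | none, μ => iB μ
  | some a, μ => iW a μ

lemma gaugeIx_ne_scalar (α : Option (Fin 3)) (μ : Fin 4) (k : Fin 8) : gaugeIx α μ ≠ iφ k := by
  cases α <;> simp [gaugeIx]

lemma gaugeIx_inj {α β : Option (Fin 3)} {μ ν : Fin 4} :
    gaugeIx α μ = gaugeIx β ν ↔ α = β ∧ μ = ν := by
  cases α <;> cases β <;> simp [gaugeIx]

/-- The coordinates `φ_J` of a jet. -/
def scal (J : MIx) : Jet →ₗ[ℝ] (Fin 8 → ℝ) where
  toFun j k := j.2 (iφ k) J
  map_add' _ _ := rfl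
  map_smul' _ _ := rfl

/-- The coordinates `W_{μ,J}` of a jet. -/
def wcoord (μ : Fin 4) (J : MIx) : Jet →ₗ[ℝ] (Fin 3 → ℝ) where
  toFun j a := j.2 (gaugeIx (some a) μ) J
  map_add' _ _ := rfl
  map_smul' _ _ := rfl

/-- The matrix `A_{μ,J} = ∑_α y_{αμ,J} T_α` of (derivatives of) the gauge connection. -/
def conn (c : Gauge) (μ : Fin 4) (J : MIx) : Jet →ₗ[ℝ] (Fin 8 → ℝ) →ₗ[ℝ] (Fin 8 → ℝ) where
  toFun j := ∑ α, j.2 (gaugeIx α μ) J • gaugeGen c α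
  map_add' j j' := by simp [add_smul, Finset.sum_add_distrib]
  map_smul' t j := by simp [mul_smul, Finset.smul_sum]

/-- The covariant derivative `φ_μ + A_μ φ` of the real scalar fields. -/
def covD (c : Gauge) (μ : Fin 4) (j : Jet) : Fin 8 → ℝ :=
  scal (unitIx μ) j + conn c μ 0 j (scal 0 j)

/-- The self-coupling `s g (u × v)` of the `W` bosons; it vanishes for `B`. -/
def selfCoupling (c : Gauge) : Option (Fin 3) → (Fin 3 → ℝ) → (Fin 3 → ℝ) → ℝ
  | none, _, _ => 0
  | some a, u, v => c.s * c.g * crossProduct u v a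

/-- The field strengths `B_{μν}` (`none`) and `W^a_{μν}` (`some a`). -/
def fieldStrength (c : Gauge) (α : Option (Fin 3)) (μ ν : Fin 4) (j : Jet) : ℝ :=
  j.2 (gaugeIx α ν) (unitIx μ) - j.2 (gaugeIx α μ) (unitIx ν)
    + selfCoupling c α (wcoord μ 0 j) (wcoord ν 0 j)

/-- The gauge part of the Lagrangian. -/
def gaugeLagrangian (c : Gauge) (j : Jet) : ℝ :=
  -(1 / 4) * ∑ α, ∑ μ, ∑ ν, metric μ * metric ν * fieldStrength c α μ ν j ^ 2

/-- The potential as a function of the real scalar fields. -/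
def potU (p : Potential) (φ : Fin 8 → ℝ) : ℝ := p.V (doublets φ)

lemma covDeriv_eq (c : Gauge) (μ : Fin 4) (n : Fin 2) (j : Jet) :
    covDeriv c μ n j = doublets (covD c μ j) n := by
  have h1 : doublets (covD c μ j) = doublets (scal (unitIx μ) j) +
      ∑ α, j.2 (gaugeIx α μ) 0 • (doublets (scal 0 j) * gaugeMat c α) := by
    simp only [← doublets_rightMul]
    simp only [← doubletsEquiv_apply, covD, map_add, conn, LinearMap.coe_mk,
      AddHom.coe_mk, LinearMap.sum_apply, LinearMap.smul_apply, map_sum, map_smul, gaugeGen]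
  have h2 : ∀ B : Matrix (Fin 2) (Fin 2) ℂ, (doublets (scal 0 j) * B) n =
      Bᵀ *ᵥ doublets (scal 0 j) n := fun B => by
    rw [Matrix.mulVec_transpose]; rfl
  rw [h1, Fintype.sum_option]
  funext b
  rw [Matrix.add_apply, Matrix.add_apply, Matrix.sum_apply, Matrix.smul_apply]
  simp only [Matrix.smul_apply, h2, gaugeMat, Matrix.transpose_smul, Matrix.transpose_one,
    Matrix.transpose_transpose, Matrix.smul_mulVec, Matrix.one_mulVec, covDeriv, Pi.add_apply,
    Pi.smul_apply, Finset.sum_apply, smul_eq_mul, Finset.mul_sum]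
  change doublets (scal (unitIx μ) j) n b + _ + _ * doublets (scal 0 j) n b = _
  rw [add_assoc, add_comm (Finset.sum _ _)]
  congr 2
  · change _ = ((j.2 (iB μ) 0 : ℝ) : ℂ) * _
    ring
  · refine Finset.sum_congr rfl fun a _ => ?_
    change _ = ((j.2 (iW a μ) 0 : ℝ) : ℂ) * _
    change _ * (((j.2 (iW a μ) 0 : ℝ) : ℂ) * (1 / 2 * (pauli a *ᵥ doublets (scal 0 j) n) b)) = _
    ring

lemma lagrangian_eq (c : Gauge) (p : Potential) (j : Jet) :
    lagrangian c p j = gaugeLagrangian c j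
      + 1 / 2 * ∑ μ, metric μ * (covD c μ j ⬝ᵥ covD c μ j) - potU p (scal 0 j) := by
  have hkin : ∀ μ, ∑ n, (star (covDeriv c μ n j) ⬝ᵥ covDeriv c μ n j).re =
      1 / 2 * (covD c μ j ⬝ᵥ covD c μ j) := by
    intro μ
    rw [dotProduct_eq_trace, Matrix.trace_mul_comm]
    simp only [covDeriv_eq, Matrix.trace, Matrix.diag, Matrix.mul_apply, Fin.sum_univ_two,
      Matrix.conjTranspose_apply, dotProduct, Pi.star_apply, Complex.add_re]
    simp only [mul_comm]
    ring
  have hkin' : ∑ n, ∑ μ, metric μ * (star (covDeriv c μ n j) ⬝ᵥ covDeriv c μ n j).re =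
      1 / 2 * ∑ μ, metric μ * (covD c μ j ⬝ᵥ covD c μ j) := by
    rw [Finset.sum_comm, Finset.mul_sum]
    refine Finset.sum_congr rfl fun μ _ => ?_
    rw [← Finset.mul_sum, hkin]
    ring
  unfold lagrangian
  rw [hkin']
  have hg : gaugeLagrangian c j =
      -(1 / 4) * (∑ a, ∑ μ, ∑ ν, metric μ * metric ν * fieldStrengthW c a μ ν j ^ 2)
      - 1 / 4 * (∑ μ, ∑ ν, metric μ * metric ν * fieldStrengthB μ ν j ^ 2) := by
    rw [gaugeLagrangian, Fintype.sum_option]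
    simp only [fieldStrength, selfCoupling, add_zero, gaugeIx, fieldStrengthW, fieldStrengthB]
    simp only [wcoord, LinearMap.coe_mk, AddHom.coe_mk, gaugeIx]
    ring
  rw [hg]
  rfl

/-! ### The field equations in real form -/

lemma selfCoupling_add_left (c : Gauge) (α : Option (Fin 3)) (u u' v : Fin 3 → ℝ) :
    selfCoupling c α (u + u') v = selfCoupling c α u v + selfCoupling c α u' v := by
  cases α <;> simp [selfCoupling, mul_add]

lemma selfCoupling_add_right (c : Gauge) (α : Option (Fin 3)) (u v v' : Fin 3 → ℝ) :
    selfCoupling c α u (v + v') = selfCoupling c α u v + selfCoupling c α u v' := by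
  cases α <;> simp [selfCoupling, mul_add]

lemma selfCoupling_smul_left (c : Gauge) (α : Option (Fin 3)) (t : ℝ) (u v : Fin 3 → ℝ) :
    selfCoupling c α (t • u) v = t * selfCoupling c α u v := by
  cases α <;> simp [selfCoupling, mul_left_comm]

lemma selfCoupling_smul_right (c : Gauge) (α : Option (Fin 3)) (t : ℝ) (u v : Fin 3 → ℝ) :
    selfCoupling c α u (t • v) = t * selfCoupling c α u v := by
  cases α <;> simp [selfCoupling, mul_left_comm]

/-- The derivative of the field strength at the jet `j` in the direction `v`. -/
def fieldStrengthDeriv (c : Gauge) (α : Option (Fin 3)) (μ ν : Fin 4) (j v : Jet) : ℝ :=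
  v.2 (gaugeIx α ν) (unitIx μ) - v.2 (gaugeIx α μ) (unitIx ν)
    + (selfCoupling c α (wcoord μ 0 v) (wcoord ν 0 j) +
      selfCoupling c α (wcoord μ 0 j) (wcoord ν 0 v))

/-- The derivative of the covariant derivative at the jet `j` in the direction `v`. -/
def covDDeriv (c : Gauge) (μ : Fin 4) (j v : Jet) : Fin 8 → ℝ :=
  scal (unitIx μ) v + (conn c μ 0 v (scal 0 j) + conn c μ 0 j (scal 0 v))

lemma hasDerivAt_quadratic {E : Type*} [NormedAddCommGroup E] [NormedSpace ℝ E] (x y z : E) :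
    HasDerivAt (fun t : ℝ => x + t • y + t ^ 2 • z) y 0 := by
  have h := ((((hasDerivAt_id' (0 : ℝ)).smul_const y).const_add x)).fun_add
    (((hasDerivAt_id' (0 : ℝ)).fun_pow 2).smul_const z)
  simpa using h

lemma hasLineDerivAt_fieldStrength (c : Gauge) (α : Option (Fin 3)) (μ ν : Fin 4) (j v : Jet) :
    HasLineDerivAt ℝ (fieldStrength c α μ ν) (fieldStrengthDeriv c α μ ν j v) j v := by
  have h := hasDerivAt_quadratic (fieldStrength c α μ ν j) (fieldStrengthDeriv c α μ ν j v)
    (selfCoupling c α (wcoord μ 0 v) (wcoord ν 0 v))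
  unfold HasLineDerivAt
  convert h using 1
  funext t
  simp only [fieldStrength, fieldStrengthDeriv, map_add, map_smul, selfCoupling_add_left,
    selfCoupling_add_right, selfCoupling_smul_left, selfCoupling_smul_right, Prod.snd_add,
    Prod.smul_snd, Pi.add_apply, Pi.smul_apply, smul_eq_mul]
  ring

lemma hasLineDerivAt_covD (c : Gauge) (μ : Fin 4) (j v : Jet) :
    HasLineDerivAt ℝ (covD c μ) (covDDeriv c μ j v) j v := by
  have h := hasDerivAt_quadratic (covD c μ j) (covDDeriv c μ j v) (conn c μ 0 v (scal 0 v))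
  unfold HasLineDerivAt
  convert h using 1
  funext t
  simp only [covD, covDDeriv, map_add, map_smul, LinearMap.add_apply, LinearMap.smul_apply]
  module

lemma _root_.HasDerivAt.dotProduct {n : Type*} [Fintype n] {u w : ℝ → n → ℝ} {u' w' : n → ℝ} {t : ℝ}
    (hu : HasDerivAt u u' t) (hw : HasDerivAt w w' t) :
    HasDerivAt (fun t => u t ⬝ᵥ w t) (u' ⬝ᵥ w t + u t ⬝ᵥ w') t := by
  simp only [_root_.dotProduct, ← Finset.sum_add_distrib]
  exact HasDerivAt.fun_sum fun k _ => (hasDerivAt_pi.1 hu k).mul (hasDerivAt_pi.1 hw k)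

lemma contDiff_potU (p : Potential) : ContDiff ℝ ∞ (potU p) := by
  have hre : ContDiff ℝ ∞ (fun z : ℂ => z.re) := Complex.reCLM.contDiff
  have hof : ContDiff ℝ ∞ (fun x : ℝ => (x : ℂ)) := Complex.ofRealCLM.contDiff
  have hstar : ContDiff ℝ ∞ (fun z : ℂ => star z) := Complex.conjCLE.contDiff
  have hΦ : ∀ a b, ContDiff ℝ ∞ fun φ : Fin 8 → ℝ => doublets φ a b := by
    intro a b
    have : ∀ k, ContDiff ℝ ∞ fun φ : Fin 8 → ℝ => ((φ k : ℝ) : ℂ) := fun k =>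
      hof.comp (contDiff_apply ℝ ℝ k)
    have h2 : ∀ k l, ContDiff ℝ ∞ fun φ : Fin 8 → ℝ =>
        ((1 / √2 : ℝ) : ℂ) * (φ k + φ l * Complex.I) := fun k l =>
      contDiff_const.mul ((this k).add ((this l).mul contDiff_const))
    fin_cases a <;> fin_cases b
    · exact h2 0 1
    · exact h2 2 3
    · exact h2 4 5
    · exact h2 6 7
  have hb : ∀ a b, ContDiff ℝ ∞ fun φ : Fin 8 → ℝ => star (doublets φ a) ⬝ᵥ doublets φ b := by
    intro a b
    simp only [dotProduct, Fin.sum_univ_two, Pi.star_apply]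
    exact ((hstar.comp (hΦ a 0)).mul (hΦ b 0)).add ((hstar.comp (hΦ a 1)).mul (hΦ b 1))
  have hbr := fun a b => hre.comp (hb a b)
  unfold potU Potential.V
  refine ContDiff.add (((((ContDiff.sub (ContDiff.add ?_ ?_) ?_).add ?_).add ?_).add ?_).add ?_) ?_
  · exact contDiff_const.mul (hbr 0 0)
  · exact contDiff_const.mul (hbr 1 1)
  · exact contDiff_const.mul (hre.comp (contDiff_const.mul (hb 0 1)))
  · exact contDiff_const.mul ((hbr 0 0).pow 2)
  · exact contDiff_const.mul ((hbr 1 1).pow 2)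
  · exact (contDiff_const.mul (hbr 0 0)).mul (hbr 1 1)
  · exact contDiff_const.mul (hre.comp ((hb 0 1).mul (hb 1 0)))
  · exact contDiff_const.mul (hre.comp (((contDiff_const.mul ((hb 0 1).pow 2)).add
      ((contDiff_const.mul (hb 0 0)).mul (hb 0 1))).add
      ((contDiff_const.mul (hb 1 1)).mul (hb 0 1))))

lemma differentiable_potU (p : Potential) : Differentiable ℝ (potU p) :=
  (contDiff_potU p).differentiable (by simp)

/-- The derivative of the Lagrangian at the jet `j` in the direction `v`. -/
def lagrangianDeriv (c : Gauge) (p : Potential) (j v : Jet) : ℝ :=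
  -(1 / 2) * (∑ α, ∑ μ, ∑ ν,
      metric μ * metric ν * (fieldStrength c α μ ν j * fieldStrengthDeriv c α μ ν j v))
    + ∑ μ, metric μ * (covD c μ j ⬝ᵥ covDDeriv c μ j v) - fderiv ℝ (potU p) (scal 0 j) (scal 0 v)

lemma hasLineDerivAt_lagrangian (c : Gauge) (p : Potential) (j v : Jet) :
    HasLineDerivAt ℝ (lagrangian c p) (lagrangianDeriv c p j v) j v := by
  have hF := fun α μ ν => hasLineDerivAt_fieldStrength c α μ ν j v
  have hD := fun μ => hasLineDerivAt_covD c μ j v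
  have hU := hasLineDerivAt_comp_linear (scal 0) (differentiable_potU p (scal 0 j)) v
  have h := ((HasDerivAt.const_mul (-(1 / 4)) (HasDerivAt.fun_sum fun α (_ : α ∈ Finset.univ) =>
    HasDerivAt.fun_sum fun μ (_ : μ ∈ Finset.univ) =>
    HasDerivAt.fun_sum fun ν (_ : ν ∈ Finset.univ) =>
      HasDerivAt.const_mul (metric μ * metric ν) (HasDerivAt.fun_pow (hF α μ ν) 2))).add
    (HasDerivAt.const_mul (1 / 2) (HasDerivAt.fun_sum fun μ (_ : μ ∈ Finset.univ) =>
      HasDerivAt.const_mul (metric μ) ((hD μ).dotProduct (hD μ))))).sub hU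
  have hL : lagrangian c p = fun j => gaugeLagrangian c j
      + 1 / 2 * ∑ μ, metric μ * (covD c μ j ⬝ᵥ covD c μ j) - potU p (scal 0 j) :=
    funext fun j => lagrangian_eq c p j
  rw [hL]
  refine h.congr_deriv ?_
  simp only [lagrangianDeriv, Finset.mul_sum, zero_smul, add_zero]
  refine congrArg₂ _ (congrArg₂ _ ?_ ?_) rfl
  · refine Finset.sum_congr rfl fun α _ => Finset.sum_congr rfl fun μ _ =>
      Finset.sum_congr rfl fun ν _ => ?_
    simp
    ring
  · refine Finset.sum_congr rfl fun μ _ => ?_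
    rw [dotProduct_comm (covDDeriv c μ j v)]
    ring

lemma isLocalFunction_gaugeLagrangian (c : Gauge) : IsLocalFunction (gaugeLagrangian c) := by
  have hW : ∀ (α : Option (Fin 3)) (μ ν : Fin 4),
      IsLocalFunction fun j => selfCoupling c α (wcoord μ 0 j) (wcoord ν 0 j) := by
    have hw : ∀ a μ, IsLocalFunction fun j => wcoord μ 0 j a :=
      fun a μ => isLocalFunction_coord _ _
    intro α μ ν
    rcases α with _ | a
    · exact isLocalFunction_const 0
    · refine (isLocalFunction_const _).mul ?_
      simp only [cross_apply]
      fin_cases a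
      · exact ((hw 1 μ).mul (hw 2 ν)).sub ((hw 2 μ).mul (hw 1 ν))
      · exact ((hw 2 μ).mul (hw 0 ν)).sub ((hw 0 μ).mul (hw 2 ν))
      · exact ((hw 0 μ).mul (hw 1 ν)).sub ((hw 1 μ).mul (hw 0 ν))
  have hF : ∀ α μ ν, IsLocalFunction (fieldStrength c α μ ν) := fun α μ ν =>
    ((isLocalFunction_coord _ _).sub (isLocalFunction_coord _ _)).add (hW α μ ν)
  refine (isLocalFunction_const _).mul (IsLocalFunction.sum fun α _ => IsLocalFunction.sum
    fun μ _ => IsLocalFunction.sum fun ν _ => ?_)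
  simp only [pow_two]
  exact (isLocalFunction_const _).mul ((hF α μ ν).mul (hF α μ ν))

lemma isLocalFunction_lagrangian (c : Gauge) (p : Potential) :
    IsLocalFunction (lagrangian c p) := by
  have hs : ∀ J k, IsLocalFunction fun j => scal J j k := fun J k => isLocalFunction_coord _ _
  have hD : ∀ μ k, IsLocalFunction fun j => covD c μ j k := by
    intro μ k
    have e : ∀ j, covD c μ j k = scal (unitIx μ) j k + ∑ α, j.2 (gaugeIx α μ) 0 *
        ∑ l, scal 0 j l * gaugeGen c α (Pi.single l 1) k := by
      intro j
      have e2 : ∀ α, gaugeGen c α (scal 0 j) k =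
          ∑ l, scal 0 j l * gaugeGen c α (Pi.single l 1) k := by
        intro α
        conv_lhs => rw [pi_eq_sum_univ' (scal 0 j)]
        simp [map_sum, Finset.sum_apply]
      simp [covD, conn, LinearMap.sum_apply, Finset.sum_apply, e2]
    simp only [e]
    exact (hs _ _).add (IsLocalFunction.sum fun α _ => (isLocalFunction_coord _ _).mul
      (IsLocalFunction.sum fun l _ => (hs _ _).mul (isLocalFunction_const _)))
  have hU : IsLocalFunction fun j => potU p (scal 0 j) :=
    IsLocalFunction.comp (g := fun k j => scal 0 j k) (fun k => hs 0 k)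
      (H := fun z => potU p z.2) ((contDiff_potU p).comp contDiff_snd)
  have hL : lagrangian c p = fun j => gaugeLagrangian c j
      + 1 / 2 * ∑ μ, metric μ * (covD c μ j ⬝ᵥ covD c μ j) - potU p (scal 0 j) :=
    funext fun j => lagrangian_eq c p j
  rw [hL]
  exact ((isLocalFunction_gaugeLagrangian c).add ((isLocalFunction_const _).mul
    (IsLocalFunction.sum fun μ _ => (isLocalFunction_const _).mul
      (IsLocalFunction.sum fun k _ => (hD μ k).mul (hD μ k))))).sub hU

lemma scal_congr {J : MIx} {j j' : Jet} (h : ∀ i, j.2 i J = j'.2 i J) : scal J j = scal J j' :=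
  funext fun _ => h _

lemma wcoord_congr {μ : Fin 4} {J : MIx} {j j' : Jet}
    (h : ∀ α μ, j.2 (gaugeIx α μ) J = j'.2 (gaugeIx α μ) J) :
    wcoord μ J j = wcoord μ J j' :=
  funext fun _ => h _ _

lemma conn_congr {c : Gauge} {μ : Fin 4} {J : MIx} {j j' : Jet}
    (h : ∀ i, j.2 i J = j'.2 i J) : conn c μ J j = conn c μ J j' := by
  simp [conn, h]

lemma isFirstOrder_lagrangian (c : Gauge) (p : Potential) : IsFirstOrder (lagrangian c p) := by
  intro j j' _ hy hyd
  have hd : ∀ μ, covD c μ j = covD c μ j' := fun μ => by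
    simp only [covD, scal_congr hy, scal_congr (fun i => hyd i μ), conn_congr hy]
  have hF : ∀ α μ ν, fieldStrength c α μ ν j = fieldStrength c α μ ν j' := fun α μ ν => by
    simp only [fieldStrength, hyd, wcoord_congr fun α μ => hy (gaugeIx α μ)]
  simp only [lagrangian_eq, gaugeLagrangian, hd, hF, scal_congr hy]

lemma scal_coordField_scalar (k : Fin 8) (I J : MIx) (j : Jet) :
    scal J (coordField (iφ k) I j) = if J = I then Pi.single k 1 else 0 := by
  funext l
  by_cases hl : l = k
  · subst hl
    by_cases h : J = I <;> simp [scal, coordField, h]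
  · by_cases h : J = I <;> simp [scal, coordField, h, hl]

lemma coordField_scalar_gauge (k : Fin 8) (I J : MIx) (α : Option (Fin 3)) (μ : Fin 4) (j : Jet) :
    (coordField (iφ k) I j).2 (gaugeIx α μ) J = 0 := by
  simp [coordField, gaugeIx_ne_scalar]

lemma scal_coordField_gauge (α : Option (Fin 3)) (μ : Fin 4) (I J : MIx) (j : Jet) :
    scal J (coordField (gaugeIx α μ) I j) = 0 := by
  funext l
  simp [scal, coordField, (gaugeIx_ne_scalar α μ l).symm]

lemma coordField_gauge_gauge (α β : Option (Fin 3)) (μ ν : Fin 4) (I J : MIx) (j : Jet) :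
    (coordField (gaugeIx α μ) I j).2 (gaugeIx β ν) J =
      if β = α ∧ ν = μ ∧ J = I then 1 else 0 := by
  by_cases h : gaugeIx β ν = gaugeIx α μ
  · obtain ⟨rfl, rfl⟩ := gaugeIx_inj.1 h
    simp [coordField, Pi.single_apply]
  · have h' : ¬ (β = α ∧ ν = μ ∧ J = I) := fun h' => h (gaugeIx_inj.2 ⟨h'.1, h'.2.1⟩)
    simp [coordField, h, h']

lemma wcoord_eq_zero {v : Jet} {J : MIx} (h : ∀ α μ, v.2 (gaugeIx α μ) J = 0) (μ : Fin 4) :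
    wcoord μ J v = 0 := funext fun _ => h _ _

lemma conn_eq_zero {c : Gauge} {v : Jet} {J : MIx} (h : ∀ α μ, v.2 (gaugeIx α μ) J = 0)
    (μ : Fin 4) : conn c μ J v = 0 := by
  simp [conn, h]

lemma selfCoupling_zero_left (c : Gauge) (α : Option (Fin 3)) (v : Fin 3 → ℝ) :
    selfCoupling c α 0 v = 0 := by
  cases α <;> simp [selfCoupling]

lemma selfCoupling_zero_right (c : Gauge) (α : Option (Fin 3)) (v : Fin 3 → ℝ) :
    selfCoupling c α v 0 = 0 := by
  cases α <;> simp [selfCoupling]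

lemma fieldStrengthDeriv_eq_zero {c : Gauge} {j v : Jet}
    (h : ∀ α μ J, v.2 (gaugeIx α μ) J = 0) (α : Option (Fin 3)) (μ ν : Fin 4) :
    fieldStrengthDeriv c α μ ν j v = 0 := by
  simp [fieldStrengthDeriv, h, wcoord_eq_zero fun α μ => h α μ _, selfCoupling_zero_left,
    selfCoupling_zero_right]

lemma conn_skew (c : Gauge) (μ : Fin 4) (J : MIx) (j : Jet) (v w : Fin 8 → ℝ) :
    conn c μ J j v ⬝ᵥ w = -(v ⬝ᵥ conn c μ J j w) := by
  simp [conn, LinearMap.sum_apply, sum_dotProduct, dotProduct_sum, gaugeGen_skew]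
  ring

/-- The gradient of the potential. -/
def gradU (p : Potential) (φ : Fin 8 → ℝ) (k : Fin 8) : ℝ := fderiv ℝ (potU p) φ (Pi.single k 1)

lemma partialY_lagrangian (c : Gauge) (p : Potential) (i : FieldIx) (J : MIx) :
    partialY i J (lagrangian c p) = fun j => lagrangianDeriv c p j (coordField i J j) :=
  funext fun j => (hasLineDerivAt_lagrangian c p j (coordField i J j)).lineDeriv

lemma partialY_scalar (c : Gauge) (p : Potential) (k : Fin 8) (j : Jet) :
    partialY (iφ k) 0 (lagrangian c p) j =
      -(∑ μ, metric μ * conn c μ 0 j (covD c μ j) k) - gradU p (scal 0 j) k := by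
  simp only [partialY_lagrangian, lagrangianDeriv, covDDeriv,
    fieldStrengthDeriv_eq_zero (fun α μ J => coordField_scalar_gauge k 0 J α μ j),
    conn_eq_zero (fun α μ => coordField_scalar_gauge k 0 0 α μ j), scal_coordField_scalar,
    unitIx_ne_zero, if_true, if_false, LinearMap.zero_apply, zero_add, mul_zero,
    Finset.sum_const_zero, gradU]
  congr 1
  rw [← Finset.sum_neg_distrib]
  refine Finset.sum_congr rfl fun μ _ => ?_
  have := conn_skew c μ 0 j (covD c μ j) (Pi.single k 1)
  rw [dotProduct_single_one] at this
  rw [this]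
  ring

lemma partialY_scalar_unitIx (c : Gauge) (p : Potential) (k : Fin 8) (μ : Fin 4) :
    partialY (iφ k) (unitIx μ) (lagrangian c p) = fun j => metric μ * covD c μ j k := by
  funext j
  simp only [partialY_lagrangian, lagrangianDeriv, covDDeriv,
    fieldStrengthDeriv_eq_zero (fun α ν J => coordField_scalar_gauge k (unitIx μ) J α ν j),
    conn_eq_zero (fun α ν => coordField_scalar_gauge k (unitIx μ) 0 α ν j),
    scal_coordField_scalar, (unitIx_ne_zero μ).symm, if_false, LinearMap.zero_apply, map_zero,
    add_zero, mul_zero, Finset.sum_const_zero, sub_zero, zero_add, unitIx_inj]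
  rw [Finset.sum_eq_single μ]
  · simp
  · intro ν _ hν
    simp [hν]
  · simp

lemma partialY_gauge (c : Gauge) (p : Potential) (α : Option (Fin 3)) (ν : Fin 4) (j : Jet) :
    partialY (gaugeIx α ν) 0 (lagrangian c p) j =
      metric ν * (covD c ν j ⬝ᵥ gaugeGen c α (scal 0 j)) - 1 / 2 * ∑ β, ∑ ρ, ∑ σ,
        metric ρ * metric σ * (fieldStrength c β ρ σ j *
          fieldStrengthDeriv c β ρ σ j (coordField (gaugeIx α ν) 0 j)) := by
  simp only [partialY_lagrangian, lagrangianDeriv, covDDeriv, scal_coordField_gauge, map_zero,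
    add_zero, zero_add, sub_zero]
  rw [Finset.sum_eq_single ν]
  · have : conn c ν 0 (coordField (gaugeIx α ν) 0 j) = gaugeGen c α := by
      simp only [conn, LinearMap.coe_mk, AddHom.coe_mk, coordField_gauge_gauge]
      simp
    rw [this]
    ring
  · intro μ _ hμ
    have : conn c μ 0 (coordField (gaugeIx α ν) 0 j) = 0 := by
      simp [conn, coordField_gauge_gauge, hμ]
    simp [this]
  · simp

lemma fieldStrength_antisymm (c : Gauge) (α : Option (Fin 3)) (μ ν : Fin 4) (j : Jet) :
    fieldStrength c α ν μ j = -fieldStrength c α μ ν j := by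
  have : selfCoupling c α (wcoord ν 0 j) (wcoord μ 0 j) =
      -selfCoupling c α (wcoord μ 0 j) (wcoord ν 0 j) := by
    rcases α with _ | a
    · simp [selfCoupling]
    · simp only [selfCoupling]
      rw [← neg_cross]
      simp
  simp only [fieldStrength, this]
  ring

lemma partialY_gauge_unitIx (c : Gauge) (p : Potential) (α : Option (Fin 3)) (ν μ : Fin 4) :
    partialY (gaugeIx α ν) (unitIx μ) (lagrangian c p) = fun j =>
      -(metric μ * metric ν) * fieldStrength c α μ ν j := by
  funext j
  have h0 : ∀ β σ, (coordField (gaugeIx α ν) (unitIx μ) j).2 (gaugeIx β σ) 0 = 0 := by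
    intro β σ
    rw [coordField_gauge_gauge, if_neg fun h => unitIx_ne_zero μ h.2.2.symm]
  simp only [partialY_lagrangian, lagrangianDeriv, covDDeriv, scal_coordField_gauge, map_zero,
    add_zero, sub_zero, fieldStrengthDeriv, wcoord_eq_zero h0, conn_eq_zero h0,
    selfCoupling_zero_left, selfCoupling_zero_right, LinearMap.zero_apply, dotProduct_zero,
    mul_zero, Finset.sum_const_zero, coordField_gauge_gauge, unitIx_inj]
  have e : ∀ β ρ σ, metric ρ * metric σ * (fieldStrength c β ρ σ j *
      ((if β = α ∧ σ = ν ∧ ρ = μ then 1 else 0) - if β = α ∧ ρ = ν ∧ σ = μ then 1 else 0)) =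
      (if β = α then if ρ = μ then if σ = ν then
        metric ρ * metric σ * fieldStrength c β ρ σ j else 0 else 0 else 0) -
      (if β = α then if ρ = ν then if σ = μ then
        metric ρ * metric σ * fieldStrength c β ρ σ j else 0 else 0 else 0) := by
    intro β ρ σ
    split_ifs <;> grind
  simp only [e, Finset.sum_sub_distrib]
  have e1 : ∀ ρ' σ' : Fin 4, (∑ β, ∑ ρ, ∑ σ, if β = α then if ρ = ρ' then if σ = σ' then
        metric ρ * metric σ * fieldStrength c β ρ σ j else 0 else 0 else 0) =
      metric ρ' * metric σ' * fieldStrength c α ρ' σ' j := by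
    intro ρ' σ'
    rw [Finset.sum_eq_single α, Finset.sum_eq_single ρ', Finset.sum_eq_single σ'] <;>
      simp +contextual
  rw [e1, e1, fieldStrength_antisymm c α μ ν]
  ring

/-- The operator on the left of the scalar field equations, without the potential:
`∑_μ m_μ (φ_μμ + A_{μ,μ} φ + 2 A_μ φ_μ + A_μ A_μ φ)`. -/
def boxD (c : Gauge) (j : Jet) : Fin 8 → ℝ :=
  ∑ μ, metric μ • (scal (unitIx μ + unitIx μ) j + conn c μ (unitIx μ) j (scal 0 j)
    + (2 : ℝ) • conn c μ 0 j (scal (unitIx μ) j) + conn c μ 0 j (conn c μ 0 j (scal 0 j)))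

lemma scal_totalField (μ : Fin 4) (J : MIx) (j : Jet) :
    scal J (totalField μ j) = scal (J + unitIx μ) j := rfl

lemma conn_totalField (c : Gauge) (ν μ : Fin 4) (J : MIx) (j : Jet) :
    conn c ν J (totalField μ j) = conn c ν (J + unitIx μ) j := rfl

lemma wcoord_totalField (ν μ : Fin 4) (J : MIx) (j : Jet) :
    wcoord ν J (totalField μ j) = wcoord ν (J + unitIx μ) j := rfl

/-- The scalar field equations. -/
lemma eulerLagrange_scalar (c : Gauge) (p : Potential) (k : Fin 8) (j : Jet) :
    eulerLagrange (lagrangian c p) (iφ k) j = -boxD c j k - gradU p (scal 0 j) k := by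
  have h : ∀ μ, totalDeriv μ (fun j => metric μ * covD c μ j k) j =
      metric μ * covDDeriv c μ j (totalField μ j) k := fun μ =>
    (HasDerivAt.const_mul _
      (hasDerivAt_pi.1 (hasLineDerivAt_covD c μ j (totalField μ j)) k)).deriv
  simp only [eulerLagrange, partialY_scalar, partialY_scalar_unitIx, h, boxD]
  simp only [Finset.sum_apply, covDDeriv, scal_totalField, conn_totalField, zero_add,
    covD, Pi.smul_apply, Pi.add_apply, smul_eq_mul, map_add]
  rw [sub_right_comm, ← Finset.sum_neg_distrib, ← Finset.sum_neg_distrib,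
    ← Finset.sum_sub_distrib]
  congr 1
  refine Finset.sum_congr rfl fun μ _ => ?_
  ring

/-- The part of the gauge field equations that involves first order jets of gauge fields only. -/
def gaugeSource (c : Gauge) (α : Option (Fin 3)) (ν : Fin 4) (j : Jet) : ℝ :=
  -(1 / 2 * ∑ β, ∑ ρ, ∑ σ, metric ρ * metric σ * (fieldStrength c β ρ σ j *
      fieldStrengthDeriv c β ρ σ j (coordField (gaugeIx α ν) 0 j)))
    + ∑ μ, metric μ * metric ν * (selfCoupling c α (wcoord μ (unitIx μ) j) (wcoord ν 0 j) +
      selfCoupling c α (wcoord μ 0 j) (wcoord ν (unitIx μ) j))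

/-- The gauge field equations. -/
lemma eulerLagrange_gauge (c : Gauge) (p : Potential) (α : Option (Fin 3)) (ν : Fin 4) (j : Jet) :
    eulerLagrange (lagrangian c p) (gaugeIx α ν) j =
      metric ν * (covD c ν j ⬝ᵥ gaugeGen c α (scal 0 j)) + (gaugeSource c α ν j +
        ∑ μ, metric μ * metric ν * (j.2 (gaugeIx α ν) (unitIx μ + unitIx μ) -
          j.2 (gaugeIx α μ) (unitIx ν + unitIx μ))) := by
  have h : ∀ μ, totalDeriv μ (fun j => -(metric μ * metric ν) * fieldStrength c α μ ν j) j =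
      -(metric μ * metric ν) * fieldStrengthDeriv c α μ ν j (totalField μ j) := fun μ =>
    (HasDerivAt.const_mul _ (hasLineDerivAt_fieldStrength c α μ ν j (totalField μ j))).deriv
  simp only [eulerLagrange, partialY_gauge, partialY_gauge_unitIx, h, gaugeSource]
  simp only [fieldStrengthDeriv, wcoord_totalField, zero_add, neg_mul, Finset.sum_neg_distrib,
    sub_eq_add_neg, neg_neg, add_assoc, ← Finset.sum_add_distrib]
  refine congrArg₂ _ rfl (congrArg₂ _ rfl (Finset.sum_congr rfl fun μ _ => ?_))
  simp only [totalField]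
  ring

lemma gaugeSource_congr {c : Gauge} {j j' : Jet}
    (h : ∀ α μ, j.2 (gaugeIx α μ) 0 = j'.2 (gaugeIx α μ) 0)
    (hd : ∀ α μ ν, j.2 (gaugeIx α μ) (unitIx ν) = j'.2 (gaugeIx α μ) (unitIx ν))
    (α : Option (Fin 3)) (ν : Fin 4) : gaugeSource c α ν j = gaugeSource c α ν j' := by
  simp only [gaugeSource, fieldStrength, fieldStrengthDeriv, hd, wcoord_congr h,
    wcoord_congr (J := unitIx _) fun α μ => hd α μ _]
  rfl

/-! ### Solving the field equations for second derivatives -/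

/-- The jet with coordinates `x`, `y`, first derivatives `p`, pure second derivatives `r`, and all
other derivatives zero. -/
def mkJet (x : Spacetime) (y : FieldIx → ℝ) (p r : Fin 4 → FieldIx → ℝ) : Jet :=
  (x, fun i J => (if J = 0 then y i else 0) + (∑ μ, if J = unitIx μ then p μ i else 0) +
    ∑ μ, if J = unitIx μ + unitIx μ then r μ i else 0)

lemma sum_unitIx (μ : Fin 4) : ∑ ν, unitIx μ ν = 1 := by simp

lemma sum_unitIx_add (μ ν : Fin 4) : ∑ ρ, (unitIx μ + unitIx ν) ρ = 2 := by
  rw [sum_add_unitIx, sum_unitIx]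

lemma unitIx_add_ne_zero (μ ν : Fin 4) : unitIx μ + unitIx ν ≠ 0 := fun h => by
  have := sum_unitIx_add μ ν
  rw [h] at this
  simp at this

lemma unitIx_add_ne_unitIx (μ ν ρ : Fin 4) : unitIx μ + unitIx ν ≠ unitIx ρ := fun h => by
  have := sum_unitIx_add μ ν
  rw [h, sum_unitIx] at this
  omega

lemma unitIx_add_eq_iff (μ ν ρ : Fin 4) :
    unitIx μ + unitIx ν = unitIx ρ + unitIx ρ ↔ μ = ρ ∧ ν = ρ := by
  constructor
  · intro h
    have h1 : (if ρ = μ then 1 else 0) + (if ρ = ν then 1 else 0) = 1 + 1 := by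
      simpa [Pi.single_apply] using congrFun h ρ
    split_ifs at h1 with h2 h3
    · exact ⟨h2.symm, h3.symm⟩
    all_goals omega
  · rintro ⟨rfl, rfl⟩; rfl

lemma mkJet_zero (x : Spacetime) (y : FieldIx → ℝ) (p r : Fin 4 → FieldIx → ℝ) (i : FieldIx) :
    (mkJet x y p r).2 i 0 = y i := by
  simp [mkJet, (unitIx_ne_zero _).symm, (unitIx_add_ne_zero _ _).symm]

lemma mkJet_unitIx (x : Spacetime) (y : FieldIx → ℝ) (p r : Fin 4 → FieldIx → ℝ) (i : FieldIx)
    (μ : Fin 4) : (mkJet x y p r).2 i (unitIx μ) = p μ i := by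
  simp only [mkJet, unitIx_ne_zero, (unitIx_add_ne_unitIx _ _ _).symm, if_false, zero_add,
    Finset.sum_const_zero, add_zero, unitIx_inj]
  simp

lemma mkJet_unitIx_add (x : Spacetime) (y : FieldIx → ℝ) (p r : Fin 4 → FieldIx → ℝ)
    (i : FieldIx) (μ ν : Fin 4) :
    (mkJet x y p r).2 i (unitIx μ + unitIx ν) = if μ = ν then r μ i else 0 := by
  simp only [mkJet, unitIx_add_ne_zero, unitIx_add_ne_unitIx, if_false, zero_add,
    Finset.sum_const_zero, unitIx_add_eq_iff]
  by_cases h : μ = ν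
  · subst h; simp
  · have : ∀ ρ, ¬ (μ = ρ ∧ ν = ρ) := fun ρ h' => h (h'.1.trans h'.2.symm)
    simp [this, h]

lemma metric_mul_self (μ : Fin 4) : metric μ * metric μ = 1 := by
  fin_cases μ <;> simp [metric]

lemma metric_ne_zero (μ : Fin 4) : metric μ ≠ 0 := fun h => by
  have := metric_mul_self μ
  simp [h] at this

section

variable (c : Gauge) (P : Potential) (x : Spacetime) (y : FieldIx → ℝ) (p r : Fin 4 → FieldIx → ℝ)

lemma conn_mkJet_congr (r' : Fin 4 → FieldIx → ℝ) (μ : Fin 4) :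
    conn c μ 0 (mkJet x y p r) = conn c μ 0 (mkJet x y p r') ∧
    conn c μ (unitIx μ) (mkJet x y p r) = conn c μ (unitIx μ) (mkJet x y p r') := by
  constructor <;> apply conn_congr <;> simp [mkJet_zero, mkJet_unitIx]

lemma scal_mkJet_zero : scal 0 (mkJet x y p r) = fun k => y (iφ k) :=
  funext fun _ => mkJet_zero x y p r _

lemma scal_mkJet_unitIx (μ : Fin 4) : scal (unitIx μ) (mkJet x y p r) = fun k => p μ (iφ k) :=
  funext fun _ => mkJet_unitIx x y p r _ μ

lemma scal_mkJet_unitIx_add (μ : Fin 4) :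
    scal (unitIx μ + unitIx μ) (mkJet x y p r) = fun k => r μ (iφ k) :=
  funext fun k => (mkJet_unitIx_add x y p r (iφ k) μ μ).trans (if_pos rfl)

lemma eulerLagrange_scalar_mkJet (k : Fin 8) :
    eulerLagrange (lagrangian c P) (iφ k) (mkJet x y p r) =
      eulerLagrange (lagrangian c P) (iφ k) (mkJet x y p 0) - ∑ μ, metric μ * r μ (iφ k) := by
  have h := fun μ => conn_mkJet_congr c x y p r 0 μ
  simp only [eulerLagrange_scalar, boxD, scal_mkJet_zero, scal_mkJet_unitIx,
    scal_mkJet_unitIx_add, (h _).1, (h _).2, Finset.sum_apply, Pi.smul_apply, Pi.add_apply,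
    smul_eq_mul, Pi.zero_apply]
  rw [sub_right_comm, ← Finset.sum_neg_distrib, ← Finset.sum_neg_distrib,
    ← Finset.sum_sub_distrib]
  congr 1
  refine Finset.sum_congr rfl fun μ _ => ?_
  ring

/-- In the equation of the gauge field component `ν`, the second derivative `∂_ν∂_ν` of that
component drops out. -/
lemma eulerLagrange_gauge_mkJet (α : Option (Fin 3)) (ν : Fin 4) :
    eulerLagrange (lagrangian c P) (gaugeIx α ν) (mkJet x y p r) =
      eulerLagrange (lagrangian c P) (gaugeIx α ν) (mkJet x y p 0) +
        ∑ μ, if μ = ν then 0 else metric μ * metric ν * r μ (gaugeIx α ν) := by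
  have h1 : covD c ν (mkJet x y p r) = covD c ν (mkJet x y p 0) := by
    simp only [covD, scal_mkJet_zero, scal_mkJet_unitIx, (conn_mkJet_congr c x y p r 0 ν).1]
  have h2 : gaugeSource c α ν (mkJet x y p r) = gaugeSource c α ν (mkJet x y p 0) :=
    gaugeSource_congr (by simp [mkJet_zero]) (by simp [mkJet_unitIx]) α ν
  simp only [eulerLagrange_gauge, h1, h2, scal_mkJet_zero, mkJet_unitIx_add, if_true]
  rw [add_assoc, add_assoc]
  congr 2
  rw [← Finset.sum_add_distrib]
  refine Finset.sum_congr rfl fun μ _ => ?_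
  by_cases h : μ = ν
  · subst h; simp
  · simp [h, Ne.symm h]

/-- The spacetime index of a gauge field component. -/
def gaugeDir : Fin 4 ⊕ (Fin 3 × Fin 4) → Fin 4 := Sum.elim id Prod.snd

/-- Pure second derivatives that solve the field equations for a given first order jet. The values
`t` of `∂_ν∂_ν` of the gauge field components with index `ν` are arbitrary. The scalar equations are
solved for `∂_0∂_0`, and the equation of a component with index `ν` for `∂_{ν+1}∂_{ν+1}` of that
component, with `ν + 1` taken modulo 4. -/
def solveR (t : Fin 4 ⊕ (Fin 3 × Fin 4) → ℝ) (μ : Fin 4) : FieldIx → ℝ :=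
  Sum.elim
    (fun k => if μ = 0 then eulerLagrange (lagrangian c P) (iφ k) (mkJet x y p 0) else 0)
    (fun i => if μ = gaugeDir i then t i else if μ = gaugeDir i + 1 then
      -(metric μ * metric (gaugeDir i)) *
        eulerLagrange (lagrangian c P) (Sum.inr i) (mkJet x y p 0) else 0)

lemma solveR_spec (t : Fin 4 ⊕ (Fin 3 × Fin 4) → ℝ) (i : FieldIx) :
    eulerLagrange (lagrangian c P) i (mkJet x y p (solveR c P x y p t)) = 0 := by
  rcases i with k | i
  · rw [eulerLagrange_scalar_mkJet, Finset.sum_eq_single 0]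
    · simp [solveR, metric]
    · intro μ _ hμ
      simp [solveR, hμ]
    · simp
  · obtain ⟨α, ν, hi, hν⟩ : ∃ α ν, Sum.inr i = gaugeIx α ν ∧ gaugeDir i = ν := by
      rcases i with ν | ⟨a, ν⟩
      · exact ⟨none, ν, rfl, rfl⟩
      · exact ⟨some a, ν, rfl, rfl⟩
    have hne : ν + 1 ≠ ν := by
      fin_cases ν <;> decide
    rw [hi, eulerLagrange_gauge_mkJet, Finset.sum_eq_single (ν + 1)]
    · rw [if_neg hne, ← hi]
      simp only [solveR, Sum.elim_inr, hν, if_neg hne, if_true]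
      linear_combination (-eulerLagrange (lagrangian c P) (Sum.inr i) (mkJet x y p 0)) *
        (metric ν * metric ν * metric_mul_self (ν + 1) + metric_mul_self ν)
    · intro μ _ hμ
      rw [← hi]
      by_cases h : μ = ν
      · simp [h]
      · simp [solveR, hν, h, hμ]
    · simp

end

/-! ### The linearized field equations -/

lemma contDiff_gradU (p : Potential) : ContDiff ℝ ∞ (gradU p) :=
  contDiff_pi.2 fun _ => ((contDiff_potU p).fderiv_right (m := ∞) (by simp)).clm_apply
    contDiff_const

lemma differentiable_gradU (p : Potential) : Differentiable ℝ (gradU p) :=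
  (contDiff_gradU p).differentiable (by simp)

lemma IsScalar.isVertical {X : PointGenerator} (hX : IsScalar X) : IsVertical X := hX.1

lemma IsScalar.prolongField_gauge {X : PointGenerator} (hX : IsScalar X) (α : Option (Fin 3))
    (μ : Fin 4) (J : MIx) (j : Jet) : (prolongField X j).2 (gaugeIx α μ) J = 0 := by
  have h0 : characteristic X (gaugeIx α μ) = 0 := by
    rw [hX.isVertical.characteristic_eq]
    funext j
    rcases α with _ | a
    · exact hX.2.1 μ _
    · exact hX.2.2 a μ _
  simp only [prolongField, hX.isVertical.prolongCoeff_eq, h0, iterTotalDeriv_zero_fun,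
    Pi.zero_apply]

lemma lineDeriv_eulerLagrange_scalar (c : Gauge) (p : Potential) (k : Fin 8) (j v : Jet)
    (hv : ∀ α μ J, v.2 (gaugeIx α μ) J = 0) :
    lineDeriv ℝ (eulerLagrange (lagrangian c p) (iφ k)) j v =
      -(∑ μ, metric μ • (scal (unitIx μ + unitIx μ) v + conn c μ (unitIx μ) j (scal 0 v)
        + (2 : ℝ) • conn c μ 0 j (scal (unitIx μ) v)
        + conn c μ 0 j (conn c μ 0 j (scal 0 v)))) k
      - fderiv ℝ (gradU p) (scal 0 j) (scal 0 v) k := by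
  set b : Fin 8 → ℝ := ∑ μ, metric μ • (scal (unitIx μ + unitIx μ) v +
    conn c μ (unitIx μ) j (scal 0 v) + (2 : ℝ) • conn c μ 0 j (scal (unitIx μ) v)
    + conn c μ 0 j (conn c μ 0 j (scal 0 v))) with hb
  have h1 : HasDerivAt (fun t : ℝ => boxD c (j + t • v) k) (b k) 0 := by
    have e : (fun t : ℝ => boxD c (j + t • v) k) = fun t => boxD c j k + t * b k := by
      funext t
      have : boxD c (j + t • v) = boxD c j + t • b := by
        rw [hb, boxD, boxD, Finset.smul_sum, ← Finset.sum_add_distrib]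
        refine Finset.sum_congr rfl fun μ _ => ?_
        simp only [map_add, map_smul, conn_eq_zero (fun α μ => hv α μ _), smul_zero, add_zero]
        module
      simp [this]
    rw [e]
    simpa using ((hasDerivAt_id (0 : ℝ)).mul_const (b k)).const_add (boxD c j k)
  have h2 := hasDerivAt_pi.1
    (hasLineDerivAt_comp_linear (scal 0) (differentiable_gradU p (scal 0 j)) v) k
  have h3 := h1.neg.sub h2
  have e : eulerLagrange (lagrangian c p) (iφ k) = fun j => -boxD c j k - gradU p (scal 0 j) k :=
    funext fun j => eulerLagrange_scalar c p k j
  rw [e]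
  exact h3.deriv

lemma lineDeriv_eulerLagrange_gauge (c : Gauge) (p : Potential) (α : Option (Fin 3)) (ν : Fin 4)
    (j v : Jet) (hv : ∀ α μ J, v.2 (gaugeIx α μ) J = 0) :
    lineDeriv ℝ (eulerLagrange (lagrangian c p) (gaugeIx α ν)) j v =
      metric ν * (covDDeriv c ν j v ⬝ᵥ gaugeGen c α (scal 0 j) +
        covD c ν j ⬝ᵥ gaugeGen c α (scal 0 v)) := by
  have hs : HasDerivAt (fun t : ℝ => gaugeGen c α (scal 0 (j + t • v)))
      (gaugeGen c α (scal 0 v)) 0 := by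
    simpa using ((hasDerivAt_id (0 : ℝ)).smul_const (gaugeGen c α (scal 0 v))).const_add
      (gaugeGen c α (scal 0 j))
  have h := ((HasDerivAt.const_mul (metric ν)
    ((hasLineDerivAt_covD c ν j v).dotProduct hs)).add_const
    (gaugeSource c α ν j + ∑ μ, metric μ * metric ν *
      (j.2 (gaugeIx α ν) (unitIx μ + unitIx μ) - j.2 (gaugeIx α μ) (unitIx ν + unitIx μ))))
  simp only [zero_smul, add_zero] at h
  rw [← h.deriv, lineDeriv]
  congr 1
  funext t
  rw [eulerLagrange_gauge]
  have e : ∀ β σ J, (j + t • v).2 (gaugeIx β σ) J = j.2 (gaugeIx β σ) J := by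
    simp [hv]
  simp only [e, gaugeSource_congr (j := j + t • v) (j' := j) (fun β σ => e β σ 0)
    (fun β σ ρ => e β σ _)]

/-- The prolongation of a vertical generator whose scalar components are a function `g` of a linear
image `π j` of the jet. -/
lemma scal_prolongField {X : PointGenerator} (hX : IsVertical X) {E : Type*}
    [NormedAddCommGroup E] [NormedSpace ℝ E] (π : Jet →ₗ[ℝ] E) {g : E → Fin 8 → ℝ}
    (hg : ContDiff ℝ ∞ g) (h : ∀ j k, X.η (iφ k) (base j) = g (π j) k) (j : Jet) (μ : Fin 4) :
    scal 0 (prolongField X j) = g (π j) ∧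
    scal (unitIx μ) (prolongField X j) = fderiv ℝ g (π j) (π (totalField μ j)) ∧
    scal (unitIx μ + unitIx μ) (prolongField X j) =
      fderiv ℝ (fderiv ℝ g) (π j) (π (totalField μ j)) (π (totalField μ j)) +
      fderiv ℝ g (π j) (π (0, fun i J => j.2 i (J + unitIx μ + unitIx μ))) := by
  have hd : ∀ z, DifferentiableAt ℝ g z := fun z =>
    (hg.differentiable (by simp)).differentiableAt
  have hd2 : ∀ z, DifferentiableAt ℝ (fderiv ℝ g) z := fun z =>
    ((hg.fderiv_right (m := ∞) (by simp)).differentiable (by simp)).differentiableAt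
  have hQ : ∀ k, characteristic X (iφ k) = fun j => g (π j) k := fun k => by
    rw [hX.characteristic_eq]
    exact funext fun j => h j k
  have hloc := fun k => hX.isLocalFunction_characteristic (iφ k)
  have e1 : ∀ k j, totalDeriv μ (characteristic X (iφ k)) j =
      fderiv ℝ g (π j) (π (totalField μ j)) k := by
    intro k j
    rw [hQ]
    exact (hasDerivAt_pi.1 (hasLineDerivAt_comp_linear π (hd (π j)) (totalField μ j)) k).deriv
  refine ⟨funext fun k => ?_, funext fun k => ?_, funext fun k => ?_⟩
  · simp only [scal, prolongField, LinearMap.coe_mk, AddHom.coe_mk, hX.prolongCoeff_eq,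
      iterTotalDeriv_zero, hQ]
  · simp only [scal, prolongField, LinearMap.coe_mk, AddHom.coe_mk, hX.prolongCoeff_eq,
      iterTotalDeriv_unitIx (hloc k), e1]
  · simp only [scal, prolongField, LinearMap.coe_mk, AddHom.coe_mk, hX.prolongCoeff_eq,
      iterTotalDeriv_add_unitIx (hloc k), iterTotalDeriv_unitIx (hloc k)]
    rw [show totalDeriv μ (characteristic X (iφ k)) = _ from funext (e1 k)]
    have h1 := hasLineDerivAt_comp_linear π (hd2 (π j)) (totalField μ j)
    have h2 : HasDerivAt (fun t : ℝ => π (totalField μ (j + t • totalField μ j)))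
        (π (0, fun i J => j.2 i (J + unitIx μ + unitIx μ))) 0 := by
      have e : (fun t : ℝ => π (totalField μ (j + t • totalField μ j))) = fun t =>
          π (totalField μ j) + t • π (0, fun i J => j.2 i (J + unitIx μ + unitIx μ)) := by
        funext t
        rw [← map_smul, ← map_add]
        congr 1
        refine Prod.ext ?_ ?_
        · simp [totalField]
        · rfl
      rw [e]
      simpa using ((hasDerivAt_id (0 : ℝ)).smul_const
        (π (0, fun i J => j.2 i (J + unitIx μ + unitIx μ)))).const_add (π (totalField μ j))
    have h3 := HasDerivAt.clm_apply h1 h2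
    simp only [zero_smul, add_zero] at h3
    exact (hasDerivAt_pi.1 h3 k).deriv

/-- The scalar part of the linearized symmetry condition. -/
lemma IsScalar.scalar_equation {c : Gauge} {p : Potential} {X : PointGenerator} (hX : IsScalar X)
    (h : IsELSymmetry (lagrangian c p) X) {j : Jet}
    (hj : ∀ i, eulerLagrange (lagrangian c p) i j = 0) :
    ∑ μ, metric μ • (scal (unitIx μ + unitIx μ) (prolongField X j)
        + conn c μ (unitIx μ) j (scal 0 (prolongField X j))
        + (2 : ℝ) • conn c μ 0 j (scal (unitIx μ) (prolongField X j))
        + conn c μ 0 j (conn c μ 0 j (scal 0 (prolongField X j))))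
      + fderiv ℝ (gradU p) (scal 0 j) (scal 0 (prolongField X j)) = 0 := by
  funext k
  have h1 := h j hj (iφ k)
  rw [hX.isVertical.pr_eq_along, along, lineDeriv_eulerLagrange_scalar c p k j _
    (fun α μ J => hX.prolongField_gauge α μ J j)] at h1
  rw [Pi.add_apply, Pi.zero_apply]
  linarith

/-- The gauge part of the linearized symmetry condition. -/
lemma IsScalar.gauge_equation {c : Gauge} {p : Potential} {X : PointGenerator} (hX : IsScalar X)
    (h : IsELSymmetry (lagrangian c p) X) {j : Jet}
    (hj : ∀ i, eulerLagrange (lagrangian c p) i j = 0) (α : Option (Fin 3)) (ν : Fin 4) :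
    (scal (unitIx ν) (prolongField X j) + conn c ν 0 j (scal 0 (prolongField X j))) ⬝ᵥ
        gaugeGen c α (scal 0 j) +
      covD c ν j ⬝ᵥ gaugeGen c α (scal 0 (prolongField X j)) = 0 := by
  have h1 := h j hj (gaugeIx α ν)
  have hg := fun α μ J => hX.prolongField_gauge α μ J j
  rw [hX.isVertical.pr_eq_along, along, lineDeriv_eulerLagrange_gauge c p α ν j _ hg] at h1
  have h2 := (mul_eq_zero.1 h1).resolve_left (metric_ne_zero ν)
  simpa only [covDDeriv, conn_eq_zero (fun α μ => hg α μ 0), LinearMap.zero_apply, zero_add]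
    using h2

/-! ### The determining equations -/

/-- The scalar components of a generator. -/
def scalarPart (X : PointGenerator) (z : Vars) (k : Fin 8) : ℝ := X.η (iφ k) z

lemma contDiff_scalarPart (X : PointGenerator) : ContDiff ℝ ∞ (scalarPart X) :=
  contDiff_pi.2 fun k => X.contDiff_eta (iφ k)

/-- The projection of jets to `(x, y)`, as a linear map. -/
def baseLin : Jet →ₗ[ℝ] Vars where
  toFun := base
  map_add' _ _ := rfl
  map_smul' _ _ := rfl

/-- The scalar components of a symmetry have zero derivative along the gauge fields: this derivative
multiplies the second derivative `∂_ν∂_ν` of a gauge field component with index `ν` in the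
linearized scalar equation, and the field equations leave that second derivative free. -/
lemma IsScalar.fderiv_gauge {c : Gauge} {P : Potential} {X : PointGenerator} (hX : IsScalar X)
    (h : IsELSymmetry (lagrangian c P) X) (z : Vars) (i : Fin 4 ⊕ (Fin 3 × Fin 4)) :
    fderiv ℝ (scalarPart X) z (0, Pi.single (Sum.inr i) 1) = 0 := by
  obtain ⟨x, y⟩ := z
  set D := fderiv ℝ (scalarPart X) (x, y) with hD
  let t : Fin 4 ⊕ (Fin 3 × Fin 4) → ℝ := Pi.single i 1
  have hs := fun j μ => scal_prolongField hX.isVertical baseLin (contDiff_scalarPart X)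
    (fun _ _ => rfl) j μ
  have hs0 := fun j => (hs j 0).1
  -- The symmetry condition at on-shell jets over a fixed first order jet is affine in the second
  -- derivatives.
  have key : ∃ R : Fin 8 → ℝ, ∀ r, (∀ i, eulerLagrange (lagrangian c P) i (mkJet x y 0 r) = 0) →
      (∑ μ, metric μ • D (0, r μ)) + R = 0 := by
    let j0 := mkJet x y 0 0
    refine ⟨∑ μ, metric μ • (fderiv ℝ (fderiv ℝ (scalarPart X)) (x, y)
        (baseLin (totalField μ j0)) (baseLin (totalField μ j0))
        + conn c μ (unitIx μ) j0 (scalarPart X (x, y))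
        + (2 : ℝ) • conn c μ 0 j0 (D (baseLin (totalField μ j0)))
        + conn c μ 0 j0 (conn c μ 0 j0 (scalarPart X (x, y))))
      + fderiv ℝ (gradU P) (scal 0 j0) (scalarPart X (x, y)), fun r hr => ?_⟩
    have h1 := hX.scalar_equation h hr
    have hb : baseLin (mkJet x y 0 r) = (x, y) :=
      Prod.ext rfl (funext fun i => mkJet_zero x y 0 r i)
    have hT : ∀ μ, baseLin (totalField μ (mkJet x y 0 r)) = baseLin (totalField μ j0) := by
      intro μ
      refine Prod.ext rfl (funext fun i => ?_)
      change (mkJet x y 0 r).2 i (0 + unitIx μ) = (mkJet x y 0 0).2 i (0 + unitIx μ)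
      rw [zero_add, mkJet_unitIx, mkJet_unitIx]
    have h2 : ∀ μ, baseLin (0, fun i J => (mkJet x y 0 r).2 i (J + unitIx μ + unitIx μ)) =
        (0, r μ) := by
      intro μ
      refine Prod.ext rfl (funext fun i => ?_)
      change (mkJet x y 0 r).2 i (0 + unitIx μ + unitIx μ) = r μ i
      rw [zero_add, mkJet_unitIx_add, if_pos rfl]
    have hc := fun μ => conn_mkJet_congr c x y 0 r 0 μ
    have h0 : scal 0 (mkJet x y 0 r) = scal 0 j0 := by
      rw [scal_mkJet_zero, scal_mkJet_zero]
    simp only [hs0, (hs _ _).2.1, (hs _ _).2.2, hb, hT, h2, (hc _).1, (hc _).2, h0] at h1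
    rw [← h1, ← add_assoc, ← Finset.sum_add_distrib]
    congr 1
    refine Finset.sum_congr rfl fun μ _ => ?_
    module
  obtain ⟨R, hR⟩ := key
  have e1 := hR _ (solveR_spec c P x y 0 t)
  have e0 := hR _ (solveR_spec c P x y 0 0)
  have e2 : ∀ μ, solveR c P x y 0 t μ = solveR c P x y 0 0 μ +
      if μ = gaugeDir i then Pi.single (Sum.inr i) 1 else 0 := by
    intro μ
    funext k
    rcases k with k | k
    · by_cases hμ : μ = gaugeDir i <;> simp [solveR, hμ]
    · by_cases hk : k = i
      · subst hk
        by_cases hμ : μ = gaugeDir k <;> simp [solveR, hμ, t]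
      · by_cases hμ : μ = gaugeDir i <;> simp [solveR, hμ, t, hk]
  have e3 : ∑ μ, metric μ • D (0, solveR c P x y 0 t μ) =
      ∑ μ, metric μ • D (0, solveR c P x y 0 0 μ) +
        metric (gaugeDir i) • D (0, Pi.single (Sum.inr i) 1) := by
    have : ∀ μ, D (0, solveR c P x y 0 t μ) = D (0, solveR c P x y 0 0 μ) +
        if μ = gaugeDir i then D (0, Pi.single (Sum.inr i) 1) else 0 := by
      intro μ
      rw [e2 μ]
      split_ifs
      · rw [← map_add, Prod.mk_add_mk, add_zero]
      · simp
    simp only [this, smul_add, Finset.sum_add_distrib]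
    simp
  rw [e3] at e1
  have e4 : metric (gaugeDir i) • D (0, Pi.single (Sum.inr i) 1) = 0 := by
    rw [add_right_comm, e0, zero_add] at e1
    exact e1
  exact (smul_eq_zero.1 e4).resolve_left (metric_ne_zero _)

/-- The scalar components, restricted to vanishing gauge fields. -/
def reducedPart (X : PointGenerator) (z : Spacetime × (Fin 8 → ℝ)) : Fin 8 → ℝ :=
  scalarPart X (z.1, Sum.elim z.2 0)

lemma contDiff_reducedPart (X : PointGenerator) : ContDiff ℝ ∞ (reducedPart X) := by
  refine (contDiff_scalarPart X).comp (contDiff_fst.prodMk (contDiff_pi.2 fun i => ?_))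
  rcases i with k | i
  · exact (contDiff_apply ℝ ℝ k).comp contDiff_snd
  · exact contDiff_const

/-- Symmetries do not depend on the gauge fields. -/
lemma IsScalar.scalarPart_eq {c : Gauge} {P : Potential} {X : PointGenerator} (hX : IsScalar X)
    (h : IsELSymmetry (lagrangian c P) X) (x : Spacetime) (y : FieldIx → ℝ) :
    scalarPart X (x, y) = reducedPart X (x, fun k => y (iφ k)) := by
  let w : FieldIx → ℝ := Sum.elim 0 fun i => y (Sum.inr i)
  have hw : ∀ z, fderiv ℝ (scalarPart X) z (0, w) = 0 := by
    intro z
    have : ((0, w) : Vars) = ∑ i, y (Sum.inr i) • (0, Pi.single (Sum.inr i) 1) := by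
      refine Prod.ext (by simp [Prod.fst_sum]) ?_
      funext k
      rcases k with k | k
      · simp [w, Prod.snd_sum, Finset.sum_apply]
      · simp only [w, Prod.snd_sum, Finset.sum_apply, Prod.smul_snd, Pi.smul_apply, smul_eq_mul,
          Sum.elim_inr]
        rw [Finset.sum_eq_single k]
        · simp
        · intro i _ hi
          simp [hi.symm]
        · simp
    rw [this, map_sum]
    refine Finset.sum_eq_zero fun i _ => ?_
    rw [map_smul, hX.fderiv_gauge h, smul_zero]
  let y0 : FieldIx → ℝ := Sum.elim (fun k => y (iφ k)) 0
  let l : ℝ → Vars := fun t => (x, y0) + t • (0, w)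
  have hl : ∀ t, HasDerivAt l (0, w) t := fun t =>
    (((hasDerivAt_id t).smul_const ((0, w) : Vars)).const_add (x, y0)).congr_deriv (one_smul _ _)
  have hd : ∀ t, HasDerivAt (fun t => scalarPart X (l t)) 0 t := by
    intro t
    have := (((contDiff_scalarPart X).differentiable (by simp)).differentiableAt
      (x := l t)).hasFDerivAt.comp_hasDerivAt t (hl t)
    rwa [hw] at this
  have hc := is_const_of_deriv_eq_zero (fun t => (hd t).differentiableAt)
    (fun t => (hd t).deriv) 1 0
  have l1 : l 1 = (x, y) := by
    refine Prod.ext (by simp [l]) (funext fun k => ?_)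
    rcases k with k | k <;> simp [l, y0, w]
  have l0 : l 0 = (x, y0) := by simp [l]
  rw [l1, l0] at hc
  exact hc

/-- The projection of jets to `(x, φ)`. -/
def scalarBaseLin : Jet →ₗ[ℝ] Spacetime × (Fin 8 → ℝ) where
  toFun j := (j.1, scal 0 j)
  map_add' _ _ := rfl
  map_smul' _ _ := rfl

/-- The determining equations from the scalar field equations, at jets with `A = 0`: here `f μ`
stands for `φ_μ` and `b` for the divergence of the gauge fields. -/
lemma IsScalar.determining_scalar {c : Gauge} {P : Potential} {X : PointGenerator}
    (hX : IsScalar X) (h : IsELSymmetry (lagrangian c P) X) (x : Spacetime) (φ : Fin 8 → ℝ)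
    (f : Fin 4 → Fin 8 → ℝ) (b : Option (Fin 3) → ℝ) :
    (∑ μ, metric μ • fderiv ℝ (fderiv ℝ (reducedPart X)) (x, φ) (Pi.single μ 1, f μ)
        (Pi.single μ 1, f μ))
      - fderiv ℝ (reducedPart X) (x, φ) (0, (∑ α, b α • gaugeGen c α φ) + gradU P φ)
      + (∑ α, b α • gaugeGen c α (reducedPart X (x, φ)))
      + fderiv ℝ (gradU P) φ (reducedPart X (x, φ)) = 0 := by
  classical
  -- The only nonzero first derivative of the gauge fields is `∂_0` of the components with index 0.
  let y : FieldIx → ℝ := Sum.elim φ 0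
  let p : Fin 4 → FieldIx → ℝ := fun μ => Sum.elim (f μ) fun i =>
    if μ = 0 then Sum.elim (fun ν => if ν = 0 then b none else 0)
      (fun q => if q.2 = 0 then b (some q.1) else 0) i else 0
  set r := solveR c P x y p 0 with hr
  set j := mkJet x y p r with hjdef
  have hj : ∀ i, eulerLagrange (lagrangian c P) i j = 0 := solveR_spec c P x y p 0
  have hs := fun μ => scal_prolongField hX.isVertical scalarBaseLin (contDiff_reducedPart X)
    (fun j k => congrFun (hX.scalarPart_eq h j.1 fun i => j.2 i 0) k) j μ
  have hφ : scal 0 j = φ := scal_mkJet_zero x y p r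
  have hf : ∀ μ, scal (unitIx μ) j = f μ := fun μ => scal_mkJet_unitIx x y p r μ
  have hb : scalarBaseLin j = (x, φ) := Prod.ext rfl hφ
  have hT : ∀ μ, scalarBaseLin (totalField μ j) = (Pi.single μ 1, f μ) := by
    intro μ
    refine Prod.ext rfl ?_
    change scal (0 + unitIx μ) j = f μ
    rw [zero_add, hf]
  have h2 : ∀ μ, scalarBaseLin (0, fun i J => j.2 i (J + unitIx μ + unitIx μ)) =
      (0, scal (unitIx μ + unitIx μ) j) := by
    intro μ
    refine Prod.ext rfl ?_
    change scal (0 + unitIx μ + unitIx μ) j = _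
    rw [zero_add]
  have hA : ∀ μ, conn c μ 0 j = 0 := by
    intro μ
    refine conn_eq_zero (fun α ν => ?_) μ
    rw [hjdef, mkJet_zero]
    cases α <;> rfl
  have hA' : ∀ μ, conn c μ (unitIx μ) j = if μ = 0 then ∑ α, b α • gaugeGen c α else 0 := by
    intro μ
    have : ∀ α, j.2 (gaugeIx α μ) (unitIx μ) = if μ = 0 then b α else 0 := by
      intro α
      rw [hjdef, mkJet_unitIx]
      by_cases hμ : μ = 0 <;> cases α <;> simp [p, gaugeIx, hμ]
    simp only [conn, LinearMap.coe_mk, AddHom.coe_mk, this]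
    by_cases hμ : μ = 0 <;> simp [hμ]
  have hQ : ∀ v, ∑ μ, metric μ • conn c μ (unitIx μ) j v = ∑ α, b α • gaugeGen c α v := by
    intro v
    rw [Finset.sum_eq_single 0]
    · simp [hA', metric, LinearMap.sum_apply]
    · intro μ _ hμ
      simp [hA', hμ]
    · simp
  have hbox : ∑ μ, metric μ • scal (unitIx μ + unitIx μ) j =
      -((∑ α, b α • gaugeGen c α φ) + gradU P φ) := by
    have : boxD c j + gradU P φ = 0 := by
      funext k
      have := hj (iφ k)
      rw [eulerLagrange_scalar, hφ] at this
      simp only [Pi.add_apply, Pi.zero_apply]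
      linarith
    simp only [boxD, hA, LinearMap.zero_apply, smul_zero, add_zero, hφ, smul_add,
      Finset.sum_add_distrib, hQ] at this
    rw [add_assoc] at this
    exact eq_neg_of_add_eq_zero_left this
  have h1 := hX.scalar_equation h hj
  simp only [(hs 0).1, (hs _).2.1, (hs _).2.2, hb, hT, h2, hA, hφ, LinearMap.zero_apply,
    smul_zero, add_zero, smul_add, Finset.sum_add_distrib, hQ] at h1
  have h3 : ∑ μ, metric μ • fderiv ℝ (reducedPart X) (x, φ)
      (0, scal (unitIx μ + unitIx μ) j) = -fderiv ℝ (reducedPart X) (x, φ)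
        (0, (∑ α, b α • gaugeGen c α φ) + gradU P φ) := by
    have e : ∀ μ, metric μ • fderiv ℝ (reducedPart X) (x, φ)
        (0, scal (unitIx μ + unitIx μ) j) = fderiv ℝ (reducedPart X) (x, φ)
        (metric μ • (0, scal (unitIx μ + unitIx μ) j)) := fun μ => (map_smul _ _ _).symm
    simp only [e]
    rw [← map_sum, ← map_neg]
    congr 1
    refine Prod.ext (by simp [Prod.fst_sum]) ?_
    simpa only [Prod.snd_sum, Prod.smul_snd, Prod.snd_neg, map_smul] using hbox
  rw [h3] at h1
  rw [← h1]
  abel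

/-- The determining equations from the gauge field equations, at jets with `A = 0`. -/
lemma IsScalar.determining_gauge {c : Gauge} {P : Potential} {X : PointGenerator}
    (hX : IsScalar X) (h : IsELSymmetry (lagrangian c P) X) (x : Spacetime) (φ w : Fin 8 → ℝ)
    (α : Option (Fin 3)) :
    fderiv ℝ (reducedPart X) (x, φ) (Pi.single 0 1, w) ⬝ᵥ gaugeGen c α φ
      + w ⬝ᵥ gaugeGen c α (reducedPart X (x, φ)) = 0 := by
  let y : FieldIx → ℝ := Sum.elim φ 0
  let p : Fin 4 → FieldIx → ℝ := fun _ => Sum.elim w 0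
  set r := solveR c P x y p 0 with hr
  set j := mkJet x y p r with hjdef
  have hj : ∀ i, eulerLagrange (lagrangian c P) i j = 0 := solveR_spec c P x y p 0
  have hs := fun μ => scal_prolongField hX.isVertical scalarBaseLin (contDiff_reducedPart X)
    (fun j k => congrFun (hX.scalarPart_eq h j.1 fun i => j.2 i 0) k) j μ
  have hφ : scal 0 j = φ := scal_mkJet_zero x y p r
  have hf : ∀ μ, scal (unitIx μ) j = w := fun μ => scal_mkJet_unitIx x y p r μ
  have hb : scalarBaseLin j = (x, φ) := Prod.ext rfl hφ
  have hT : ∀ μ, scalarBaseLin (totalField μ j) = (Pi.single μ 1, w) := by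
    intro μ
    refine Prod.ext rfl ?_
    change scal (0 + unitIx μ) j = w
    rw [zero_add, hf]
  have hA : ∀ μ, conn c μ 0 j = 0 := by
    intro μ
    refine conn_eq_zero (fun α ν => ?_) μ
    rw [hjdef, mkJet_zero]
    cases α <;> rfl
  have h1 := hX.gauge_equation h hj α 0
  simpa only [(hs 0).1, (hs _).2.1, hb, hT, hφ, hA, covD, hf, LinearMap.zero_apply, add_zero]
    using h1

/-- If a quadratic form is constant along the line `e + t v`, its parts of order 1 and 2 in `t`
vanish. -/
lemma quadratic_part_eq_zero {E F : Type*} [NormedAddCommGroup E] [NormedSpace ℝ E]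
    [NormedAddCommGroup F] [NormedSpace ℝ F] {B : E →L[ℝ] E →L[ℝ] F} (hB : ∀ u v, B u v = B v u)
    {e : E} {v : E} {R : F} (h : ∀ t : ℝ, B (e + t • v) (e + t • v) = R) :
    B v v = 0 ∧ B e v = 0 := by
  have h1 : ∀ t : ℝ, B (e + t • v) (e + t • v) = B e e + (2 * t) • B e v + (t ^ 2) • B v v := by
    intro t
    simp only [map_add, map_smul, add_apply, smul_apply,
      hB v e]
    module
  have ha := (h1 1).symm.trans (h 1)
  have hb := (h1 (-1)).symm.trans (h (-1))
  have hc := (h1 0).symm.trans (h 0)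
  constructor
  · have : (2 : ℝ) • B v v = 0 := by
      linear_combination (norm := module) ha + hb - (2 : ℝ) • hc
    simpa using this
  · have : (4 : ℝ) • B e v = 0 := by
      linear_combination (norm := module) ha - hb
    simpa using this

/-- Scalar symmetries are linear in `φ`, with constant coefficients. The Jacobian matrix is
skew, commutes with the gauge generators and intertwines the gradient of the potential. -/
lemma IsScalar.exists_linear {c : Gauge} (hg' : c.g' ≠ 0) (hY : c.Y ≠ 0) {P : Potential}
    {X : PointGenerator} (hX : IsScalar X) (h : IsELSymmetry (lagrangian c P) X) :
    ∃ M : (Fin 8 → ℝ) →ₗ[ℝ] (Fin 8 → ℝ), X = linearScalarGenerator M ∧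
      (∀ α φ, M (gaugeGen c α φ) = gaugeGen c α (M φ)) ∧ (∀ v w, M v ⬝ᵥ w = -(v ⬝ᵥ M w)) ∧
      ∀ φ, fderiv ℝ (gradU P) φ (M φ) = M (gradU P φ) := by
  classical
  set k := reducedPart X with hk
  have hkd : ContDiff ℝ ∞ k := contDiff_reducedPart X
  have hk1 : Differentiable ℝ k := hkd.differentiable (by simp)
  have hk2 : Differentiable ℝ (fderiv ℝ k) :=
    (hkd.fderiv_right (m := ∞) (by simp)).differentiable (by simp)
  have hsymm : ∀ z u v, fderiv ℝ (fderiv ℝ k) z u v = fderiv ℝ (fderiv ℝ k) z v u := by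
    intro z u v
    have : IsSymmSndFDerivAt ℝ k z := hkd.contDiffAt.isSymmSndFDerivAt (by
      rw [minSmoothness_of_isRCLikeNormedField]; exact WithTop.coe_le_coe.2 le_top)
    exact this.eq u v
  have key := hX.determining_scalar h
  simp only [← hk] at key
  have hquad : ∀ x φ μ v, fderiv ℝ (fderiv ℝ k) (x, φ) (0, v) (0, v) = 0 ∧
      fderiv ℝ (fderiv ℝ k) (x, φ) (Pi.single μ 1, 0) (0, v) = 0 := by
    intro x φ μ v
    -- Only `φ_μ` varies in the determining equation.
    refine quadratic_part_eq_zero (hsymm (x, φ))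
      (R := fderiv ℝ (fderiv ℝ k) (x, φ) (Pi.single μ 1, 0) (Pi.single μ 1, 0)) fun t => ?_
    have h1 := key x φ (Pi.single μ (t • v)) 0
    have h0 := key x φ 0 0
    rw [← h0] at h1
    simp only [add_left_inj, sub_left_inj] at h1
    rw [← Finset.add_sum_erase _ _ (Finset.mem_univ μ),
      ← Finset.add_sum_erase _ _ (Finset.mem_univ μ)] at h1
    have e : ∀ ν ∈ Finset.univ.erase μ, metric ν • fderiv ℝ (fderiv ℝ k) (x, φ)
        (Pi.single ν 1, (Pi.single μ (t • v) : Fin 4 → Fin 8 → ℝ) ν)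
        (Pi.single ν 1, (Pi.single μ (t • v) : Fin 4 → Fin 8 → ℝ) ν) =
        metric ν • fderiv ℝ (fderiv ℝ k) (x, φ)
        (Pi.single ν 1, (0 : Fin 4 → Fin 8 → ℝ) ν) (Pi.single ν 1, (0 : Fin 4 → Fin 8 → ℝ) ν) := by
      intro ν hν
      rw [Pi.single_eq_of_ne (Finset.ne_of_mem_erase hν)]
      rfl
    rw [Finset.sum_congr rfl e, add_left_inj, Pi.single_eq_same] at h1
    have h2 := smul_right_injective _ (metric_ne_zero μ) h1
    simpa using h2
  -- The Jacobian with respect to `φ` is constant.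
  have hJ : ∀ w z z', fderiv ℝ k z (0, w) = fderiv ℝ k z' (0, w) := by
    intro w
    refine is_const_of_fderiv_eq_zero (𝕜 := ℝ) (f := fun z => fderiv ℝ k z (0, w))
      (fun z => (hk2 z).clm_apply (differentiableAt_const _)) fun z => ?_
    obtain ⟨x, φ⟩ := z
    refine ContinuousLinearMap.ext fun u => ?_
    rw [fderiv_clm_apply (hk2 _) (differentiableAt_const _)]
    simp only [fderiv_fun_const, Pi.zero_apply, ContinuousLinearMap.comp_zero, zero_add,
      ContinuousLinearMap.flip_apply, zero_apply]
    have hu : u = (∑ μ, u.1 μ • ((Pi.single μ 1, 0) : Spacetime × (Fin 8 → ℝ))) + (0, u.2) := by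
      refine Prod.ext ?_ (by simp [Prod.snd_sum])
      funext μ
      simp [Prod.fst_sum, Finset.sum_apply, Pi.single_apply]
    have hpol : fderiv ℝ (fderiv ℝ k) (x, φ) (0, u.2) (0, w) = 0 := by
      have h1 := (hquad x φ 0 (u.2 + w)).1
      have e : ((0, u.2 + w) : Spacetime × (Fin 8 → ℝ)) = (0, u.2) + (0, w) := by simp
      rw [e] at h1
      simp only [map_add, add_apply, (hquad x φ 0 _).1, zero_add,
        add_zero, hsymm (x, φ) (0, w) (0, u.2)] at h1
      rw [← two_smul ℝ] at h1
      simpa using h1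
    rw [hu]
    simp only [map_add, map_sum, map_smul, add_apply,
      sum_apply, smul_apply, (hquad x φ _ w).2, hpol,
      smul_zero, Finset.sum_const_zero, add_zero]
  let M : (Fin 8 → ℝ) →ₗ[ℝ] (Fin 8 → ℝ) :=
    (fderiv ℝ k 0).toLinearMap ∘ₗ LinearMap.inr ℝ Spacetime (Fin 8 → ℝ)
  have hM : ∀ z w, fderiv ℝ k z (0, w) = M w := fun z w => hJ w z 0
  have hlin : ∀ x φ, k (x, φ) = M φ + k (x, 0) := by
    intro x φ
    let l : ℝ → Spacetime × (Fin 8 → ℝ) := fun t => (x, 0) + t • (0, φ)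
    have hl : ∀ t, HasDerivAt l (0, φ) t := fun t =>
      (((hasDerivAt_id t).smul_const ((0, φ) : Spacetime × (Fin 8 → ℝ))).const_add
        (x, 0)).congr_deriv (one_smul _ _)
    have hd : ∀ t, HasDerivAt (fun t => k (l t) - t • M φ) 0 t := by
      intro t
      have h1 := (hk1 (l t)).hasFDerivAt.comp_hasDerivAt t (hl t)
      rw [hM] at h1
      exact (h1.sub ((hasDerivAt_id t).smul_const (M φ))).congr_deriv (by simp)
    have hc := is_const_of_deriv_eq_zero (fun t => (hd t).differentiableAt)
      (fun t => (hd t).deriv) 1 0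
    have l1 : l 1 = (x, φ) := by simp [l]
    have l0 : l 0 = (x, 0) := by simp [l]
    simp only [l1, l0, one_smul, zero_smul, sub_zero] at hc
    rw [← hc]
    abel
  have hcomm : ∀ α x φ, gaugeGen c α (k (x, φ)) = M (gaugeGen c α φ) := by
    intro α x φ
    have h1 := key x φ 0 (Pi.single α 1)
    have h0 := key x φ 0 0
    have e : ∀ v, ∑ β, (Pi.single α 1 : Option (Fin 3) → ℝ) β • gaugeGen c β v =
        gaugeGen c α v := by
      intro v
      rw [Finset.sum_eq_single α]
      · simp
      · intro β _ hβ
        simp [hβ]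
      · simp
    rw [e, e, hM, map_add] at h1
    simp only [Pi.zero_apply, zero_smul, Finset.sum_const_zero, zero_add, add_zero, hM] at h0
    rw [← sub_eq_zero]
    rw [← sub_eq_zero.2 (h1.trans h0.symm)]
    simp only [Pi.zero_apply]
    abel
  -- Hypercharge acts invertibly, which excludes inhomogeneous terms.
  have hTT : ∀ v, gaugeGen c none (gaugeGen c none v) = -(c.g' * c.Y) ^ 2 • v := by
    intro v
    refine doublets_injective ?_
    simp only [gaugeGen, ← doubletsEquiv_apply, map_smul]
    simp only [doubletsEquiv_apply, doublets_rightMul, gaugeMat, Matrix.mul_smul, Matrix.mul_one,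
      smul_smul]
    ext a b
    simp only [Matrix.smul_apply, smul_eq_mul, Complex.real_smul]
    push_cast
    linear_combination ((c.g' : ℂ) * c.Y) ^ 2 * doublets v a b * Complex.I_mul_I
  have hne : -(c.g' * c.Y) ^ 2 ≠ 0 := by
    simp [hg', hY]
  have hb : ∀ x, k (x, 0) = 0 := by
    intro x
    have h1 := hcomm none x 0
    rw [map_zero, map_zero] at h1
    have h2 := hTT (k (x, 0))
    rw [h1, map_zero] at h2
    exact (smul_eq_zero.1 h2.symm).resolve_left hne
  have hkM : ∀ x φ, k (x, φ) = M φ := fun x φ => by rw [hlin, hb, add_zero]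
  have hTM : ∀ α φ, M (gaugeGen c α φ) = gaugeGen c α (M φ) := fun α φ => by
    rw [← hcomm α 0 φ, hkM]
  have hkfun : k = fun z => ((LinearMap.toContinuousLinearMap M).comp
      (ContinuousLinearMap.snd ℝ Spacetime (Fin 8 → ℝ))) z := funext fun z => hkM z.1 z.2
  have hfd : fderiv ℝ k = fun _ => (LinearMap.toContinuousLinearMap M).comp
      (ContinuousLinearMap.snd ℝ Spacetime (Fin 8 → ℝ)) := by
    funext z
    rw [hkfun]
    exact ContinuousLinearMap.fderiv _
  refine ⟨M, ?_, hTM, ?_, fun φ => ?_⟩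
  · refine Subtype.ext (funext fun z => Prod.ext (funext fun μ => hX.1 μ z) (funext fun i => ?_))
    obtain ⟨x, y⟩ := z
    rcases i with i | μ | ⟨a, μ⟩
    · have := congrFun (hX.scalarPart_eq h x y) i
      rw [← hk, hkM] at this
      exact this
    · exact hX.2.1 μ _
    · exact hX.2.2 a μ _
  · intro v w
    have h1 : ∀ φ, M v ⬝ᵥ gaugeGen c none φ + v ⬝ᵥ M (gaugeGen c none φ) = 0 := by
      intro φ
      have h2 := hX.determining_gauge h 0 φ v none
      rw [← hk, hfd, hkM, ← hTM] at h2
      exact h2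
    have h3 := h1 (gaugeGen c none w)
    rw [hTT, map_smul, dotProduct_smul, dotProduct_smul, ← smul_add] at h3
    exact eq_neg_of_add_eq_zero_left ((smul_eq_zero.1 h3).resolve_left hne)
  · have h1 := key 0 φ 0 0
    have h2 : fderiv ℝ (fderiv ℝ k) (0, φ) = 0 := by
      rw [hfd]
      simp
    simp only [Pi.zero_apply, zero_smul, Finset.sum_const_zero, zero_add, hM, hkM, h2,
      zero_apply, smul_zero, add_zero] at h1
    rw [zero_sub] at h1
    exact (neg_add_eq_zero.1 h1).symm

/-! ### Symmetries as invariances of the potential -/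

lemma fderiv_potU_eq (p : Potential) (φ v : Fin 8 → ℝ) :
    fderiv ℝ (potU p) φ v = gradU p φ ⬝ᵥ v := by
  conv_lhs => rw [pi_eq_sum_univ' v]
  simp only [map_sum, map_smul, smul_eq_mul, dotProduct, gradU]
  exact Finset.sum_congr rfl fun k _ => mul_comm _ _

/-- If a skew matrix `M` intertwines the gradient of the potential, the potential is invariant
under `M`: the gradient of `φ ↦ DU(φ)(M φ)` vanishes. -/
lemma fderiv_potU_eq_zero {p : Potential} {M : (Fin 8 → ℝ) →ₗ[ℝ] (Fin 8 → ℝ)}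
    (hM : ∀ v w, M v ⬝ᵥ w = -(v ⬝ᵥ M w))
    (h : ∀ φ, fderiv ℝ (gradU p) φ (M φ) = M (gradU p φ)) (φ : Fin 8 → ℝ) :
    fderiv ℝ (potU p) φ (M φ) = 0 := by
  have hd2 : Differentiable ℝ (fderiv ℝ (potU p)) :=
    ((contDiff_potU p).fderiv_right (m := ∞) (by simp)).differentiable (by simp)
  have hMd : Differentiable ℝ fun φ => M φ := (LinearMap.toContinuousLinearMap M).differentiable
  have hgrad : ∀ φ v w, fderiv ℝ (fderiv ℝ (potU p)) φ v w = fderiv ℝ (gradU p) φ v ⬝ᵥ w := by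
    intro φ v w
    have h1 : HasDerivAt (fun t : ℝ => fderiv ℝ (potU p) (φ + t • v) w)
        (fderiv ℝ (fderiv ℝ (potU p)) φ v w) 0 := by
      have := (hasLineDerivAt_comp_linear LinearMap.id (hd2 φ) v : HasDerivAt _ _ _).clm_apply
        (hasDerivAt_const (0 : ℝ) w)
      simpa using this
    have h2 : HasDerivAt (fun t : ℝ => gradU p (φ + t • v) ⬝ᵥ w)
        (fderiv ℝ (gradU p) φ v ⬝ᵥ w) 0 := by
      have := (hasLineDerivAt_comp_linear LinearMap.id (differentiable_gradU p φ) v :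
        HasDerivAt _ _ _).dotProduct (hasDerivAt_const (0 : ℝ) w)
      simpa using this
    simp only [fderiv_potU_eq] at h1
    exact h1.unique h2
  have hsymm : ∀ φ u v, fderiv ℝ (fderiv ℝ (potU p)) φ u v =
      fderiv ℝ (fderiv ℝ (potU p)) φ v u := by
    intro φ u v
    have : IsSymmSndFDerivAt ℝ (potU p) φ := (contDiff_potU p).contDiffAt.isSymmSndFDerivAt (by
      rw [minSmoothness_of_isRCLikeNormedField]; exact WithTop.coe_le_coe.2 le_top)
    exact this.eq u v
  have hc := is_const_of_fderiv_eq_zero (𝕜 := ℝ) (f := fun φ => fderiv ℝ (potU p) φ (M φ))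
    (fun φ => (hd2 φ).clm_apply (hMd φ)) (fun φ => ?_) φ 0
  · simpa using hc
  · refine ContinuousLinearMap.ext fun w => ?_
    rw [fderiv_clm_apply (hd2 φ) (hMd φ)]
    have e : fderiv ℝ (fun φ => M φ) φ = LinearMap.toContinuousLinearMap M :=
      (LinearMap.toContinuousLinearMap M).fderiv
    rw [e]
    change fderiv ℝ (potU p) φ (M w) + fderiv ℝ (fderiv ℝ (potU p)) φ w (M φ) = 0
    rw [hsymm, hgrad, h, hM, fderiv_potU_eq]
    ring

lemma isScalar_linearScalarGenerator (M : (Fin 8 → ℝ) →ₗ[ℝ] (Fin 8 → ℝ)) :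
    IsScalar (linearScalarGenerator M) :=
  ⟨fun _ _ => rfl, fun _ _ => rfl, fun _ _ _ => rfl⟩

lemma isStrictlyVariational_linear {c : Gauge} {p : Potential}
    {M : (Fin 8 → ℝ) →ₗ[ℝ] (Fin 8 → ℝ)} (hT : ∀ α φ, M (gaugeGen c α φ) = gaugeGen c α (M φ))
    (hM : ∀ v w, M v ⬝ᵥ w = -(v ⬝ᵥ M w)) (hU : ∀ φ, fderiv ℝ (potU p) φ (M φ) = 0) :
    IsStrictlyVariational (lagrangian c p) (linearScalarGenerator M) := by
  intro j
  have hX := isScalar_linearScalarGenerator M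
  have hs := scal_prolongField hX.isVertical (scal 0)
    (LinearMap.toContinuousLinearMap M).contDiff (fun _ _ => rfl) j
  have hs1 : ∀ μ, scal (unitIx μ) (prolongField (linearScalarGenerator M) j) =
      M (scal (unitIx μ) j) := by
    intro μ
    rw [(hs μ).2.1, (LinearMap.toContinuousLinearMap M).fderiv, scal_totalField, zero_add]
    rfl
  have hs0 : scal 0 (prolongField (linearScalarGenerator M) j) = M (scal 0 j) := (hs 0).1
  have hg := fun α μ J => hX.prolongField_gauge α μ J j
  have hA : ∀ μ v, conn c μ 0 j (M v) = M (conn c μ 0 j v) := by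
    intro μ v
    simp only [conn, LinearMap.coe_mk, AddHom.coe_mk, LinearMap.sum_apply, LinearMap.smul_apply,
      map_sum, map_smul, hT]
  have hself : ∀ v, v ⬝ᵥ M v = 0 := by
    intro v
    have h1 := hM v v
    rw [dotProduct_comm] at h1
    linarith
  rw [hX.isVertical.firstVariation_eq, hX.isVertical.pr_eq_along, along,
    (hasLineDerivAt_lagrangian c p j _).lineDeriv, lagrangianDeriv]
  simp only [fieldStrengthDeriv_eq_zero hg, covDDeriv, conn_eq_zero (fun α μ => hg α μ 0), hs0,
    hs1, hU, hA, LinearMap.zero_apply, zero_add, ← map_add]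
  have : ∀ μ, covD c μ j ⬝ᵥ M (scal (unitIx μ) j + conn c μ 0 j (scal 0 j)) = 0 :=
    fun μ => hself _
  simp only [this, mul_zero, Finset.sum_const_zero, add_zero, sub_zero]

lemma IsScalar.isStrictlyVariational {c : Gauge} (hg' : c.g' ≠ 0) (hY : c.Y ≠ 0) {p : Potential}
    {X : PointGenerator} (hX : IsScalar X) (h : IsELSymmetry (lagrangian c p) X) :
    IsStrictlyVariational (lagrangian c p) X := by
  obtain ⟨M, rfl, hT, hM, hU⟩ := hX.exists_linear hg' hY h
  exact isStrictlyVariational_linear hT hM (fderiv_potU_eq_zero hM hU)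

lemma IsScalar.isELSymmetry {c : Gauge} {p : Potential} {X : PointGenerator} (hX : IsScalar X)
    (h : IsVariational (lagrangian c p) X) : IsELSymmetry (lagrangian c p) X :=
  h.isELSymmetry hX.isVertical (isFirstOrder_lagrangian c p) (isLocalFunction_lagrangian c p)

/-! ### The commutant of the gauge generators -/

lemma eq_leftMul_of_commute {c : Gauge} (hg : c.g ≠ 0) (hg' : c.g' ≠ 0) (hY : c.Y ≠ 0)
    {M : (Fin 8 → ℝ) →ₗ[ℝ] (Fin 8 → ℝ)} (hT : ∀ α φ, M (gaugeGen c α φ) = gaugeGen c α (M φ)) :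
    ∃ a, M = leftMul a := by
  let N : Matrix (Fin 2) (Fin 2) ℂ →ₗ[ℝ] Matrix (Fin 2) (Fin 2) ℂ :=
    doubletsEquiv.toLinearMap ∘ₗ M ∘ₗ doubletsEquiv.symm.toLinearMap
  -- The matrices whose right multiplication commutes with `M` form a real algebra.
  let S : Subalgebra ℝ (Matrix (Fin 2) (Fin 2) ℂ) :=
    { carrier := {B | ∀ Φ, N (Φ * B) = N Φ * B}
      mul_mem' := fun {A B} hA hB Φ => by
        rw [← Matrix.mul_assoc, hB, hA, Matrix.mul_assoc]
      add_mem' := fun {A B} hA hB Φ => by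
        rw [Matrix.mul_add, map_add, hA, hB, Matrix.mul_add]
      algebraMap_mem' := fun r Φ => by
        simp [Algebra.algebraMap_eq_smul_one] }
  have hα : ∀ α, gaugeMat c α ∈ S := by
    intro α Φ
    have h1 := congrArg doubletsEquiv (hT α (doubletsEquiv.symm Φ))
    have h2 : gaugeGen c α (doubletsEquiv.symm Φ) = doubletsEquiv.symm (Φ * gaugeMat c α) := by
      simp [gaugeGen, rightMul]
    rw [h2] at h1
    refine h1.trans ?_
    simp [gaugeGen, rightMul, N]
  have hI : (Complex.I • 1 : Matrix (Fin 2) (Fin 2) ℂ) ∈ S := by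
    have h1 := S.smul_mem (hα none) (c.g' * c.Y)⁻¹
    convert h1 using 1
    ext i k
    have : (c.g' : ℂ) ≠ 0 := by exact_mod_cast hg'
    have : (c.Y : ℂ) ≠ 0 := by exact_mod_cast hY
    simp only [gaugeMat, Matrix.smul_apply, smul_eq_mul, Complex.real_smul]
    push_cast
    field_simp
  have hz : ∀ z : ℂ, (z • 1 : Matrix (Fin 2) (Fin 2) ℂ) ∈ S := by
    intro z
    have h1 := S.add_mem (S.smul_mem S.one_mem z.re) (S.smul_mem hI z.im)
    convert h1 using 1
    ext i k
    simp only [Matrix.smul_apply, Matrix.add_apply, smul_eq_mul, Complex.real_smul]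
    conv_lhs => rw [← Complex.re_add_im z]
    ring
  have hσ : ∀ a (z : ℂ), z • (pauli a)ᵀ ∈ S := by
    intro a z
    have h1 := S.mul_mem (hz (z * (-(Complex.I * (2 * c.g⁻¹)))))  (hα (some a))
    convert h1 using 1
    have : (c.g : ℂ) ≠ 0 := by exact_mod_cast hg
    simp only [gaugeMat, Matrix.smul_mul, Matrix.one_mul, smul_smul]
    congr 1
    push_cast
    field_simp
    simp
  have hall : ∀ B, B ∈ S := by
    intro B
    have h1 := S.add_mem (S.add_mem (hz ((B 0 0 + B 1 1) / 2)) (hσ 0 ((B 0 1 + B 1 0) / 2)))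
      (S.add_mem (hσ 1 (Complex.I * (B 1 0 - B 0 1) / 2 )) (hσ 2 ((B 0 0 - B 1 1) / 2)))
    convert h1 using 1
    ext i k
    fin_cases i <;> fin_cases k <;> simp [pauli] <;> ring_nf <;> simp <;> ring
  refine ⟨N 1, LinearMap.ext fun φ => doublets_injective ?_⟩
  rw [doublets_leftMul]
  have h1 := hall (doublets φ) 1
  rw [Matrix.one_mul] at h1
  rw [← h1, ← doubletsEquiv_apply φ]
  simp only [N, LinearMap.comp_apply, LinearEquiv.coe_coe, LinearEquiv.symm_apply_apply]
  rfl

lemma conjTranspose_eq_neg_of_skew {a : Matrix (Fin 2) (Fin 2) ℂ}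
    (h : ∀ v w, leftMul a v ⬝ᵥ w = -(v ⬝ᵥ leftMul a w)) : aᴴ = -a := by
  set b := a + aᴴ with hb
  set v := doubletsEquiv.symm b with hv
  set w := doubletsEquiv.symm 1 with hw
  have hv' : doublets v = b := doubletsEquiv.apply_symm_apply b
  have hw' : doublets w = 1 := doubletsEquiv.apply_symm_apply 1
  have h1 := h v w
  rw [dotProduct_eq_trace, dotProduct_eq_trace, doublets_leftMul, doublets_leftMul, hv', hw',
    Matrix.mul_one, Matrix.mul_one, Matrix.conjTranspose_mul] at h1
  have h2 : v ⬝ᵥ v = 0 := by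
    rw [dotProduct_eq_trace, hv']
    nth_rewrite 2 [hb]
    rw [Matrix.mul_add, Matrix.trace_add, Complex.add_re]
    linarith
  have h3 : b = 0 := by
    rw [← hv', dotProduct_self_eq_zero.1 h2, ← doubletsEquiv_apply, map_zero]
  exact eq_neg_of_add_eq_zero_right (hb ▸ h3)

/-- The skew-Hermitian matrices under which the potential is infinitesimally invariant. -/
def IsInvariance (p : Potential) (a : Matrix (Fin 2) (Fin 2) ℂ) : Prop :=
  aᴴ = -a ∧ ∀ φ, fderiv ℝ (potU p) φ (leftMul a φ) = 0

/-- The scalar symmetries are the generators `φ ↦ a Φ` with `a ∈ u(2)` that leave the potential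
invariant. -/
lemma mem_scalarSymmetries_iff {c : Gauge} (hg : c.g ≠ 0) (hg' : c.g' ≠ 0) (hY : c.Y ≠ 0)
    {p : Potential} {X : PointGenerator} : X ∈ scalarSymmetries c p ↔
      ∃ a, IsInvariance p a ∧ X = linearScalarGenerator (leftMul a) := by
  constructor
  · rintro ⟨hX, h⟩
    obtain ⟨M, rfl, hT, hM, hU⟩ := hX.exists_linear hg' hY h
    obtain ⟨a, rfl⟩ := eq_leftMul_of_commute hg hg' hY hT
    exact ⟨a, ⟨conjTranspose_eq_neg_of_skew hM, fderiv_potU_eq_zero hM hU⟩, rfl⟩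
  · rintro ⟨a, ⟨ha, hU⟩, rfl⟩
    have hX := isScalar_linearScalarGenerator (leftMul a)
    exact ⟨hX, hX.isELSymmetry (isStrictlyVariational_linear
      (fun α φ => leftMul_rightMul a _ φ) (leftMul_skew ha) hU).isVariational⟩

attribute [local instance] LieRing.ofAssociativeRing

/-! ### The Lie algebra of invariances -/

lemma leftMul_add (a b : Matrix (Fin 2) (Fin 2) ℂ) : leftMul (a + b) = leftMul a + leftMul b :=
  LinearMap.ext fun φ => doublets_injective (by
    rw [doublets_leftMul, Matrix.add_mul, ← doublets_leftMul, ← doublets_leftMul]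
    exact (map_add doubletsEquiv _ _).symm)

lemma leftMul_smul (r : ℝ) (a : Matrix (Fin 2) (Fin 2) ℂ) : leftMul (r • a) = r • leftMul a :=
  LinearMap.ext fun φ => doublets_injective (by
    rw [doublets_leftMul, Matrix.smul_mul, ← doublets_leftMul]
    exact (map_smul doubletsEquiv _ _).symm)

lemma leftMul_mul (a b : Matrix (Fin 2) (Fin 2) ℂ) (φ : Fin 8 → ℝ) :
    leftMul (a * b) φ = leftMul a (leftMul b φ) :=
  doublets_injective (by simp only [doublets_leftMul, Matrix.mul_assoc])

lemma leftMul_zero : leftMul 0 = 0 := by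
  simpa using leftMul_smul 0 0

lemma leftMul_neg (a : Matrix (Fin 2) (Fin 2) ℂ) : leftMul (-a) = -leftMul a := by
  rw [← neg_one_smul ℝ a, leftMul_smul, neg_one_smul ℝ (leftMul a)]

lemma leftMul_injective : Function.Injective leftMul := by
  intro a b h
  have h1 : doublets (leftMul a (doubletsEquiv.symm 1)) =
      doublets (leftMul b (doubletsEquiv.symm 1)) := by rw [h]
  have h2 : doublets (doubletsEquiv.symm 1) = 1 := doubletsEquiv.apply_symm_apply 1
  rwa [doublets_leftMul, doublets_leftMul, h2, Matrix.mul_one, Matrix.mul_one] at h1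

/-- The invariances of a potential form a Lie algebra. -/
def invarianceAlgebra (p : Potential) : LieSubalgebra ℝ (Matrix (Fin 2) (Fin 2) ℂ) where
  carrier := {a | IsInvariance p a}
  add_mem' := fun {a b} ha hb => by
    refine ⟨(uAlg 2).add_mem ha.1 hb.1, fun φ => ?_⟩
    rw [leftMul_add, LinearMap.add_apply, map_add, ha.2, hb.2, add_zero]
  zero_mem' := ⟨(uAlg 2).zero_mem, fun φ => by simp [leftMul_zero]⟩
  smul_mem' := fun r a ha => by
    refine ⟨(uAlg 2).smul_mem r ha.1, fun φ => ?_⟩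
    rw [leftMul_smul, LinearMap.smul_apply, map_smul, ha.2, smul_zero]
  lie_mem' := fun {a b} ha hb => by
    refine ⟨(uAlg 2).lie_mem ha.1 hb.1, fun φ => ?_⟩
    have hd2 : Differentiable ℝ (fderiv ℝ (potU p)) :=
      ((contDiff_potU p).fderiv_right (m := ∞) (by simp)).differentiable (by simp)
    have hsymm : IsSymmSndFDerivAt ℝ (potU p) φ :=
      (contDiff_potU p).contDiffAt.isSymmSndFDerivAt (by
        rw [minSmoothness_of_isRCLikeNormedField]; exact WithTop.coe_le_coe.2 le_top)
    have key : ∀ a b, IsInvariance p a → fderiv ℝ (fderiv ℝ (potU p)) φ (leftMul b φ)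
        (leftMul a φ) + fderiv ℝ (potU p) φ (leftMul a (leftMul b φ)) = 0 := by
      intro a b ha
      have h1 := (hasLineDerivAt_comp_linear LinearMap.id (hd2 φ) (leftMul b φ) :
        HasDerivAt _ _ _).clm_apply (hasLineDerivAt_comp_linear LinearMap.id
          ((LinearMap.toContinuousLinearMap (leftMul a)).differentiable φ) (leftMul b φ))
      rw [(LinearMap.toContinuousLinearMap (leftMul a)).fderiv] at h1
      simp only [LinearMap.id_apply, LinearMap.coe_toContinuousLinearMap', ha.2, zero_smul,
        add_zero] at h1
      exact h1.unique (hasDerivAt_const _ _)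
    have h1 := key a b ha
    have h2 := key b a hb
    rw [hsymm.eq] at h2
    change fderiv ℝ (potU p) φ (leftMul (a * b - b * a) φ) = 0
    rw [sub_eq_add_neg, leftMul_add, leftMul_neg, LinearMap.add_apply, LinearMap.neg_apply,
      leftMul_mul, leftMul_mul, map_add, map_neg]
    linarith

/-- A linear vector field as a continuous linear map. -/
def linearFieldCLM (A : (Fin 8 → ℝ) →ₗ[ℝ] (Fin 8 → ℝ)) : Vars →L[ℝ] Vars :=
  LinearMap.toContinuousLinearMap
    { toFun := (linearScalarGenerator A).1
      map_add' := fun z z' => by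
        refine Prod.ext (by simp [linearScalarGenerator]) (funext fun i => ?_)
        rcases i with k | i
        · exact congrFun (map_add A (fun k => z.2 (iφ k)) (fun k => z'.2 (iφ k))) k
        · simp [linearScalarGenerator]
      map_smul' := fun r z => by
        refine Prod.ext (by simp [linearScalarGenerator]) (funext fun i => ?_)
        rcases i with k | i
        · exact congrFun (map_smul A r (fun k => z.2 (iφ k))) k
        · simp [linearScalarGenerator] }

lemma bracket_linearScalarGenerator (A B : (Fin 8 → ℝ) →ₗ[ℝ] (Fin 8 → ℝ)) :
    ⁅linearScalarGenerator A, linearScalarGenerator B⁆ =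
      linearScalarGenerator (B ∘ₗ A - A ∘ₗ B) := by
  refine Subtype.ext (funext fun z => ?_)
  rw [PointGenerator.coe_bracket]
  have hA : (linearScalarGenerator A).1 = linearFieldCLM A := rfl
  have hB : (linearScalarGenerator B).1 = linearFieldCLM B := rfl
  rw [hA, hB, VectorField.lieBracket, (linearFieldCLM A).fderiv, (linearFieldCLM B).fderiv]
  refine Prod.ext (sub_self _) (funext fun i => ?_)
  rcases i with k | i
  · rfl
  · exact sub_self _

lemma linearScalarGenerator_injective : Function.Injective linearScalarGenerator := by
  intro A B h
  refine LinearMap.ext fun φ => funext fun k => ?_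
  have h1 := congrFun (congrArg Subtype.val h) (0, Sum.elim φ 0)
  exact congrFun (congrArg Prod.snd h1) (iφ k)

/-- The homomorphism from matrices to vector fields, `a ↦ (φ ↦ -a Φ)`. The sign compensates the
anti-homomorphism from matrices to linear vector fields. -/
def toGenerator : Matrix (Fin 2) (Fin 2) ℂ →ₗ⁅ℝ⁆ PointGenerator where
  toFun a := linearScalarGenerator (leftMul (-a))
  map_add' a b := by
    refine Subtype.ext (funext fun z => Prod.ext (by simp [linearScalarGenerator])
      (funext fun i => ?_))
    rw [neg_add, leftMul_add]
    rcases i with k | i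
    · rfl
    · exact (add_zero _).symm
  map_smul' r a := by
    refine Subtype.ext (funext fun z => Prod.ext (by simp [linearScalarGenerator])
      (funext fun i => ?_))
    rw [← smul_neg, leftMul_smul]
    rcases i with k | i
    · rfl
    · exact (mul_zero _).symm
  map_lie' := fun {a b} => by
    change linearScalarGenerator (leftMul (-(a * b - b * a))) = _
    rw [bracket_linearScalarGenerator]
    congr 1
    refine LinearMap.ext fun φ => ?_
    rw [LinearMap.sub_apply, LinearMap.comp_apply, LinearMap.comp_apply, ← leftMul_mul,
      ← leftMul_mul, neg_mul_neg, neg_mul_neg, neg_sub, sub_eq_add_neg, leftMul_add, leftMul_neg]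
    simp [sub_eq_add_neg]

lemma toGenerator_injective : Function.Injective toGenerator := fun _ _ h =>
  neg_injective (leftMul_injective (linearScalarGenerator_injective h))

lemma scalarSymmetries_eq_image {c : Gauge} (hg : c.g ≠ 0) (hg' : c.g' ≠ 0) (hY : c.Y ≠ 0)
    (p : Potential) : scalarSymmetries c p = toGenerator '' invarianceAlgebra p := by
  ext X
  rw [mem_scalarSymmetries_iff hg hg' hY]
  constructor
  · rintro ⟨a, ha, rfl⟩
    exact ⟨-a, (invarianceAlgebra p).neg_mem ha, by simp [toGenerator]⟩
  · rintro ⟨a, ha, rfl⟩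
    exact ⟨-a, (invarianceAlgebra p).neg_mem ha, rfl⟩

/-! ### The structure of `u(2)` -/

/-- The element `-(i/2) ∑ n_a σ_a` of `su(2)`. -/
def su2 : (Fin 3 → ℝ) →ₗ[ℝ] Matrix (Fin 2) (Fin 2) ℂ where
  toFun n := (1 / 2 : ℂ) • !![-Complex.I * n 2, -Complex.I * n 0 - n 1;
    -Complex.I * n 0 + n 1, Complex.I * n 2]
  map_add' n m := by
    ext i k
    fin_cases i <;> fin_cases k <;> simp <;> ring
  map_smul' r n := by
    ext i k
    fin_cases i <;> fin_cases k <;> simp <;> ring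

/-- The generator `i` of the center of `u(2)`. -/
def iOne : Matrix (Fin 2) (Fin 2) ℂ := Complex.I • 1

lemma iOne_eq : iOne = !![Complex.I, 0; 0, Complex.I] := by
  ext i k
  fin_cases i <;> fin_cases k <;> simp [iOne]

lemma su2_apply (n : Fin 3 → ℝ) : su2 n = (1 / 2 : ℂ) •
    !![-Complex.I * n 2, -Complex.I * n 0 - n 1; -Complex.I * n 0 + n 1, Complex.I * n 2] := rfl

lemma su2_cross (n m : Fin 3 → ℝ) : su2 (crossProduct n m) = su2 n * su2 m - su2 m * su2 n := by
  ext i k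
  fin_cases i <;> fin_cases k <;> simp [su2_apply, cross_apply] <;> ring_nf <;>
    simp <;> ring

lemma iOne_mul_comm (a : Matrix (Fin 2) (Fin 2) ℂ) : iOne * a = a * iOne := by
  simp [iOne]

lemma su2_conjTranspose (n : Fin 3 → ℝ) : (su2 n)ᴴ = -su2 n := by
  ext i k
  fin_cases i <;> fin_cases k <;> simp [su2_apply] <;> ring

lemma iOne_conjTranspose : iOneᴴ = -iOne := by
  simp [iOne]

lemma su2_trace (n : Fin 3 → ℝ) : (su2 n).trace = 0 := by
  simp [su2_apply, Matrix.trace, Fin.sum_univ_two]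

/-- The coordinates of `u(2) = u(1) ⊕ su(2)`. -/
lemma exists_eq_of_skew {a : Matrix (Fin 2) (Fin 2) ℂ} (ha : aᴴ = -a) :
    a = (((a 0 0).im + (a 1 1).im) / 2) • iOne +
      su2 ![-2 * (a 0 1).im, -2 * (a 0 1).re, (a 1 1).im - (a 0 0).im] := by
  have h : ∀ i k, star (a k i) = -a i k := fun i k => congrFun (congrFun ha i) k
  have h00 := h 0 0
  have h11 := h 1 1
  have h10 := h 1 0
  simp only [Complex.ext_iff, Complex.star_def, Complex.conj_re, Complex.conj_im,
    Complex.neg_re, Complex.neg_im] at h00 h11 h10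
  ext i k
  fin_cases i <;> fin_cases k <;> apply Complex.ext <;>
    rw [Matrix.add_apply, Matrix.smul_apply] <;> simp [iOne_eq, su2_apply] <;> linarith

lemma su2_injective : Function.Injective su2 := by
  rw [injective_iff_map_eq_zero]
  intro n hn
  have h0 := congrFun (congrFun hn 0) 0
  have h1 := congrFun (congrFun hn 0) 1
  simp only [su2_apply, Complex.ext_iff] at h0 h1
  simp at h0 h1
  funext a
  fin_cases a
  · exact h1.2
  · exact h1.1
  · exact h0

lemma smul_iOne_add_su2_eq_zero {s : ℝ} {n : Fin 3 → ℝ} (h : s • iOne + su2 n = 0) :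
    s = 0 ∧ n = 0 := by
  have h1 := congrArg Matrix.trace h
  rw [Matrix.trace_add, su2_trace, add_zero, Matrix.trace_smul] at h1
  have hs : s = 0 := by
    simpa [iOne, Complex.ext_iff] using h1
  subst hs
  rw [zero_smul, zero_add] at h
  exact ⟨rfl, su2_injective (h.trans (map_zero su2).symm)⟩

/-- Subspaces of `ℝ³` closed under the cross product have dimension 0, 1 or 3: with independent `n`
and `m` they contain the basis `n`, `m`, `n × m`. -/
lemma submodule_cross_trichotomy (N : Submodule ℝ (Fin 3 → ℝ))
    (hN : ∀ n ∈ N, ∀ m ∈ N, crossProduct n m ∈ N) :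
    N = ⊥ ∨ (∃ n, n ≠ 0 ∧ N = Submodule.span ℝ {n}) ∨ N = ⊤ := by
  by_cases h0 : N = ⊥
  · exact Or.inl h0
  obtain ⟨n, hn, hn0⟩ := N.ne_bot_iff.1 h0
  by_cases h1 : N = Submodule.span ℝ {n}
  · exact Or.inr (Or.inl ⟨n, hn0, h1⟩)
  have hle : Submodule.span ℝ {n} ≤ N := by simpa using hn
  obtain ⟨m, hm, hmn⟩ := SetLike.exists_of_lt (lt_of_le_of_ne hle (Ne.symm h1))
  have hind : LinearIndependent ℝ ![n, m] := by
    rw [LinearIndependent.pair_iff' hn0]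
    intro r hr
    exact hmn (Submodule.mem_span_singleton.2 ⟨r, hr⟩)
  have hc := crossProduct_ne_zero_iff_linearIndependent.2 hind
  refine Or.inr (Or.inr ?_)
  have hdet : (Matrix.of ![n, m, crossProduct n m]).det ≠ 0 := by
    have e : (Matrix.of ![n, m, crossProduct n m]).det =
        crossProduct n m ⬝ᵥ crossProduct n m := by
      simp [Matrix.det_fin_three, cross_apply, dotProduct, Fin.sum_univ_three]
      ring
    rw [e]
    exact fun h => hc (dotProduct_self_eq_zero.1 h)
  have hli := Matrix.linearIndependent_rows_of_det_ne_zero hdet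
  have hspan := hli.span_eq_top_of_card_eq_finrank (by simp)
  rw [eq_top_iff, ← hspan, Submodule.span_le]
  rintro _ ⟨i, rfl⟩
  fin_cases i
  · exact hn
  · exact hm
  · exact hN n hn m hm

/-! ### The potential as a function of the gauge invariant bilinears -/

/-- The gauge invariant bilinears `|Φ₁|²`, `|Φ₂|²`, `Re Φ₁†Φ₂`, `Im Φ₁†Φ₂`. -/
def bilinears (Φ : Matrix (Fin 2) (Fin 2) ℂ) : Fin 4 → ℝ :=
  ![(star (Φ 0) ⬝ᵥ Φ 0).re, (star (Φ 1) ⬝ᵥ Φ 1).re, (star (Φ 0) ⬝ᵥ Φ 1).re,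
    (star (Φ 0) ⬝ᵥ Φ 1).im]

/-- The coefficients of the linear part of the potential in the bilinears. -/
def linCoeff (p : Potential) : Fin 4 → ℝ :=
  ![p.m11sq, p.m22sq, -2 * p.m12sq.re, 2 * p.m12sq.im]

/-- The coefficients of the quadratic part of the potential in the bilinears. -/
def quadCoeff (p : Potential) : Matrix (Fin 4) (Fin 4) ℝ :=
  !![p.lam1 / 2, p.lam3 / 2, p.lam6.re, -p.lam6.im;
     p.lam3 / 2, p.lam2 / 2, p.lam7.re, -p.lam7.im;
     p.lam6.re, p.lam7.re, p.lam4 + p.lam5.re, -p.lam5.im;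
     -p.lam6.im, -p.lam7.im, -p.lam5.im, p.lam4 - p.lam5.re]

lemma V_eq (p : Potential) (Φ : Matrix (Fin 2) (Fin 2) ℂ) :
    p.V Φ = linCoeff p ⬝ᵥ bilinears Φ + bilinears Φ ⬝ᵥ quadCoeff p *ᵥ bilinears Φ := by
  have h1 : star (Φ 1) ⬝ᵥ Φ 0 = star (star (Φ 0) ⬝ᵥ Φ 1) := by
    simp [dotProduct, Fin.sum_univ_two, mul_comm]
  have h2 : ∀ i, (star (Φ i) ⬝ᵥ Φ i).im = 0 := by
    intro i
    simp [dotProduct, Fin.sum_univ_two]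
    ring
  have h0 := h2 0
  have h3 := h2 1
  simp only [Potential.V, h1, linCoeff, quadCoeff, bilinears]
  generalize star (Φ 0) ⬝ᵥ Φ 0 = x at *
  generalize star (Φ 1) ⬝ᵥ Φ 1 = y at *
  generalize star (Φ 0) ⬝ᵥ Φ 1 = z at *
  simp [dotProduct, Matrix.mulVec, Fin.sum_univ_four, pow_two, h0, h3]
  ring

/-- Every quadratic polynomial in the bilinears is a potential of the general form. -/
lemma exists_potential (l : Fin 4 → ℝ) (q : Matrix (Fin 4) (Fin 4) ℝ) :
    ∃ p : Potential, ∀ Φ, p.V Φ = l ⬝ᵥ bilinears Φ + bilinears Φ ⬝ᵥ q *ᵥ bilinears Φ := by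
  refine ⟨⟨l 0, l 1, ⟨-l 2 / 2, l 3 / 2⟩, 2 * q 0 0, 2 * q 1 1, q 0 1 + q 1 0,
    (q 2 2 + q 3 3) / 2, ⟨(q 2 2 - q 3 3) / 2, -(q 2 3 + q 3 2) / 2⟩,
    ⟨(q 0 2 + q 2 0) / 2, -(q 0 3 + q 3 0) / 2⟩,
    ⟨(q 1 2 + q 2 1) / 2, -(q 1 3 + q 3 1) / 2⟩⟩, fun Φ => ?_⟩
  rw [V_eq]
  generalize bilinears Φ = r
  simp [linCoeff, quadCoeff, dotProduct, Matrix.mulVec, Fin.sum_univ_four]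
  ring

/-- A linear transformation of the doublets acts linearly on the bilinears. -/
lemma exists_bilinears_mul (A : Matrix (Fin 2) (Fin 2) ℂ) :
    ∃ R : Matrix (Fin 4) (Fin 4) ℝ, ∀ Φ, bilinears (A * Φ) = R *ᵥ bilinears Φ := by
  let c : Fin 2 → Fin 2 → Fin 2 → Fin 2 → ℂ := fun a b k l => star (A a k) * A b l
  -- The entries are the coefficients of `(AΦ)_a†(AΦ)_b = ∑ c_{abkl} Φ_k†Φ_l`.
  refine ⟨!![(c 0 0 0 0).re, (c 0 0 1 1).re, 2 * (c 0 0 0 1).re, -2 * (c 0 0 0 1).im;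
    (c 1 1 0 0).re, (c 1 1 1 1).re, 2 * (c 1 1 0 1).re, -2 * (c 1 1 0 1).im;
    (c 0 1 0 0).re, (c 0 1 1 1).re, (c 0 1 0 1).re + (c 0 1 1 0).re,
      -(c 0 1 0 1).im + (c 0 1 1 0).im;
    (c 0 1 0 0).im, (c 0 1 1 1).im, (c 0 1 0 1).im + (c 0 1 1 0).im,
      (c 0 1 0 1).re - (c 0 1 1 0).re], fun Φ => ?_⟩
  funext i
  fin_cases i <;>
    simp [c, bilinears, dotProduct, Matrix.mulVec, Matrix.mul_apply, Fin.sum_univ_four,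
      Fin.sum_univ_two] <;> ring

/-! ### Changes of the Higgs basis -/

lemma exists_basisChange {W : Matrix (Fin 2) (Fin 2) ℂ} (hW : W ∈ Matrix.unitaryGroup (Fin 2) ℂ)
    (p : Potential) : ∃ p', IsBasisChange W p p' := by
  obtain ⟨R, hR⟩ := exists_bilinears_mul Wᴴ
  obtain ⟨p', hp'⟩ := exists_potential (linCoeff p ᵥ* R) (Rᵀ * quadCoeff p * R)
  refine ⟨p', hW, fun Φ => ?_⟩
  have h1 : Wᴴ * (W * Φ) = Φ := by
    rw [← Matrix.mul_assoc, ← Matrix.star_eq_conjTranspose, Matrix.mem_unitaryGroup_iff'.1 hW,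
      Matrix.one_mul]
  rw [hp', V_eq, ← h1, hR, h1]
  generalize bilinears (W * Φ) = r
  rw [Matrix.dotProduct_mulVec (linCoeff p), ← Matrix.mulVec_mulVec, ← Matrix.mulVec_mulVec,
    Matrix.dotProduct_mulVec r Rᵀ, Matrix.vecMul_transpose]

lemma IsBasisChange.symm {W : Matrix (Fin 2) (Fin 2) ℂ} {p p' : Potential}
    (h : IsBasisChange W p p') : IsBasisChange Wᴴ p' p := by
  refine ⟨Unitary.star_mem h.1, fun Φ => ?_⟩
  rw [← h.2, ← Matrix.mul_assoc, ← Matrix.star_eq_conjTranspose,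
    Matrix.mem_unitaryGroup_iff.1 h.1, Matrix.one_mul]

lemma isBasisChange_one (p : Potential) : IsBasisChange 1 p p :=
  ⟨Submonoid.one_mem _, fun Φ => by rw [Matrix.one_mul]⟩

/-- A change of basis conjugates the invariances. -/
lemma IsBasisChange.conj_mem {W : Matrix (Fin 2) (Fin 2) ℂ} {p p' : Potential}
    (h : IsBasisChange W p p') {a : Matrix (Fin 2) (Fin 2) ℂ} (ha : a ∈ invarianceAlgebra p) :
    W * a * Wᴴ ∈ invarianceAlgebra p' := by
  refine ⟨?_, fun φ => ?_⟩
  · rw [Matrix.conjTranspose_mul, Matrix.conjTranspose_mul, Matrix.conjTranspose_conjTranspose,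
      ha.1]
    simp [Matrix.mul_assoc]
  · have e : potU p = potU p' ∘ LinearMap.toContinuousLinearMap (leftMul W) :=
      funext fun ψ => by
        change p.V _ = p'.V (doublets (leftMul W ψ))
        rw [doublets_leftMul, h.2]
    have h1 := ha.2 (leftMul Wᴴ φ)
    rw [e, fderiv_comp _ (differentiable_potU p' _)
      (LinearMap.toContinuousLinearMap (leftMul W)).differentiableAt,
      ContinuousLinearMap.fderiv] at h1
    have h2 : leftMul W (leftMul Wᴴ φ) = φ := doublets_injective (by
      rw [doublets_leftMul, doublets_leftMul, ← Matrix.mul_assoc,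
        ← Matrix.star_eq_conjTranspose, Matrix.mem_unitaryGroup_iff.1 h.1, Matrix.one_mul])
    rw [ContinuousLinearMap.comp_apply, LinearMap.coe_toContinuousLinearMap', h2] at h1
    rwa [leftMul_mul, leftMul_mul]

lemma IsBasisChange.conj_conj {W : Matrix (Fin 2) (Fin 2) ℂ} {p p' : Potential}
    (h : IsBasisChange W p p') (a : Matrix (Fin 2) (Fin 2) ℂ) : Wᴴ * (W * a * Wᴴ) * W = a := by
  have h1 : Wᴴ * W = 1 := Matrix.mem_unitaryGroup_iff'.1 h.1
  rw [Matrix.mul_assoc W, ← Matrix.mul_assoc Wᴴ, h1, Matrix.one_mul, Matrix.mul_assoc, h1,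
    Matrix.mul_one]

/-- Every nonzero element of `su(2)` is conjugate to a multiple of the third basis element, because
Hermitian matrices can be diagonalized by unitary ones. -/
lemma exists_unitary_conj_su2 {n : Fin 3 → ℝ} (hn : n ≠ 0) :
    ∃ W ∈ Matrix.unitaryGroup (Fin 2) ℂ, ∃ r : ℝ, r ≠ 0 ∧
      W * su2 n * Wᴴ = r • su2 ![0, 0, 1] := by
  have hH : (Complex.I • su2 n).IsHermitian := by
    rw [Matrix.IsHermitian, Matrix.conjTranspose_smul, su2_conjTranspose]
    simp
  set U := hH.eigenvectorUnitary with hU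
  have hd := hH.conjStarAlgAut_star_eigenvectorUnitary
  rw [Unitary.conjStarAlgAut_star_apply] at hd
  set W : Matrix (Fin 2) (Fin 2) ℂ := star (U : Matrix (Fin 2) (Fin 2) ℂ) with hW
  have hWmem : W ∈ Matrix.unitaryGroup (Fin 2) ℂ := Unitary.star_mem U.2
  have hWH : Wᴴ = (U : Matrix (Fin 2) (Fin 2) ℂ) := Matrix.conjTranspose_conjTranspose _
  rw [← hWH] at hd
  rw [Matrix.mul_smul, Matrix.smul_mul] at hd
  have htr : (W * su2 n * Wᴴ).trace = 0 := by
    rw [Matrix.trace_mul_comm, ← Matrix.mul_assoc, hWH, hW, Matrix.mem_unitaryGroup_iff.1 U.2]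
    simp [su2_trace]
  obtain ⟨e, he⟩ : ∃ e, e = hH.eigenvalues := ⟨_, rfl⟩
  rw [← he] at hd
  have h1 : W * su2 n * Wᴴ = -Complex.I • Matrix.diagonal (RCLike.ofReal ∘ e) := by
    rw [← hd, smul_smul]
    simp
  have hsum : e 1 = -e 0 := by
    rw [h1, Matrix.trace_smul, Matrix.trace_diagonal] at htr
    simp [Fin.sum_univ_two, Complex.ext_iff] at htr
    linarith
  have h2 : W * su2 n * Wᴴ = (2 * e 0) • su2 ![0, 0, 1] := by
    rw [h1]
    ext i k
    rw [Matrix.smul_apply, Matrix.smul_apply]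
    fin_cases i <;> fin_cases k <;> simp [su2_apply, hsum] <;> ring
  refine ⟨W, hWmem, _, fun h0 => hn ?_, h2⟩
  rw [h0, zero_smul] at h2
  refine su2_injective ?_
  have h3 : Wᴴ * W = 1 := Matrix.mem_unitaryGroup_iff'.1 hWmem
  calc su2 n = Wᴴ * (W * su2 n * Wᴴ) * W := by
        rw [Matrix.mul_assoc W, ← Matrix.mul_assoc Wᴴ, h3, Matrix.one_mul, Matrix.mul_assoc, h3,
          Matrix.mul_one]
    _ = su2 0 := by rw [h2, Matrix.mul_zero, Matrix.zero_mul, map_zero]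

/-! ### Derivatives of the bilinears -/

lemma hasDerivAt_potU_leftMul (p : Potential) (a : Matrix (Fin 2) (Fin 2) ℂ) (φ : Fin 8 → ℝ) :
    HasDerivAt (fun t : ℝ => p.V (doublets φ + t • (a * doublets φ)))
      (fderiv ℝ (potU p) φ (leftMul a φ)) 0 := by
  have h := hasLineDerivAt_comp_linear LinearMap.id (differentiable_potU p φ) (leftMul a φ)
  have e : ∀ t : ℝ, doublets φ + t • (a * doublets φ) = doublets (φ + t • leftMul a φ) := by
    intro t
    rw [← doublets_leftMul]
    exact ((map_add doubletsEquiv _ _).trans (congrArg _ (map_smul doubletsEquiv _ _))).symm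
  simp only [e]
  exact h

lemma bilinears_add_smul_iOne (Φ : Matrix (Fin 2) (Fin 2) ℂ) (t : ℝ) :
    bilinears (Φ + t • (iOne * Φ)) = (1 + t ^ 2) • bilinears Φ := by
  have h : ∀ i k, (Φ + t • (iOne * Φ)) i k = Φ i k + t * (Complex.I * Φ i k) := by
    intro i k
    rw [Matrix.add_apply, Matrix.smul_apply, iOne, Matrix.smul_mul, Matrix.one_mul,
      Matrix.smul_apply, smul_eq_mul, Complex.real_smul]
  funext i
  fin_cases i <;>
    simp only [bilinears, dotProduct, Fin.sum_univ_two, Pi.star_apply, h] <;> simp <;> ring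

/-- Every potential is invariant under hypercharge. -/
lemma iOne_mem_invarianceAlgebra (p : Potential) : iOne ∈ invarianceAlgebra p := by
  refine ⟨iOne_conjTranspose, fun φ => ?_⟩
  have h1 := hasDerivAt_potU_leftMul p iOne φ
  simp only [V_eq, bilinears_add_smul_iOne, dotProduct_smul, smul_dotProduct, Matrix.mulVec_smul,
    smul_eq_mul] at h1
  have h2 : HasDerivAt (fun t : ℝ => 1 + t ^ 2) 0 0 := by
    simpa using (hasDerivAt_pow 2 (0 : ℝ)).const_add 1
  have h3 := (h2.mul_const (linCoeff p ⬝ᵥ bilinears (doublets φ))).add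
    (h2.mul (h2.mul_const (bilinears (doublets φ) ⬝ᵥ quadCoeff p *ᵥ bilinears (doublets φ))))
  refine (h1.unique h3).trans ?_
  simp

/-- `su(2)` acts on the bilinears by infinitesimal rotations. -/
lemma hasDerivAt_bilinears_su2 (n : Fin 3 → ℝ) (Φ : Matrix (Fin 2) (Fin 2) ℂ) :
    HasDerivAt (fun t : ℝ => bilinears (Φ + t • (su2 n * Φ)))
      ![n 0 * bilinears Φ 3 - n 1 * bilinears Φ 2, n 1 * bilinears Φ 2 - n 0 * bilinears Φ 3,
        n 1 * (bilinears Φ 0 - bilinears Φ 1) / 2 - n 2 * bilinears Φ 3,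
        n 2 * bilinears Φ 2 - n 0 * (bilinears Φ 0 - bilinears Φ 1) / 2] 0 := by
  rw [hasDerivAt_pi]
  intro i
  have key : ∀ (a b c : ℝ), HasDerivAt (fun t : ℝ => a + t * b + t ^ 2 * c) b 0 := by
    intro a b c
    have h2 : HasDerivAt (fun t : ℝ => t ^ 2) 0 0 := by
      simpa using hasDerivAt_pow 2 (0 : ℝ)
    have h1 := (((hasDerivAt_id' (0 : ℝ)).mul_const b).const_add a).add (h2.mul_const c)
    exact h1.congr_deriv (by ring)
  have h : ∀ (t : ℝ) i k, (Φ + t • (su2 n * Φ)) i k = Φ i k + t * (su2 n * Φ) i k := by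
    intro t i k
    rw [Matrix.add_apply, Matrix.smul_apply, Complex.real_smul]
  refine (key (bilinears Φ i) _ (bilinears (su2 n * Φ) i)).congr_of_eventuallyEq
    (.of_forall fun t => ?_)
  fin_cases i <;>
    simp only [bilinears, dotProduct, Fin.sum_univ_two, Pi.star_apply, h] <;>
    simp [su2_apply, Matrix.mul_apply, Fin.sum_univ_two] <;> ring

/-! ### The possible algebras of invariances -/

/-- The subspace `u(1)_Y ⊕ N` of `u(2)`, for a subspace `N` of `su(2) = ℝ³`. -/
def centralExtension (N : Submodule ℝ (Fin 3 → ℝ)) :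
    Submodule ℝ (Matrix (Fin 2) (Fin 2) ℂ) :=
  Submodule.span ℝ {iOne} ⊔ N.map su2

lemma mem_centralExtension {N : Submodule ℝ (Fin 3 → ℝ)} {a : Matrix (Fin 2) (Fin 2) ℂ} :
    a ∈ centralExtension N ↔ ∃ s : ℝ, ∃ n ∈ N, a = s • iOne + su2 n := by
  simp only [centralExtension, Submodule.mem_sup, Submodule.mem_span_singleton, Submodule.mem_map]
  constructor
  · rintro ⟨_, ⟨s, rfl⟩, _, ⟨n, hn, rfl⟩, rfl⟩
    exact ⟨s, n, hn, rfl⟩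
  · rintro ⟨s, n, hn, rfl⟩
    exact ⟨_, ⟨s, rfl⟩, _, ⟨n, hn, rfl⟩, rfl⟩

/-- The part of the algebra of invariances in `su(2)`. -/
def su2Part (p : Potential) : Submodule ℝ (Fin 3 → ℝ) :=
  (invarianceAlgebra p).toSubmodule.comap su2

lemma invarianceAlgebra_eq (p : Potential) :
    (invarianceAlgebra p).toSubmodule = centralExtension (su2Part p) := by
  ext a
  rw [mem_centralExtension]
  constructor
  · intro ha
    obtain ⟨s, n, rfl⟩ : ∃ (s : ℝ) (n : Fin 3 → ℝ), a = s • iOne + su2 n :=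
      ⟨_, _, exists_eq_of_skew ha.1⟩
    refine ⟨s, n, ?_, rfl⟩
    have h := (invarianceAlgebra p).sub_mem ha
      ((invarianceAlgebra p).smul_mem s (iOne_mem_invarianceAlgebra p))
    rwa [add_sub_cancel_left] at h
  · rintro ⟨s, n, hn, rfl⟩
    exact (invarianceAlgebra p).add_mem
      ((invarianceAlgebra p).smul_mem s (iOne_mem_invarianceAlgebra p)) hn

lemma su2Part_cross (p : Potential) :
    ∀ n ∈ su2Part p, ∀ m ∈ su2Part p, crossProduct n m ∈ su2Part p := by
  intro n hn m hm
  change su2 (crossProduct n m) ∈ invarianceAlgebra p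
  rw [su2_cross]
  exact (invarianceAlgebra p).lie_mem hn hm

/-- The subspace of `su(2)` in the standard algebra of each type. -/
def standardPart : AlgebraType → Submodule ℝ (Fin 3 → ℝ)
  | .su2u1 => ⊤
  | .u1u1 => Submodule.span ℝ {![0, 0, 1]}
  | .u1 => ⊥

/-- The potential is in a Higgs basis in which its symmetries are the standard ones. -/
def IsStandard (p : Potential) (t : AlgebraType) : Prop :=
  (invarianceAlgebra p).toSubmodule = centralExtension (standardPart t)

/-- In a suitable Higgs basis the symmetries are the standard ones. The type is read off from the
dimension of the part in `su(2)`, which is 0, 1 or 3. -/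
lemma exists_isStandard (p : Potential) : ∃ t W p', IsBasisChange W p p' ∧ IsStandard p' t := by
  rcases submodule_cross_trichotomy _ (su2Part_cross p) with h | ⟨n, hn, h⟩ | h
  · exact ⟨.u1, 1, p, isBasisChange_one p, by rw [IsStandard, invarianceAlgebra_eq, h]; rfl⟩
  · obtain ⟨W, hW, r, hr, hWn⟩ := exists_unitary_conj_su2 hn
    obtain ⟨p', hp'⟩ := exists_basisChange hW p
    refine ⟨.u1u1, W, p', hp', ?_⟩
    have hWW : W * Wᴴ = 1 := Matrix.mem_unitaryGroup_iff.1 hW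
    have hconj : ∀ s q : ℝ, W * (s • iOne + su2 (q • n)) * Wᴴ =
        s • iOne + su2 ((q * r) • ![0, 0, 1]) := by
      intro s q
      rw [Matrix.mul_add, Matrix.add_mul, map_smul, map_smul, Matrix.mul_smul, Matrix.smul_mul,
        Matrix.mul_smul, Matrix.smul_mul, hWn, ← iOne_mul_comm, Matrix.mul_assoc, hWW,
        Matrix.mul_one, smul_smul]
    rw [IsStandard]
    ext a
    rw [mem_centralExtension]
    constructor
    · intro ha
      have h1 := hp'.symm.conj_mem ha
      rw [← LieSubalgebra.mem_toSubmodule, invarianceAlgebra_eq, h, mem_centralExtension] at h1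
      obtain ⟨s, m, hm, h1⟩ := h1
      obtain ⟨q, rfl⟩ := Submodule.mem_span_singleton.1 hm
      refine ⟨s, _, Submodule.smul_mem _ (q * r) (Submodule.mem_span_singleton_self _), ?_⟩
      have h2 := hp'.symm.conj_conj a
      rw [h1, Matrix.conjTranspose_conjTranspose, hconj] at h2
      exact h2.symm
    · rintro ⟨s, m, hm, rfl⟩
      obtain ⟨q, rfl⟩ := Submodule.mem_span_singleton.1 hm
      have h1 : s • iOne + su2 ((q * r⁻¹) • n) ∈ invarianceAlgebra p := by
        rw [← LieSubalgebra.mem_toSubmodule, invarianceAlgebra_eq, h, mem_centralExtension]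
        exact ⟨s, _, Submodule.smul_mem _ _ (Submodule.mem_span_singleton_self _), rfl⟩
      have h2 := hp'.conj_mem h1
      rwa [hconj, mul_assoc, inv_mul_cancel₀ hr, mul_one] at h2
  · exact ⟨.su2u1, 1, p, isBasisChange_one p, by rw [IsStandard, invarianceAlgebra_eq, h]; rfl⟩

/-! ### The standard algebras of vector fields -/

lemma linearScalarGenerator_eq_toGenerator {A : (Fin 8 → ℝ) →ₗ[ℝ] (Fin 8 → ℝ)}
    {a : Matrix (Fin 2) (Fin 2) ℂ} (h : ∀ φ, doublets (A φ) = -a * doublets φ) :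
    linearScalarGenerator A = toGenerator a := by
  have : A = leftMul (-a) := LinearMap.ext fun φ => doublets_injective (by
    rw [h, doublets_leftMul])
  rw [this]
  rfl

lemma H1_eq : H1 = toGenerator (su2 ![-2, 0, 0]) := by
  refine linearScalarGenerator_eq_toGenerator fun φ => ?_
  ext i k
  fin_cases i <;> fin_cases k <;> apply Complex.ext <;>
    simp [doublets, signedPerm, su2_apply, Matrix.mul_apply, Fin.sum_univ_two]

lemma H2_eq : H2 = toGenerator (su2 ![0, 2, 0]) := by
  refine linearScalarGenerator_eq_toGenerator fun φ => ?_
  ext i k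
  fin_cases i <;> fin_cases k <;> apply Complex.ext <;>
    simp [doublets, signedPerm, su2_apply, Matrix.mul_apply, Fin.sum_univ_two]

lemma H3_eq : H3 = toGenerator (su2 ![0, 0, -2]) := by
  refine linearScalarGenerator_eq_toGenerator fun φ => ?_
  ext i k
  fin_cases i <;> fin_cases k <;> apply Complex.ext <;>
    simp [doublets, signedPerm, su2_apply, Matrix.mul_apply, Fin.sum_univ_two]

lemma XY_eq : XY = toGenerator (-iOne) := by
  refine linearScalarGenerator_eq_toGenerator fun φ => ?_
  ext i k
  fin_cases i <;> fin_cases k <;> apply Complex.ext <;>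
    simp [doublets, signedPerm, iOne]

lemma span_iOne : Submodule.span ℝ {iOne} = Submodule.span ℝ {-iOne} := by
  rw [← Set.neg_singleton, Submodule.span_neg]

lemma standardAlgebra_eq (t : AlgebraType) : standardAlgebra t =
    (centralExtension (standardPart t)).map (toGenerator : _ →ₗ[ℝ] PointGenerator) := by
  have h3 : Submodule.span ℝ {![(0 : ℝ), 0, 1]} = Submodule.span ℝ {![0, 0, -2]} := by
    refine le_antisymm ?_ ?_ <;>
      rw [Submodule.span_singleton_le_iff_mem, Submodule.mem_span_singleton]
    · exact ⟨-1 / 2, by simp⟩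
    · exact ⟨-2, by simp⟩
  have h123 : (⊤ : Submodule ℝ (Fin 3 → ℝ)) =
      Submodule.span ℝ {![-2, 0, 0], ![0, 2, 0], ![0, 0, -2]} := by
    refine (eq_top_iff.2 fun n _ => Submodule.mem_span_triple.2
      ⟨-n 0 / 2, n 1 / 2, -n 2 / 2, ?_⟩).symm
    funext i
    fin_cases i <;> simp
  cases t
  · rw [standardPart, h123, centralExtension, span_iOne, Submodule.map_span, ← Submodule.span_union,
      Submodule.map_span, standardAlgebra, H1_eq, H2_eq, H3_eq, XY_eq]
    simp only [Set.image_union, Set.image_insert_eq, Set.image_singleton, LieHom.coe_toLinearMap]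
    rw [Set.union_comm, Set.insert_union, Set.insert_union, Set.singleton_union]
  · rw [standardPart, h3, centralExtension, span_iOne, Submodule.map_span, ← Submodule.span_union,
      Submodule.map_span, standardAlgebra, H3_eq, XY_eq]
    simp only [Set.image_union, Set.image_singleton, LieHom.coe_toLinearMap]
    rw [Set.union_comm, Set.singleton_union]
  · rw [standardPart, centralExtension, span_iOne, Submodule.map_bot, sup_bot_eq,
      Submodule.map_span, standardAlgebra, XY_eq]
    simp only [Set.image_singleton, LieHom.coe_toLinearMap]

lemma scalarSymmetries_eq_standardAlgebra_iff {c : Gauge} (hg : c.g ≠ 0) (hg' : c.g' ≠ 0)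
    (hY : c.Y ≠ 0) {p : Potential} {t : AlgebraType} :
    scalarSymmetries c p = (standardAlgebra t : Set PointGenerator) ↔ IsStandard p t := by
  rw [scalarSymmetries_eq_image hg hg' hY, standardAlgebra_eq, Submodule.map_coe,
    LieHom.coe_toLinearMap, toGenerator_injective.image_injective.eq_iff, IsStandard]
  exact SetLike.coe_set_eq (p := (invarianceAlgebra p).toSubmodule)

/-! ### The isomorphism types -/

/-- The Lie algebra of scalar symmetries. -/
def symmetryAlgebra (p : Potential) : LieSubalgebra ℝ PointGenerator :=
  (invarianceAlgebra p).map toGenerator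

lemma coe_symmetryAlgebra {c : Gauge} (hg : c.g ≠ 0) (hg' : c.g' ≠ 0) (hY : c.Y ≠ 0)
    (p : Potential) : (symmetryAlgebra p : Set PointGenerator) = scalarSymmetries c p :=
  (scalarSymmetries_eq_image hg hg' hY p).symm

/-- Injective homomorphisms onto the algebra of invariances identify the symmetry algebra up to
isomorphism. -/
lemma nonempty_equiv_symmetryAlgebra {L : Type*} [LieRing L] [LieAlgebra ℝ L] {p : Potential}
    (f : L →ₗ⁅ℝ⁆ Matrix (Fin 2) (Fin 2) ℂ) (hf : Function.Injective f)
    (h : ∀ a, a ∈ invarianceAlgebra p ↔ ∃ x, f x = a) : Nonempty (symmetryAlgebra p ≃ₗ⁅ℝ⁆ L) := by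
  have e : (((toGenerator.comp f).range : LieSubalgebra ℝ PointGenerator) : Set PointGenerator) =
      symmetryAlgebra p := by
    ext X
    constructor
    · rintro ⟨x, rfl⟩
      exact ⟨f x, (h _).2 ⟨x, rfl⟩, rfl⟩
    · rintro ⟨a, ha, rfl⟩
      obtain ⟨x, rfl⟩ := (h a).1 ha
      exact ⟨x, rfl⟩
  exact ⟨((LieEquiv.ofInjective (toGenerator.comp f)
    (toGenerator_injective.comp hf)).trans (LieEquiv.ofEq _ _ e)).symm⟩

/-- The coordinate of `u(1)`. -/
def uOneCoord : uAlg 1 ≃ₗ[ℝ] ℝ where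
  toFun a := (a.1 0 0).im
  map_add' a b := by simp
  map_smul' r a := by simp
  invFun s := ⟨!![Complex.I * s], by
    change (!![Complex.I * (s : ℂ)])ᴴ = -!![Complex.I * (s : ℂ)]
    ext i k
    fin_cases i
    fin_cases k
    simp⟩
  left_inv a := by
    have h : star (a.1 0 0) = -a.1 0 0 := congrFun (congrFun a.2 0) 0
    refine Subtype.ext (Matrix.ext fun i k => ?_)
    fin_cases i
    fin_cases k
    simp only [Complex.ext_iff, Complex.star_def, Complex.conj_re, Complex.neg_re] at h
    apply Complex.ext
    · simp
      linarith
    · simp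
  right_inv s := by simp

lemma uOne_lie (a b : uAlg 1) : ⁅a, b⁆ = 0 := by
  refine Subtype.ext (Matrix.ext fun i k => ?_)
  fin_cases i
  fin_cases k
  change (a.1 * b.1 - b.1 * a.1) 0 0 = 0
  simp [Matrix.mul_apply, mul_comm]

/-- The dimensions of the three algebras. -/
def AlgebraType.dim : AlgebraType → ℕ
  | .su2u1 => 4
  | .u1u1 => 2
  | .u1 => 1

lemma AlgebraType.dim_injective : Function.Injective AlgebraType.dim := by
  intro t t' h
  cases t <;> cases t' <;> first | rfl | simp [AlgebraType.dim] at h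

/-- The coordinates of `su(2)`. -/
def suTwoEquiv : (Fin 3 → ℝ) ≃ₗ[ℝ] suAlg 2 :=
  LinearEquiv.ofBijective
    (LinearMap.codRestrict (suAlg 2).toSubmodule su2 fun n => ⟨su2_conjTranspose n, su2_trace n⟩)
    ⟨fun n m h => su2_injective (congrArg Subtype.val h), fun a => by
      obtain ⟨s, n, h⟩ : ∃ (s : ℝ) (n : Fin 3 → ℝ), a.1 = s • iOne + su2 n :=
        ⟨_, _, exists_eq_of_skew a.2.1⟩
      have h1 := a.2.2
      rw [h, Matrix.trace_add, su2_trace, add_zero, Matrix.trace_smul] at h1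
      have hs : s = 0 := by simpa [iOne, Complex.ext_iff] using h1
      exact ⟨n, Subtype.ext (by rw [h, hs, zero_smul, zero_add]; rfl)⟩⟩

lemma finrank_uOne : Module.finrank ℝ (uAlg 1) = 1 := by
  rw [uOneCoord.finrank_eq, Module.finrank_self]

lemma finrank_suTwo : Module.finrank ℝ (suAlg 2) = 3 := by
  rw [← suTwoEquiv.finrank_eq, Module.finrank_fin_fun]

lemma IsOfType.finrank_eq {𝔞 : LieSubalgebra ℝ PointGenerator} {t : AlgebraType}
    (h : IsOfType 𝔞 t) : Module.finrank ℝ 𝔞 = t.dim := by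
  have : FiniteDimensional ℝ (uAlg 1) := Module.finite_of_finrank_pos (by simp [finrank_uOne])
  have : FiniteDimensional ℝ (suAlg 2) := Module.finite_of_finrank_pos (by simp [finrank_suTwo])
  cases t
  · obtain ⟨e⟩ := h
    rw [e.toLinearEquiv.finrank_eq, Module.finrank_prod, finrank_uOne, finrank_suTwo]
    rfl
  · obtain ⟨e⟩ := h
    rw [e.toLinearEquiv.finrank_eq, Module.finrank_prod, finrank_uOne]
    rfl
  · obtain ⟨e⟩ := h
    rw [e.toLinearEquiv.finrank_eq, finrank_uOne]
    rfl

lemma IsOfType.unique {𝔞 : LieSubalgebra ℝ PointGenerator} {t t' : AlgebraType}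
    (h : IsOfType 𝔞 t) (h' : IsOfType 𝔞 t') : t = t' :=
  AlgebraType.dim_injective (h.finrank_eq.symm.trans h'.finrank_eq)

lemma mem_invarianceAlgebra_iff_of_isStandard {p : Potential} {t : AlgebraType}
    (h : IsStandard p t) {a : Matrix (Fin 2) (Fin 2) ℂ} :
    a ∈ invarianceAlgebra p ↔ ∃ s : ℝ, ∃ n ∈ standardPart t, a = s • iOne + su2 n := by
  rw [← LieSubalgebra.mem_toSubmodule, h, mem_centralExtension]

lemma lie_iOne_su2 (s s' : ℝ) (n n' : Fin 3 → ℝ) :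
    ⁅s • iOne + su2 n, s' • iOne + su2 n'⁆ = su2 (crossProduct n n') := by
  rw [su2_cross]
  change (s • iOne + su2 n) * (s' • iOne + su2 n') - (s' • iOne + su2 n') * (s • iOne + su2 n) = _
  simp only [add_mul, mul_add, smul_mul_assoc, mul_smul_comm, ← iOne_mul_comm (su2 _),
    smul_add]
  module

/-- The coordinates of `u(1)` and `su(2)` give injective homomorphisms from the abstract Lie algebras
onto the algebra of invariances. -/
lemma IsStandard.isOfType {p : Potential} {t : AlgebraType} (h : IsStandard p t) :
    IsOfType (symmetryAlgebra p) t := by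
  have hmem := fun a => mem_invarianceAlgebra_iff_of_isStandard h (a := a)
  cases t
  · let f : suAlg 2 × uAlg 1 →ₗ⁅ℝ⁆ Matrix (Fin 2) (Fin 2) ℂ :=
      { toFun := fun x => uOneCoord x.2 • iOne + su2 (suTwoEquiv.symm x.1)
        map_add' := fun x y => by
          simp only [Prod.fst_add, Prod.snd_add, map_add, add_smul]
          abel
        map_smul' := fun r x => by
          simp only [Prod.smul_fst, Prod.smul_snd, map_smul, smul_add, smul_assoc,
            RingHom.id_apply]
        map_lie' := fun {x y} => by
          have h1 : ∀ b : suAlg 2, su2 (suTwoEquiv.symm b) = b.1 := fun b =>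
            congrArg Subtype.val (suTwoEquiv.apply_symm_apply b)
          change uOneCoord ⁅x.2, y.2⁆ • iOne + su2 (suTwoEquiv.symm ⁅x.1, y.1⁆) = _
          rw [lie_iOne_su2, su2_cross, uOne_lie, map_zero, zero_smul, zero_add, h1, h1, h1]
          rfl }
    refine nonempty_equiv_symmetryAlgebra f ?_ fun a => ?_
    · rw [injective_iff_map_eq_zero]
      intro x hx
      obtain ⟨h1, h2⟩ := smul_iOne_add_su2_eq_zero hx
      exact Prod.ext ((LinearEquiv.map_eq_zero_iff _).1 h2) ((LinearEquiv.map_eq_zero_iff _).1 h1)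
    · rw [hmem]
      constructor
      · rintro ⟨s, n, -, rfl⟩
        exact ⟨(suTwoEquiv n, uOneCoord.symm s), by simp [f]⟩
      · rintro ⟨x, rfl⟩
        exact ⟨_, _, Submodule.mem_top, rfl⟩
  · let f : uAlg 1 × uAlg 1 →ₗ⁅ℝ⁆ Matrix (Fin 2) (Fin 2) ℂ :=
      { toFun := fun x => uOneCoord x.2 • iOne + su2 (uOneCoord x.1 • ![0, 0, 1])
        map_add' := fun x y => by
          simp only [Prod.fst_add, Prod.snd_add, map_add, add_smul]
          abel
        map_smul' := fun r x => by
          simp only [Prod.smul_fst, Prod.smul_snd, map_smul, smul_add, smul_assoc,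
            RingHom.id_apply]
        map_lie' := fun {x y} => by
          rw [lie_iOne_su2]
          change uOneCoord ⁅x.2, y.2⁆ • iOne + su2 (uOneCoord ⁅x.1, y.1⁆ • ![0, 0, 1]) = _
          rw [uOne_lie, uOne_lie, map_zero, zero_smul, zero_smul, map_zero, zero_add, map_smul,
            LinearMap.map_smul₂, cross_self, smul_zero, smul_zero, map_zero] }
    refine nonempty_equiv_symmetryAlgebra f ?_ fun a => ?_
    · rw [injective_iff_map_eq_zero]
      intro x hx
      obtain ⟨h1, h2⟩ := smul_iOne_add_su2_eq_zero hx
      have h3 : uOneCoord x.1 = 0 := by simpa using congrFun h2 2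
      exact Prod.ext ((LinearEquiv.map_eq_zero_iff _).1 h3) ((LinearEquiv.map_eq_zero_iff _).1 h1)
    · rw [hmem]
      constructor
      · rintro ⟨s, n, hn, rfl⟩
        obtain ⟨q, rfl⟩ := Submodule.mem_span_singleton.1 hn
        exact ⟨(uOneCoord.symm q, uOneCoord.symm s), by simp [f]⟩
      · rintro ⟨x, rfl⟩
        exact ⟨_, _, Submodule.smul_mem _ _ (Submodule.mem_span_singleton_self _), rfl⟩
  · let f : uAlg 1 →ₗ⁅ℝ⁆ Matrix (Fin 2) (Fin 2) ℂ :=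
      { toFun := fun x => uOneCoord x • iOne + su2 0
        map_add' := fun x y => by simp [add_smul]
        map_smul' := fun r x => by simp [smul_smul]
        map_lie' := fun {x y} => by
          rw [lie_iOne_su2]
          simp [uOne_lie] }
    refine nonempty_equiv_symmetryAlgebra f ?_ fun a => ?_
    · rw [injective_iff_map_eq_zero]
      intro x hx
      exact (LinearEquiv.map_eq_zero_iff _).1 (smul_iOne_add_su2_eq_zero hx).1
    · rw [hmem]
      constructor
      · rintro ⟨s, n, hn, rfl⟩
        rw [(Submodule.mem_bot ℝ).1 hn]
        exact ⟨uOneCoord.symm s, by simp [f]⟩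
      · rintro ⟨x, rfl⟩
        exact ⟨_, _, Submodule.zero_mem _, rfl⟩

/-- Conjugation by a change of the Higgs basis, as a homomorphism of Lie algebras. -/
def IsBasisChange.conjHom {W : Matrix (Fin 2) (Fin 2) ℂ} {p p' : Potential}
    (h : IsBasisChange W p p') : invarianceAlgebra p' →ₗ⁅ℝ⁆ Matrix (Fin 2) (Fin 2) ℂ where
  toFun a := Wᴴ * a.1 * W
  map_add' a b := by
    change Wᴴ * (a.1 + b.1) * W = _
    rw [Matrix.mul_add, Matrix.add_mul]
  map_smul' r a := by
    change Wᴴ * (r • a.1) * W = r • (Wᴴ * a.1 * W)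
    rw [Matrix.mul_smul, Matrix.smul_mul]
  map_lie' := fun {a b} => by
    have h1 : ∀ x y : Matrix (Fin 2) (Fin 2) ℂ,
        Wᴴ * x * W * (Wᴴ * y * W) = Wᴴ * (x * y) * W := by
      intro x y
      have h2 : W * Wᴴ = 1 := Matrix.mem_unitaryGroup_iff.1 h.1
      calc Wᴴ * x * W * (Wᴴ * y * W) = Wᴴ * x * (W * Wᴴ) * y * W := by
            simp only [Matrix.mul_assoc]
        _ = Wᴴ * (x * y) * W := by rw [h2, Matrix.mul_one, Matrix.mul_assoc Wᴴ]
    change Wᴴ * (a.1 * b.1 - b.1 * a.1) * W =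
      Wᴴ * a.1 * W * (Wᴴ * b.1 * W) - Wᴴ * b.1 * W * (Wᴴ * a.1 * W)
    rw [h1, h1, Matrix.mul_sub, Matrix.sub_mul]

lemma IsBasisChange.nonempty_equiv {W : Matrix (Fin 2) (Fin 2) ℂ} {p p' : Potential}
    (h : IsBasisChange W p p') : Nonempty (symmetryAlgebra p ≃ₗ⁅ℝ⁆ invarianceAlgebra p') := by
  have hW := Matrix.conjTranspose_conjTranspose W
  refine nonempty_equiv_symmetryAlgebra h.conjHom (fun a b hab => Subtype.ext ?_) fun a =>
    ⟨fun ha => ⟨⟨_, h.conj_mem ha⟩, h.conj_conj a⟩, ?_⟩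
  · have h1 : Wᴴ * a.1 * W = Wᴴ * b.1 * W := hab
    have h2 := h.symm.conj_conj
    rw [hW] at h2
    rw [← h2 a.1, h1, h2]
  · rintro ⟨b, rfl⟩
    have h1 := h.symm.conj_mem b.2
    rwa [hW] at h1

/-- The isomorphism type does not depend on the Higgs basis. -/
lemma IsBasisChange.isOfType {W : Matrix (Fin 2) (Fin 2) ℂ} {p p' : Potential}
    (h : IsBasisChange W p p') {t : AlgebraType} (ht : IsOfType (symmetryAlgebra p') t) :
    IsOfType (symmetryAlgebra p) t := by
  obtain ⟨e⟩ := h.nonempty_equiv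
  obtain ⟨e'⟩ := (isBasisChange_one p').nonempty_equiv
  cases t <;> obtain ⟨f⟩ := ht <;> exact ⟨(e.trans e'.symm).trans f⟩

/-! ### Potentials realizing the three types -/

lemma isStandard_of_mem_su2Part {p : Potential} {t : AlgebraType}
    (h : ∀ n, n ∈ su2Part p ↔ n ∈ standardPart t) : IsStandard p t := by
  rw [IsStandard, invarianceAlgebra_eq, SetLike.ext h]

lemma mem_su2Part {p : Potential} {n : Fin 3 → ℝ} :
    n ∈ su2Part p ↔ ∀ φ, fderiv ℝ (potU p) φ (leftMul (su2 n) φ) = 0 :=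
  ⟨fun h => h.2, fun h => ⟨su2_conjTranspose n, h⟩⟩

/-- The zero potential. -/
def zeroPotential : Potential := ⟨0, 0, 0, 0, 0, 0, 0, 0, 0, 0⟩

/-- The potential `|Φ₁|² + κ Re (Φ₁†Φ₂)²`. -/
def examplePotential (κ : ℝ) : Potential := ⟨1, 0, 0, 0, 0, 0, 0, κ, 0, 0⟩

lemma isStandard_zeroPotential : IsStandard zeroPotential .su2u1 :=
  isStandard_of_mem_su2Part fun n => by
    have e : potU zeroPotential = fun _ => 0 := by
      funext φ
      simp [potU, zeroPotential, Potential.V]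
    simp [mem_su2Part, e, standardPart]

lemma fderiv_examplePotential (κ : ℝ) (n : Fin 3 → ℝ) (φ : Fin 8 → ℝ) :
    fderiv ℝ (potU (examplePotential κ)) φ (leftMul (su2 n) φ) =
      n 0 * bilinears (doublets φ) 3 - n 1 * bilinears (doublets φ) 2 +
        κ * ((bilinears (doublets φ) 0 - bilinears (doublets φ) 1) *
          (n 1 * bilinears (doublets φ) 2 + n 0 * bilinears (doublets φ) 3) -
          4 * n 2 * bilinears (doublets φ) 2 * bilinears (doublets φ) 3) := by
  have h1 := hasDerivAt_potU_leftMul (examplePotential κ) (su2 n) φ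
  have e : ∀ Φ, (examplePotential κ).V Φ =
      bilinears Φ 0 + κ * (bilinears Φ 2 ^ 2 - bilinears Φ 3 ^ 2) := by
    intro Φ
    rw [V_eq]
    generalize bilinears Φ = r
    simp [linCoeff, quadCoeff, examplePotential, dotProduct, Matrix.mulVec, Fin.sum_univ_four]
    ring
  simp only [e] at h1
  have h2 := hasDerivAt_pi.1 (hasDerivAt_bilinears_su2 n (doublets φ))
  refine (h1.unique ((h2 0).add ((((h2 2).pow 2).sub ((h2 3).pow 2)).const_mul κ))).trans ?_
  simp [-mul_eq_mul_left_iff]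
  ring

/-- The bilinears of `Φ₁ = (1, 0)`, `Φ₂ = (z, 0)`. -/
lemma exists_bilinears_eq (z : ℂ) :
    ∃ φ, bilinears (doublets φ) = ![1, z.re ^ 2 + z.im ^ 2, z.re, z.im] := by
  refine ⟨doubletsEquiv.symm !![1, 0; z, 0], ?_⟩
  rw [← doubletsEquiv_apply, LinearEquiv.apply_symm_apply]
  funext i
  fin_cases i <;> simp [bilinears, dotProduct, Fin.sum_univ_two, pow_two]

lemma isStandard_examplePotential_zero : IsStandard (examplePotential 0) .u1u1 :=
  isStandard_of_mem_su2Part fun n => by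
    simp only [mem_su2Part, fderiv_examplePotential, standardPart, Submodule.mem_span_singleton,
      zero_mul, add_zero]
    constructor
    · intro h
      obtain ⟨φ, hφ⟩ := exists_bilinears_eq 1
      obtain ⟨ψ, hψ⟩ := exists_bilinears_eq Complex.I
      have h1 := h φ
      have h2 := h ψ
      rw [hφ] at h1
      rw [hψ] at h2
      simp at h1 h2
      refine ⟨n 2, funext fun i => ?_⟩
      fin_cases i <;> simp [h1, h2]
    · rintro ⟨r, rfl⟩ φ
      simp

lemma isStandard_examplePotential_one : IsStandard (examplePotential 1) .u1 :=
  isStandard_of_mem_su2Part fun n => by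
    simp only [mem_su2Part, fderiv_examplePotential, standardPart, Submodule.mem_bot, one_mul]
    constructor
    · intro h
      obtain ⟨φ, hφ⟩ := exists_bilinears_eq 1
      obtain ⟨ψ, hψ⟩ := exists_bilinears_eq Complex.I
      obtain ⟨χ, hχ⟩ := exists_bilinears_eq (1 + Complex.I)
      have h1 := h φ
      have h2 := h ψ
      have h3 := h χ
      rw [hφ] at h1
      rw [hψ] at h2
      rw [hχ] at h3
      simp at h1 h2 h3
      funext i
      fin_cases i
      · exact h2
      · exact h1
      · simp
        linarith
    · rintro rfl φ
      simp

/-- All three types occur. -/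
lemma exists_isStandard_of_type (t : AlgebraType) : ∃ p, IsStandard p t := by
  cases t
  · exact ⟨_, isStandard_zeroPotential⟩
  · exact ⟨_, isStandard_examplePotential_zero⟩
  · exact ⟨_, isStandard_examplePotential_one⟩

end THDM

end

open THDM

theorem mainTheorem4 (c : Gauge) (hg : c.g ≠ 0) (hg' : c.g' ≠ 0) (hY : c.Y ≠ 0)
    (hs : c.s = 1 ∨ c.s = -1) :
    -- every model has a symmetry algebra of exactly one of the three types, up to a basis change
    (∀ p : Potential, ∃ 𝔞 : LieSubalgebra ℝ PointGenerator,
      (𝔞 : Set PointGenerator) = scalarSymmetries c p ∧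
      ∃ t : AlgebraType,
        (∀ t', IsOfType 𝔞 t' ↔ t' = t) ∧
        (∀ t', (∃ U p', IsBasisChange U p p' ∧
            scalarSymmetries c p' = (standardAlgebra t' : Set PointGenerator)) ↔ t' = t)) ∧
    -- all three types occur
    (∀ t : AlgebraType, ∃ p : Potential,
      scalarSymmetries c p = (standardAlgebra t : Set PointGenerator)) ∧
    -- the three kinds of scalar symmetries coincide
    (∀ (p : Potential) (X : PointGenerator), IsScalar X →
      (IsELSymmetry (lagrangian c p) X ↔ IsStrictlyVariational (lagrangian c p) X) ∧
      (IsVariational (lagrangian c p) X ↔ IsStrictlyVariational (lagrangian c p) X) ∧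
      ¬ IsDivergenceSymmetry (lagrangian c p) X ∧
      ¬ IsNonVariationalSymmetry (lagrangian c p) X) := by
  refine ⟨fun p => ?_, fun t => ?_, fun p X hX => ?_⟩
  · obtain ⟨t, W, q, hW, hq⟩ := exists_isStandard p
    have ht : IsOfType (symmetryAlgebra p) t := hW.isOfType hq.isOfType
    refine ⟨symmetryAlgebra p, coe_symmetryAlgebra hg hg' hY p, t, fun t' => ?_, fun t' => ?_⟩
    · exact ⟨fun h => h.unique ht, fun h => h ▸ ht⟩
    · simp only [scalarSymmetries_eq_standardAlgebra_iff hg hg' hY]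
      constructor
      · rintro ⟨W', q', hW', hq'⟩
        exact (hW'.isOfType hq'.isOfType).unique ht
      · rintro rfl
        exact ⟨W, q, hW, hq⟩
  · simp only [scalarSymmetries_eq_standardAlgebra_iff hg hg' hY]
    exact exists_isStandard_of_type t
  · have h1 := fun h => hX.isStrictlyVariational hg' hY (c := c) (p := p) h
    have h2 := fun h => hX.isELSymmetry (c := c) (p := p) h
    exact ⟨⟨h1, fun h => h2 h.isVariational⟩, ⟨fun h => h1 (h2 h), fun h => h.isVariational⟩,
      fun h => h.2 (h1 (h2 h.1)), fun h => h.2 (h1 h.1).isVariational⟩
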